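/- Let $R$ be the hyperbolic rectangle (Lambert quadrilateral) with three angles $\pi/2$, one ideal vertex (angle $0$), and two finite sides, both of length $\sinh^{-1}(1)$; concretely, in the upper half-plane $\mathbb{H}^2$, $R=\{z: 0\le \operatorname{Re} z\le\sqrt2,\ |z|\ge 1,\ |z-\sqrt2|\ge 1\}$, with ideal vertex $\infty$. Take copies $R_{m,n}$ of $R$, $m,n\in\mathbb{Z}$, arranged combinatorially like the unit squares $[m,m+1]\times[n,n+1]$ of the plane, and glue neighbouring copies isometrically as mirror images in their common side (corresponding points of that side are identified): $R_{m,n}$ and $R_{m+1,n}$ share the infinite side on $\operatorname{Re} z=0$ if $m$ is odd and the opposite finite side, on $|z-\sqrt2|=1$, if $m$ is even; $R_{m,n}$ and $R_{m,n+1}$ share the infinite side on $\operatorname{Re} z=\sqrt2$ if $n$ is odd and the opposite finite side, on $|z|=1$, if $n$ is even. Thus four rectangles meet at every finite vertex (total angle $2\pi$) and at every ideal vertex. Let $X$ be the resulting space (the Basmajian–Parlier–Vlamis surface), with the hyperbolic structure for which the rectangles are isometrically embedded. Then: 1. $X$ is a connected (Hausdorff) oriented hyperbolic surface, in particular a Riemann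 surface. 2. $X$ is parabolic, i.e. it has no Green's function: for no $z_0\in X$ is there a positive harmonic function $u$ on $X\setminus\{z_0\}$ with $u(z)\asymp\log\frac{1}{|z-z_0|}$ as $z\to z_0$. 3. $X$ has a bounded ideal geodesic triangulation all of whose shears are zero. Here an ideal geodesic triangulation is a locally finite family of pairwise disjoint simple complete geodesics (edges) such that every component of the complement of their union is the interior of an ideal hyperbolic triangle whose sides are edges. The shear on an edge is the number $s$ such that the two triangles adjacent along it develop isometrically, preserving orientation, onto the ideal triangles of $\mathbb{H}^2$ with vertices $-1,0,\infty$ and $0,e^{s},\infty$, the edge developing onto the geodesic from $0$ to $\infty$. The triangulation is bounded if both rays of every edge end at punctures of $X$, the number of edges incident to a puncture is bounded by a uniform constant, and the shears are bounded. 4. The covering group of $X$ is, up to conjugation, a subgroup of $PSL_2(\mathbb{Z})$: there is an orientation preserving locally isometric universal covering $\pi:\mathbb{H}^2\to X$ whose group of deck transformations is contained in $PSL_2(\mathbb{Z})$. -/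

import Mathlib

open UpperHalfPlane Set Filter Topology Asymptotics
open scoped MatrixGroups

/-! ## Hyperbolic surfaces, as spaces with an atlas of charts into the hyperbolic plane `ℍ`

Throughout, `A` is a set of charts `X → ℍ`.  The orientation preserving isometries of `ℍ` are the
maps `z ↦ g • z` with `g ∈ SL(2, ℝ)`. -/

namespace HypSurface

variable {X : Type*} [TopologicalSpace X]

/-- `A` makes `X` a connected oriented hyperbolic surface, hence a Riemann surface: the charts
cover `X` and the coordinate changes are locally orientation preserving isometries of `ℍ`. -/
structure IsHyperbolicSurface (A : Set (OpenPartialHomeomorph X ℍ)) : Prop where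
  t2 : T2Space X
  connected : ConnectedSpace X
  cover : ∀ p : X, ∃ e ∈ A, p ∈ e.source
  compatible : ∀ e ∈ A, ∀ e' ∈ A, ∀ p ∈ e.source ∩ e'.source,
    ∃ g : SL(2, ℝ), ∀ᶠ q in 𝓝 p, e' q = g • e q

/-! ### Parabolicity -/

/-- A real function on `X` is harmonic at `p` if it is harmonic at `p` in the charts. -/
def HarmonicAt (A : Set (OpenPartialHomeomorph X ℍ)) (u : X → ℝ) (p : X) : Prop :=
  ∀ e ∈ A, p ∈ e.source →
    InnerProductSpace.HarmonicAt (fun z : ℂ => u (e.symm (ofComplex z))) (e p : ℂ)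

/-- `u` is a positive harmonic function on `X ∖ {p₀}` with
`u(p) ≍ log (1 / |p - p₀|)` (in a chart) as `p → p₀`. -/
structure IsPositiveHarmonicWithLogPole (A : Set (OpenPartialHomeomorph X ℍ)) (p₀ : X)
    (u : X → ℝ) : Prop where
  harmonic : ∀ p, p ≠ p₀ → HarmonicAt A u p
  pos : ∀ p, p ≠ p₀ → 0 < u p
  pole : ∀ e ∈ A, p₀ ∈ e.source →
    u =Θ[𝓝[≠] p₀] fun p => Real.log (1 / ‖((e p : ℍ) : ℂ) - ((e p₀ : ℍ) : ℂ)‖)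

/-- `X` is parabolic: it has no Green's function.  A Green's function with pole `p₀` is a (the
smallest) positive harmonic function on `X ∖ {p₀}` with a logarithmic pole at `p₀`.  Here no
positive harmonic function with a logarithmic pole at all is allowed; in particular there is none
that satisfies, in addition, any kind of vanishing condition at the ideal boundary. -/
def IsParabolic (A : Set (OpenPartialHomeomorph X ℍ)) : Prop :=
  ¬ ∃ (p₀ : X) (u : X → ℝ), IsPositiveHarmonicWithLogPole A p₀ u

/-! ### Local isometries, geodesics, punctures -/

/-- `f`, restricted to `S ⊆ ℍ`, is an orientation preserving local isometry into `X`. -/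
def IsLocalIsometryOn (A : Set (OpenPartialHomeomorph X ℍ)) (S : Set ℍ) (f : ℍ → X) : Prop :=
  ∀ z ∈ S, ∃ e ∈ A, ∃ g : SL(2, ℝ), ∀ᶠ w in 𝓝[S] z, f w ∈ e.source ∧ e (f w) = g • w

/-- The point `x + i eᵗ` of the upper half-plane; for fixed `x` this is a unit speed geodesic
with endpoint `∞`. -/
noncomputable def verticalLine (x t : ℝ) : ℍ := ⟨⟨x, Real.exp t⟩, Real.exp_pos t⟩

/-- `γ : ℝ → X` is a complete unit speed geodesic. -/
def IsGeodesic (A : Set (OpenPartialHomeomorph X ℍ)) (γ : ℝ → X) : Prop :=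
  ∀ t, ∃ e ∈ A, ∃ g : SL(2, ℝ), ∀ᶠ s in 𝓝 t, γ s ∈ e.source ∧ e (γ s) = g • verticalLine 0 s

/-- `c` induces an isometric embedding of the cusp `{z : Im z > h} / (z ↦ z + 1)` into `X`, that
is, it uniformizes a neighbourhood of a puncture of `X`. -/
structure IsCusp (A : Set (OpenPartialHomeomorph X ℍ)) (h : ℝ) (c : ℍ → X) : Prop where
  pos : 0 < h
  isometry : IsLocalIsometryOn A {z | h < z.im} c
  eq_iff : ∀ z w : ℍ, h < z.im → h < w.im → (c z = c w ↔ ∃ k : ℤ, (w : ℂ) = z + k)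

/-- The forward ray of `γ` ends at a puncture of `X`: from some time on it is the image of a
vertical unit speed ray under a cusp uniformization. -/
def EndsAtPuncture (A : Set (OpenPartialHomeomorph X ℍ)) (γ : ℝ → X) : Prop :=
  ∃ (h : ℝ) (c : ℍ → X), IsCusp A h c ∧
    ∃ x t₀ : ℝ, ∀ᶠ t in atTop, γ t = c (verticalLine x (t + t₀))

/-! ### Ideal triangulations and shears -/

/-- The ideal triangle in `ℍ` with vertices `a < b` and `∞`, with its sides. -/
def idealTriangle (a b : ℝ) : Set ℍ :=
  {z | a ≤ z.re ∧ z.re ≤ b ∧ (b - a) / 2 ≤ ‖(z : ℂ) - (((a + b) / 2 : ℝ) : ℂ)‖}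

/-- The ideal triangle in `ℍ` with vertices `a < b` and `∞`, without its sides. -/
def openIdealTriangle (a b : ℝ) : Set ℍ :=
  {z | a < z.re ∧ z.re < b ∧ (b - a) / 2 < ‖(z : ℂ) - (((a + b) / 2 : ℝ) : ℂ)‖}

/-- The geodesic of `ℍ` with endpoints `a` and `∞`. -/
def verticalGeodesic (a : ℝ) : Set ℍ := {z | z.re = a}

/-- The geodesic of `ℍ` with endpoints `a < b`. -/
def arcGeodesic (a b : ℝ) : Set ℍ := {z | ‖(z : ℂ) - (((a + b) / 2 : ℝ) : ℂ)‖ = (b - a) / 2}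

/-- `τ` is an isometric parametrization, by the ideal triangle with vertices `a, b, ∞`, of a
triangle of the triangulation with edge set `E`: it is a local isometry, it maps the three sides
onto edges, and it maps the interior injectively onto a component of the complement of the
edges. -/
structure IsFace (A : Set (OpenPartialHomeomorph X ℍ)) (E : Set (Set X)) (a b : ℝ)
    (τ : ℍ → X) : Prop where
  isometry : IsLocalIsometryOn A (idealTriangle a b) τ
  injOn : InjOn τ (openIdealTriangle a b)
  component : ∃ p ∈ (⋃₀ E)ᶜ, τ '' openIdealTriangle a b = connectedComponentIn (⋃₀ E)ᶜ p
  side_left : τ '' verticalGeodesic a ∈ E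
  side_right : τ '' verticalGeodesic b ∈ E
  side_arc : τ '' arcGeodesic a b ∈ E

/-- `E` is the set of edges of an ideal geodesic triangulation of `X`: a locally finite set of
pairwise disjoint simple complete geodesics such that every component of the complement is the
interior of an ideal triangle whose sides are edges. -/
structure IsIdealTriangulation (A : Set (OpenPartialHomeomorph X ℍ)) (E : Set (Set X)) : Prop where
  geodesic : ∀ a ∈ E, ∃ γ : ℝ → X, IsGeodesic A γ ∧ Function.Injective γ ∧ range γ = a
  disjoint : E.PairwiseDisjoint id
  locallyFinite : LocallyFinite (fun a : E => (a : Set X))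
  faces : ∀ p ∈ (⋃₀ E)ᶜ, ∃ τ : ℍ → X, IsFace A E 0 1 τ ∧ p ∈ τ '' openIdealTriangle 0 1

/-- The shear on the edge `a` is `s`: the two triangles adjacent along `a` develop into `ℍ`, with
`a` developing to the geodesic from `0` to `∞`, as the ideal triangles with vertices `-1, 0, ∞`
and `0, eˢ, ∞`.  (The feet on `a` of the orthogeodesics from the opposite vertices `-1` and `eˢ`
are `i` and `eˢ i`, at signed distance `s`.) -/
def HasShear (A : Set (OpenPartialHomeomorph X ℍ)) (E : Set (Set X)) (a : Set X) (s : ℝ) : Prop :=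
  ∃ σ : ℍ → X,
    IsLocalIsometryOn A (idealTriangle (-1) 0 ∪ idealTriangle 0 (Real.exp s)) σ ∧
    IsFace A E (-1) 0 σ ∧ IsFace A E 0 (Real.exp s) σ ∧ σ '' verticalGeodesic 0 = a

/-- The ideal triangulation with edge set `E` is bounded: both rays of each edge end at punctures,
the number of edges (counted by their ends) incident to a puncture is uniformly bounded, and the
shears are uniformly bounded. -/
structure IsBoundedTriangulation (A : Set (OpenPartialHomeomorph X ℍ)) (E : Set (Set X)) :
    Prop where
  triangulation : IsIdealTriangulation A E
  ends : ∀ a ∈ E, ∃ γ : ℝ → X, IsGeodesic A γ ∧ Function.Injective γ ∧ range γ = a ∧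
    EndsAtPuncture A γ ∧ EndsAtPuncture A (fun t => γ (-t))
  valence : ∃ N : ℕ, ∀ (h : ℝ) (c : ℍ → X), IsCusp A h c →
    {x ∈ Ico (0 : ℝ) 1 | ∃ a ∈ E, ∀ᶠ t in atTop, c (verticalLine x t) ∈ a}.encard ≤ N
  shears : ∃ M : ℝ, ∀ a ∈ E, ∃ s : ℝ, HasShear A E a s ∧ |s| ≤ M

/-! ### The covering group -/

/-- `π : ℍ → X` is a universal covering by an orientation preserving local isometry. -/
structure IsUniformization (A : Set (OpenPartialHomeomorph X ℍ)) (π : ℍ → X) : Prop where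
  covering : IsCoveringMap π
  surjective : Function.Surjective π
  isometry : IsLocalIsometryOn A univ π

/-- The covering group of `π`: the homeomorphisms `h` of `ℍ` with `π ∘ h = π`. -/
def coveringGroup (π : ℍ → X) : Subgroup (ℍ ≃ₜ ℍ) where
  carrier := {h | ∀ z, π (h z) = π z}
  mul_mem' {a b} ha hb z := (ha (b z)).trans (hb z)
  one_mem' _ := rfl
  inv_mem' {a} ha z := by
    have h := ha (a.symm z)
    rw [a.apply_symm_apply] at h
    exact h.symm

/-- `PSL₂(ℤ)`, as the group of the Möbius transformations of `ℍ` with integral matrices of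
determinant one. -/
def modularGroup : Subgroup (ℍ ≃ₜ ℍ) where
  carrier := {h | ∃ g : SL(2, ℤ), ∀ z, h z = g • z}
  mul_mem' := by
    rintro a b ⟨g, hg⟩ ⟨k, hk⟩
    exact ⟨g * k, fun z => by rw [Homeomorph.mul_apply, hk, hg, mul_smul]⟩
  one_mem' := ⟨1, fun z => by simp⟩
  inv_mem' := by
    rintro a ⟨g, hg⟩
    refine ⟨g⁻¹, fun z => ?_⟩
    have h := hg (a.symm z)
    rw [a.apply_symm_apply] at h
    rw [eq_inv_smul_iff]
    exact h.symm

end HypSurface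

/-! ## The surface glued from rectangles -/

namespace BPV

/-- The hyperbolic rectangle with ideal vertex `∞` (angle `0`) and finite vertices `i`,
`(√2 + √2 i) / 2`, `√2 + i`.  Its sides lie on the geodesics `Re z = 0`, `|z| = 1`,
`|z - √2| = 1`, `Re z = √2`, each of which is orthogonal to the next one. -/
def rectangle : Set ℍ :=
  {z | 0 ≤ z.re ∧ z.re ≤ √2 ∧ 1 ≤ ‖(z : ℂ)‖ ∧ 1 ≤ ‖(z : ℂ) - (√2 : ℝ)‖}

/-- The vertex between the infinite side on `Re z = 0` and the finite side on `|z| = 1`. -/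
noncomputable def vertexLeft : ℍ := ⟨⟨0, 1⟩, one_pos⟩

/-- The vertex between the two finite sides. -/
noncomputable def vertexMiddle : ℍ := ⟨⟨√2 / 2, √2 / 2⟩, by positivity⟩

/-- The vertex between the finite side on `|z - √2| = 1` and the infinite side on `Re z = √2`. -/
noncomputable def vertexRight : ℍ := ⟨⟨√2, 1⟩, one_pos⟩

theorem dist_of_cosh {z w : ℍ} (h : Real.cosh (dist z w) = √2) :
    dist z w = Real.arsinh 1 := by
  apply Real.sinh_injective
  rw [Real.sinh_arsinh]
  have h2 := Real.cosh_sq (dist z w)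
  rw [h, Real.sq_sqrt (by norm_num)] at h2
  have h3 : 0 ≤ Real.sinh (dist z w) := Real.sinh_nonneg_iff.2 dist_nonneg
  nlinarith

/-- The two finite sides have length `arsinh 1`. -/
theorem finite_side_lengths :
    dist vertexLeft vertexMiddle = Real.arsinh 1 ∧
      dist vertexMiddle vertexRight = Real.arsinh 1 := by
  have h2 : √2 * √2 = 2 := Real.mul_self_sqrt (by norm_num)
  have h0 : (0 : ℝ) < √2 := by positivity
  constructor <;> apply dist_of_cosh <;> rw [cosh_dist'] <;>
    simp only [vertexLeft, vertexMiddle, vertexRight, UpperHalfPlane.re, UpperHalfPlane.im] <;>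
    field_simp <;> nlinarith

/-- The gluing of the rectangles `(m, n)`, `m, n ∈ ℤ`, each a copy of `rectangle`, arranged in the
plane in the pattern of the unit squares `[m, m + 1] × [n, n + 1]`.  Neighbouring rectangles are
mirror images of each other in their common side, so that corresponding points of the side are
identified: `(m, n)` and `(m + 1, n)` share the infinite side on `Re z = 0` if `m` is odd and the
opposite finite side if `m` is even; `(m, n)` and `(m, n + 1)` share the infinite side on
`Re z = √2` if `n` is odd and the opposite finite side if `n` is even.  So four rectangles
meet at each vertex, and likewise at each ideal vertex. -/
inductive Glue : ℤ × ℤ × rectangle → ℤ × ℤ × rectangle → Prop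
  | horizontal_infinite (k n : ℤ) (z : rectangle) (hz : (z : ℍ).re = 0) :
      Glue (2 * k - 1, n, z) (2 * k, n, z)
  | horizontal_finite (k n : ℤ) (z : rectangle) (hz : ‖((z : ℍ) : ℂ) - (√2 : ℝ)‖ = 1) :
      Glue (2 * k, n, z) (2 * k + 1, n, z)
  | vertical_infinite (m k : ℤ) (z : rectangle) (hz : (z : ℍ).re = √2) :
      Glue (m, 2 * k - 1, z) (m, 2 * k, z)
  | vertical_finite (m k : ℤ) (z : rectangle) (hz : ‖((z : ℍ) : ℂ)‖ = 1) :
      Glue (m, 2 * k, z) (m, 2 * k + 1, z)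

/-- The glued space, with the quotient topology. -/
abbrev Surface : Type := Quot Glue

/-- The inclusion of the rectangle `(m, n)` into the glued space. -/
def tile (m n : ℤ) (z : rectangle) : Surface := Quot.mk Glue (m, n, z)

/-- The hyperbolic structure for which every rectangle is isometrically embedded: the charts are
those whose restriction to each rectangle is locally (the restriction of) an isometry of `ℍ`, which
preserves the orientation if `m + n` is even and reverses it if `m + n` is odd.  (Here
`g ∈ GL₂(ℝ)` acts on `ℍ` by a Möbius transformation if `det g > 0`, and by an anti-holomorphic one
if `det g < 0`.) -/
def charts : Set (OpenPartialHomeomorph Surface ℍ) :=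
  {e | ∀ (m n : ℤ) (z : rectangle), tile m n z ∈ e.source →
    ∃ g : GL (Fin 2) ℝ, (0 < g.det.val ↔ Even (m + n)) ∧
      ∀ᶠ w in 𝓝 z, e (tile m n w) = g • (w : ℍ)}

end BPV

namespace BPV
open ComplexConjugate HypSurface

/-! The four reflections in the sides of the rectangle generate a group `reflGroup` for which the
rectangle is a strict fundamental domain, so its images tile `ℍ`. Every tile carries an index `(m,
n)` in the grid, and sending a tile to the copy of that index gives the covering `proj` of the
surface; its deck group consists of the elements of index `(0, 0)`. Two ingredients make this work.

The first is a holomorphic function `squareCoord` on `ℍ`. Its derivative is, up to a constant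
factor, `thetaForm`, a weight two form built from squares of theta values, and it turns the four
reflections into the reflections in the sides of a Euclidean unit square whose corner `0` stands for
the ideal vertex. Hence every group element acts on the coordinate by an isometry of the square
grid, which is what defines its index. The coordinate descends to the surface; morally it identifies
the surface with the plane minus the points of an even lattice. Only its symmetry and its bounded
distance from the grid position are needed.

The second is arithmetic. A group element is given by a matrix of determinant `±1` whose entries are
integers on one diagonal and integral multiples of `√2` on the other (`IsArith`), and the index
determines which of the two shapes occurs. This bounds denominators from below on the rectangle,
which proves the fundamental domain property by maximising the imaginary part. It also shows that
the deck group, conjugated by `z ↦ z / √2`, becomes integral, so the covering group lies in the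
modular group.

The triangulation is the image of the Farey tessellation: it is invariant under all modular
transformations, two adjacent Farey triangles have shear zero, and a free covering group identifies
no two points of an open triangle or of an edge. The translation by `8` lies in every modular
conjugate of the covering group, so the edges end at punctures and the valences are bounded.

For parabolicity, the logarithm of the modulus of the coordinate is a positive harmonic barrier at
infinity, and `im` is one at each cusp. With them a positive harmonic function with a pole attains
its minimum on a compact polygon in the grid (`isParabolic_charts`), and the strong minimum
principle contradicts this. -/

/-! ## A holomorphic coordinate with values in the Euclidean square lattice -/

/-- A holomorphic function on the upper half-plane has a primitive there. -/
theorem exists_primitive_upperHalfPlane {f : ℂ → ℂ} (hf : DifferentiableOn ℂ f {z | 0 < z.im}) :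
    ∃ H : ℂ → ℂ, ∀ z : ℂ, 0 < z.im → HasDerivAt H (f z) z := by
  -- The Cayley transform carries the unit disc to the half-plane; on a disc, primitives exist.
  have him : ∀ w ∈ Metric.ball (0 : ℂ) 1, 0 < (Complex.I * (1 + w) / (1 - w)).im := by
    intro w hw
    rw [mem_ball_zero_iff] at hw
    have h1 : 1 - w ≠ 0 := fun h => by
      rw [← sub_eq_zero.1 h] at hw; simp at hw
    have hn : 0 < Complex.normSq (1 - w) := Complex.normSq_pos.2 h1
    have : w.re * w.re + w.im * w.im < 1 := by
      have := Complex.normSq_eq_norm_sq w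
      rw [Complex.normSq_apply] at this
      rw [this]; nlinarith [norm_nonneg w]
    rw [Complex.div_im]
    simp only [Complex.mul_re, Complex.mul_im, Complex.I_re, Complex.I_im, Complex.add_re,
      Complex.add_im, Complex.sub_re, Complex.sub_im, Complex.one_re, Complex.one_im]
    rw [← sub_div]
    apply div_pos _ hn
    nlinarith
  have hne : ∀ w ∈ Metric.ball (0 : ℂ) 1, 1 - w ≠ 0 := by
    intro w hw h
    rw [mem_ball_zero_iff, ← sub_eq_zero.1 h] at hw; simp at hw
  obtain ⟨g, hg⟩ := DifferentiableOn.isExactOn_ball (c := 0) (r := 1)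
    (f := fun w : ℂ => f (Complex.I * (1 + w) / (1 - w)) * (2 * Complex.I / (1 - w) ^ 2)) (by
      refine DifferentiableOn.mul (hf.comp ?_ him) ?_
      · exact DifferentiableOn.div (by fun_prop) (by fun_prop) hne
      · exact DifferentiableOn.div (by fun_prop) (by fun_prop) fun w hw => pow_ne_zero 2 (hne w hw))
  refine ⟨fun z => g ((z - Complex.I) / (z + Complex.I)), fun z hz => ?_⟩
  have hzI : z + Complex.I ≠ 0 := fun h => by
    have := congrArg Complex.im h
    simp at this; linarith
  have hmem : (z - Complex.I) / (z + Complex.I) ∈ Metric.ball (0 : ℂ) 1 := by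
    rw [mem_ball_zero_iff, norm_div, div_lt_one (norm_pos_iff.2 hzI), ← sq_lt_sq₀ (norm_nonneg _)
      (norm_nonneg _), ← Complex.normSq_eq_norm_sq, ← Complex.normSq_eq_norm_sq, Complex.normSq_apply, Complex.normSq_apply]
    simp
    nlinarith
  have h1 := hg _ hmem
  have h2 : HasDerivAt (fun z : ℂ => (z - Complex.I) / (z + Complex.I)) (2 * Complex.I / (z + Complex.I) ^ 2) z := by
    have := ((hasDerivAt_id z).sub_const Complex.I).div ((hasDerivAt_id z).add_const Complex.I) hzI
    convert! this using 1
    simp; ring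
  have h3 := h1.comp z h2
  convert! h3 using 1
  have e1 : 1 - (z - Complex.I) / (z + Complex.I) = 2 * Complex.I / (z + Complex.I) := by field_simp; ring
  have e2 : Complex.I * (1 + (z - Complex.I) / (z + Complex.I)) / (1 - (z - Complex.I) / (z + Complex.I)) = z := by
    rw [e1]; field_simp; ring
  beta_reduce
  rw [e2, e1]
  field_simp

/-- The mean value inequality on the upper half-plane at a given height. -/
theorem norm_sub_le_of_deriv_le {H f : ℂ → ℂ} (hH : ∀ z : ℂ, 0 < z.im → HasDerivAt H (f z) z)
    {C : ℝ} {z : ℂ} (hz : 0 < z.im) (hC : ∀ w : ℂ, w.im = z.im → ‖f w‖ ≤ C) (t : ℝ) :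
    ‖H (z + t) - H z‖ ≤ C * |t| := by
  -- The bound is assumed at a single height only, so the mean value inequality is applied on that
  -- horizontal line.
  have hconv : Convex ℝ {w : ℂ | w.im = z.im} := by
    have : {w : ℂ | w.im = z.im} = Complex.imLm ⁻¹' {z.im} := rfl
    rw [this]; exact (convex_singleton _).is_linear_preimage Complex.imLm.isLinear
  have := hconv.norm_image_sub_le_of_norm_hasDerivWithin_le (f := H) (f' := f) (C := C)
    (x := z) (y := z + t) (fun w hw => (hH w (by rw [hw]; exact hz)).hasDerivWithinAt)
    (fun w hw => hC w hw) rfl (show (z + t).im = z.im by simp)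
  simpa using this

/-- A function with vanishing derivative on the upper half-plane is constant there. -/
theorem eq_of_deriv_eq_zero {H : ℂ → ℂ} (hH : ∀ z : ℂ, 0 < z.im → HasDerivAt H 0 z) {z w : ℂ}
    (hz : 0 < z.im) (hw : 0 < w.im) : H z = H w := by
  have hconv : Convex ℝ {w : ℂ | 0 < w.im} := convex_halfSpace_im_gt 0
  have := hconv.norm_image_sub_le_of_norm_hasDerivWithin_le (f := H) (f' := fun _ => 0) (C := 0)
    (x := w) (y := z) (fun w hw => (hH w hw).hasDerivWithinAt) (by simp) hw hz
  rw [zero_mul, norm_le_zero_iff, sub_eq_zero] at this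
  exact this

/-! ### Theta functions and the weight two form -/

theorem jacobiTheta_sq_inv {τ : ℂ} (hτ : 0 < τ.im) :
    jacobiTheta (-1 / τ) ^ 2 = -Complex.I * τ * jacobiTheta τ ^ 2 := by
  have h := jacobiTheta_S_smul ⟨τ, hτ⟩
  rw [UpperHalfPlane.modular_S_smul] at h
  have e : (-1 / τ) = (-τ)⁻¹ := by rw [inv_neg, neg_div, one_div]
  rw [e]
  simp only at h
  -- Squaring turns the half-power into an honest factor, so that no choice of branch survives.
  rw [h, mul_pow, ← Complex.cpow_nat_mul]
  norm_num

theorem jacobiTheta_neg_conj (τ : ℂ) : jacobiTheta (-conj τ) = conj (jacobiTheta τ) := by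
  rw [jacobiTheta, jacobiTheta, Complex.conj_tsum]
  refine tsum_congr fun n => ?_
  rw [← Complex.exp_conj]
  simp

/-- The exponentially small bound is weakened, by `exp x ≥ 1 + x`, to a rational one, which is all
that the later estimates need. -/
theorem norm_jacobiTheta_sub_one_le_inv {τ : ℂ} (hτ : 0 < τ.im) :
    ‖jacobiTheta τ - 1‖ ≤ 1 / τ.im := by
  have h := norm_jacobiTheta_sub_one_le hτ
  have hp : 0 < Real.pi * τ.im := mul_pos Real.pi_pos hτ
  have hpi := Real.pi_gt_three
  have he : Real.pi * τ.im + 1 ≤ Real.exp (Real.pi * τ.im) := Real.add_one_le_exp _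
  have h2 : 2 / (1 - Real.exp (-Real.pi * τ.im)) * Real.exp (-Real.pi * τ.im) ≤ 1 / τ.im := by
    rw [neg_mul, Real.exp_neg]
    have hE : 0 < Real.exp (Real.pi * τ.im) - 1 := by linarith
    have : 2 / (1 - (Real.exp (Real.pi * τ.im))⁻¹) * (Real.exp (Real.pi * τ.im))⁻¹
        = 2 / (Real.exp (Real.pi * τ.im) - 1) := by
      have := (Real.exp_pos (Real.pi * τ.im)).ne'
      field_simp
    rw [this, div_le_div_iff₀ hE hτ]
    nlinarith
  exact h.trans h2

theorem norm_jacobiTheta_le {τ : ℂ} (hτ : 0 < τ.im) : ‖jacobiTheta τ‖ ≤ 1 + 1 / τ.im := by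
  have h := norm_jacobiTheta_sub_one_le_inv hτ
  calc ‖jacobiTheta τ‖ = ‖1 + (jacobiTheta τ - 1)‖ := by ring_nf
    _ ≤ ‖(1 : ℂ)‖ + ‖jacobiTheta τ - 1‖ := norm_add_le _ _
    _ ≤ 1 + 1 / τ.im := by rw [norm_one]; linarith

/-- A modular form of weight two for the reflection group of the rectangle:
the derivative of a conformal map of the rectangle onto a Euclidean square. -/
noncomputable def thetaForm (z : ℂ) : ℂ :=
  (√2 : ℝ) * Complex.I / z * jacobiTheta ((√2 : ℝ) * z + 1) ^ 2 *
    jacobiTheta (1 - (√2 : ℝ) / z) ^ 2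

theorem sqrt_two_complex_sq : ((√2 : ℝ) : ℂ) ^ 2 = 2 := by
  rw [← Complex.ofReal_pow, Real.sq_sqrt (by norm_num)]; norm_num

theorem im_one_sub_div (z : ℂ) :
    (1 - ((√2 : ℝ) : ℂ) / z).im = √2 * z.im / Complex.normSq z := by
  rw [Complex.sub_im, Complex.div_im]; simp

theorem im_one_sub_div_pos {z : ℂ} (hz : 0 < z.im) : 0 < (1 - ((√2 : ℝ) : ℂ) / z).im := by
  rw [im_one_sub_div]
  have : 0 < Complex.normSq z := Complex.normSq_pos.2 fun h => by simp [h] at hz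
  positivity

theorem im_sqrt_mul_add_one (z : ℂ) : (((√2 : ℝ) : ℂ) * z + 1).im = √2 * z.im := by simp

theorem differentiableAt_thetaForm {z : ℂ} (hz : 0 < z.im) : DifferentiableAt ℂ thetaForm z := by
  have h0 : z ≠ 0 := fun h => by simp [h] at hz
  have h1 : 0 < (((√2 : ℝ) : ℂ) * z + 1).im := by rw [im_sqrt_mul_add_one]; positivity
  have a1 := (differentiableAt_jacobiTheta h1).comp z
    (f := fun z : ℂ => ((√2 : ℝ) : ℂ) * z + 1) (by fun_prop)
  have a2 := (differentiableAt_jacobiTheta (im_one_sub_div_pos hz)).comp z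
    (f := fun z : ℂ => 1 - ((√2 : ℝ) : ℂ) / z)
    (DifferentiableAt.sub (by fun_prop) (DifferentiableAt.div (by fun_prop) (by fun_prop) h0))
  exact ((DifferentiableAt.div (by fun_prop) (by fun_prop) h0).mul (a1.pow 2)).mul (a2.pow 2)

/-- The inversion exchanges the two theta factors, so that only the prefactor changes. -/
theorem thetaForm_inv {z : ℂ} (hz : z ≠ 0) : thetaForm (-1 / z) = -z ^ 2 * thetaForm z := by
  unfold thetaForm
  have e1 : ((√2 : ℝ) : ℂ) * (-1 / z) + 1 = 1 - (√2 : ℝ) / z := by field_simp; ring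
  have e2 : 1 - ((√2 : ℝ) : ℂ) / (-1 / z) = (√2 : ℝ) * z + 1 := by field_simp; ring
  rw [e1, e2]
  field_simp

/-- Both theta arguments go to the negatives of their conjugates, up to the period two of theta. -/
theorem thetaForm_neg_conj (z : ℂ) : thetaForm (-conj z) = conj (thetaForm z) := by
  unfold thetaForm
  have e1 : ((√2 : ℝ) : ℂ) * (-conj z) + 1 = 2 + -conj ((√2 : ℝ) * z + 1) := by
    simp; ring
  have e2 : 1 - ((√2 : ℝ) : ℂ) / (-conj z) = 2 + -conj (1 - (√2 : ℝ) / z) := by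
    simp [div_neg]; ring
  rw [e1, e2, jacobiTheta_two_add, jacobiTheta_two_add, jacobiTheta_neg_conj, jacobiTheta_neg_conj]
  simp [div_neg, neg_div]

/-- The first theta factor has period two. In the second one, `1 - √2 / (z + √2) = -1 / (-1 - √2 /
z)`, so the inversion formula applies and its automorphy factor repairs the prefactor. The remaining
factor `I` becomes the quarter turn of the square about the corner that stands for the ideal vertex.
-/
theorem thetaForm_add_sqrt_two {z : ℂ} (hz : 0 < z.im) :
    thetaForm (z + (√2 : ℝ)) = Complex.I * thetaForm z := by
  have h0 : z ≠ 0 := fun h => by simp [h] at hz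
  have h1 : z + (√2 : ℝ) ≠ 0 := fun h => by
    have := congrArg Complex.im h
    simp at this; linarith
  have hs := sqrt_two_complex_sq
  unfold thetaForm
  have e1 : ((√2 : ℝ) : ℂ) * (z + (√2 : ℝ)) + 1 = 2 + ((√2 : ℝ) * z + 1) := by
    linear_combination hs
  have e2 : 1 - ((√2 : ℝ) : ℂ) / (z + (√2 : ℝ)) = -1 / (-1 - (√2 : ℝ) / z) := by
    have : -1 - ((√2 : ℝ) : ℂ) / z = - (z + (√2 : ℝ)) / z := by field_simp; ring
    rw [this]; field_simp; ring
  have h2 : 0 < (-1 - ((√2 : ℝ) : ℂ) / z).im := by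
    have := im_one_sub_div_pos hz
    simpa using this
  have e3 : 1 - ((√2 : ℝ) : ℂ) / z = 2 + (-1 - (√2 : ℝ) / z) := by ring
  rw [e1, e2, jacobiTheta_two_add, jacobiTheta_sq_inv h2, e3, jacobiTheta_two_add]
  have : -1 - ((√2 : ℝ) : ℂ) / z = - (z + (√2 : ℝ)) / z := by field_simp; ring
  generalize jacobiTheta (-1 - (√2 : ℝ) / z) = A
  rw [this]
  field_simp

theorem norm_thetaForm_add_int_mul {z : ℂ} (hz : 0 < z.im) (n : ℤ) :
    ‖thetaForm (z + n * (√2 : ℝ))‖ = ‖thetaForm z‖ := by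
  induction n using Int.induction_on with
  | zero => simp
  | succ n ih =>
    rw [← ih, show z + ((n + 1 : ℤ) : ℂ) * (√2 : ℝ) = z + (n : ℤ) * (√2 : ℝ) + (√2 : ℝ) by
      push_cast; ring, thetaForm_add_sqrt_two (by simpa using hz), norm_mul, Complex.norm_I, one_mul]
  | pred n ih =>
    rw [← ih, show z + ((-n : ℤ) : ℂ) * (√2 : ℝ) = z + ((-n - 1 : ℤ) : ℂ) * (√2 : ℝ) + (√2 : ℝ) by
      push_cast; ring, thetaForm_add_sqrt_two (by simpa using hz), norm_mul, Complex.norm_I, one_mul]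

/-- By invariance of the modulus it suffices to look at the strip `0 ≤ re ≤ √2`. There the second
theta value grows at most linearly with the height, its square quadratically, and the prefactor
takes one power back. The bound is crude, but it starts the bootstrap of `norm_thetaForm_le_const`.
-/
theorem norm_thetaForm_le {z : ℂ} (hz : 1 / 2 ≤ z.im) : ‖thetaForm z‖ ≤ 1634 * z.im := by
  have hs2 : √2 * √2 = 2 := Real.mul_self_sqrt (by norm_num)
  have hs0 : 0 < √2 := by positivity
  have hs1 : √2 ≤ 3 / 2 := by nlinarith
  have hs3 : 1 ≤ √2 := by nlinarith
  wlog hre : 0 ≤ z.re ∧ z.re ≤ √2 generalizing z with H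
  · have hz' : 0 < z.im := by linarith
    have h1 := Int.floor_le (z.re / √2)
    have h2 := Int.lt_floor_add_one (z.re / √2)
    rw [le_div_iff₀ hs0] at h1
    rw [div_lt_iff₀ hs0] at h2
    have := H (z := z + ((-⌊z.re / √2⌋ : ℤ) : ℂ) * (√2 : ℝ)) (by simpa using hz) (by
      simp; constructor <;> nlinarith)
    rw [norm_thetaForm_add_int_mul hz'] at this
    simpa using this
  have hz' : 0 < z.im := by linarith
  have h1 : ‖jacobiTheta ((√2 : ℝ) * z + 1)‖ ≤ 3 := by
    have him : 0 < (((√2 : ℝ) : ℂ) * z + 1).im := by rw [im_sqrt_mul_add_one]; positivity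
    refine (norm_jacobiTheta_le him).trans ?_
    rw [im_sqrt_mul_add_one]
    have : 1 / (√2 * z.im) ≤ 2 := by
      rw [div_le_iff₀ (by positivity)]; nlinarith
    linarith
  have hn : Complex.normSq z = z.re * z.re + z.im * z.im := Complex.normSq_apply z
  have h2 : ‖jacobiTheta (1 - (√2 : ℝ) / z)‖ ≤ 11 * z.im := by
    refine (norm_jacobiTheta_le (im_one_sub_div_pos hz')).trans ?_
    rw [im_one_sub_div, one_div_div, hn]
    have : (z.re * z.re + z.im * z.im) / (√2 * z.im) ≤ 9 * z.im := by
      rw [div_le_iff₀ (by positivity)]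
      nlinarith [mul_nonneg hre.1 (sub_nonneg.2 hre.2)]
    linarith
  have h3 : z.im ≤ ‖z‖ := (le_abs_self _).trans (Complex.abs_im_le_norm z)
  have h4 : ‖((√2 : ℝ) : ℂ) * Complex.I / z‖ ≤ (3 / 2) / z.im := by
    rw [norm_div, norm_mul, Complex.norm_I, mul_one, Complex.norm_real, Real.norm_eq_abs,
      abs_of_pos hs0]
    gcongr
  unfold thetaForm
  rw [norm_mul, norm_mul, norm_pow, norm_pow]
  calc _ ≤ (3 / 2) / z.im * 3 ^ 2 * (11 * z.im) ^ 2 := by gcongr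
    _ = 1633.5 * z.im := by field_simp; norm_num
    _ ≤ 1634 * z.im := by nlinarith

theorem jacobiTheta_one_add_I_mul (t : ℝ) :
    ∃ a : ℝ, jacobiTheta (1 + Complex.I * t) = a := by
  have h := jacobiTheta_neg_conj (1 + Complex.I * t)
  have e : (1 + Complex.I * t) = 2 + -conj (1 + Complex.I * t) := by simp; ring
  rw [← jacobiTheta_two_add, ← e] at h
  exact ⟨_, (Complex.conj_eq_iff_real.1 h.symm).choose_spec⟩

/-- On the imaginary axis both theta arguments have real part one, where theta is real; what remains
is a product of real squares and a positive prefactor. -/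
theorem thetaForm_I_mul {y : ℝ} (hy : 0 < y) : ∃ a : ℝ, 0 ≤ a ∧ thetaForm (Complex.I * y) = a := by
  obtain ⟨a, ha⟩ := jacobiTheta_one_add_I_mul (√2 * y)
  obtain ⟨b, hb⟩ := jacobiTheta_one_add_I_mul (√2 / y)
  refine ⟨√2 / y * a ^ 2 * b ^ 2, by positivity, ?_⟩
  have hy' : (y : ℂ) ≠ 0 := by exact_mod_cast hy.ne'
  have e1 : ((√2 : ℝ) : ℂ) * (Complex.I * y) + 1 = 1 + Complex.I * ((√2 * y : ℝ) : ℂ) := by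
    push_cast; ring
  have e2 : 1 - ((√2 : ℝ) : ℂ) / (Complex.I * y) = 1 + Complex.I * ((√2 / y : ℝ) : ℂ) := by
    push_cast
    field_simp
    linear_combination (-√2 : ℂ) * Complex.I_sq
  unfold thetaForm
  rw [e1, e2, ha, hb]
  push_cast
  field_simp

/-- Both theta arguments are `1 + √2 I`, where theta differs from one by at most `1 / √2 < 1`. -/
theorem thetaForm_I_ne_zero : thetaForm Complex.I ≠ 0 := by
  have h1 : jacobiTheta (1 + Complex.I * (√2 : ℝ)) ≠ 0 := by
    intro h
    have := norm_jacobiTheta_sub_one_le_inv (τ := 1 + Complex.I * (√2 : ℝ)) (by simp)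
    rw [h] at this
    simp only [zero_sub, norm_neg, norm_one, Complex.add_im, Complex.one_im, Complex.mul_im,
      Complex.I_re, Complex.I_im, Complex.ofReal_re, Complex.ofReal_im] at this
    rw [le_div_iff₀ (by simp)] at this
    have hs2 : 1 < √2 := by rw [Real.lt_sqrt] <;> norm_num
    linarith
  unfold thetaForm
  have e2 : 1 - ((√2 : ℝ) : ℂ) / Complex.I = 1 + Complex.I * (√2 : ℝ) := by
    rw [Complex.div_I]; ring
  rw [e2, mul_comm ((√2 : ℝ) : ℂ) Complex.I, add_comm _ (1 : ℂ)]
  have : ((√2 : ℝ) : ℂ) ≠ 0 := by norm_num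
  refine mul_ne_zero (mul_ne_zero (div_ne_zero (mul_ne_zero Complex.I_ne_zero this)
    Complex.I_ne_zero) (pow_ne_zero _ h1)) (pow_ne_zero _ h1)

/-- The primitive of `thetaForm` on which `z ↦ z + √2` acts as multiplication by `i`. -/
theorem exists_thetaForm_primitive : ∃ H : ℂ → ℂ,
    (∀ z : ℂ, 0 < z.im → HasDerivAt H (thetaForm z) z) ∧
    ∀ z : ℂ, 0 < z.im → H (z + (√2 : ℝ)) = Complex.I * H z := by
  obtain ⟨H, hH⟩ := exists_primitive_upperHalfPlane (f := thetaForm)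
    fun z hz => (differentiableAt_thetaForm hz).differentiableWithinAt
  have hconst : ∀ z : ℂ, 0 < z.im → H (z + (√2 : ℝ)) - Complex.I * H z
      = H (Complex.I + (√2 : ℝ)) - Complex.I * H Complex.I := by
    intro z hz
    refine eq_of_deriv_eq_zero (H := fun z => H (z + (√2 : ℝ)) - Complex.I * H z)
      (fun w hw => ?_) hz (by simp)
    have h1 := (hH (w + (√2 : ℝ)) (by simpa using hw)).comp_add_const w ((√2 : ℝ) : ℂ)
    have h2 := h1.sub ((hH w hw).const_mul Complex.I)
    rw [thetaForm_add_sqrt_two hw, sub_self] at h2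
    exact h2
  have hI : (1 : ℂ) - Complex.I ≠ 0 := fun h => by simpa using congrArg Complex.re h
  -- A primitive is determined up to a constant; subtracting the fixed point `c / (1 - I)` of the
  -- affine map `w ↦ I w + c` makes the relation linear.
  set c := H (Complex.I + (√2 : ℝ)) - Complex.I * H Complex.I with hc
  refine ⟨fun z => H z - c / (1 - Complex.I), fun z hz => (hH z hz).sub_const _, fun z hz => ?_⟩
  have := hconst z hz
  beta_reduce
  field_simp
  linear_combination (1 - Complex.I) * this

/-! ### Decay, symmetries and non-degeneracy of the primitive -/

section
variable {H : ℂ → ℂ}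

/-- Because of the multiplier `I`, the value `H z` is the increment of `H` over a horizontal segment
of length `√2`, divided by `I - 1`; the modulus `√2` of `I - 1` cancels the length. -/
theorem norm_primitive_le_of_norm_thetaForm_le
    (hH : ∀ z : ℂ, 0 < z.im → HasDerivAt H (thetaForm z) z)
    (hT : ∀ z : ℂ, 0 < z.im → H (z + (√2 : ℝ)) = Complex.I * H z)
    {z : ℂ} (hz : 0 < z.im) {C : ℝ} (hC : ∀ w : ℂ, w.im = z.im → ‖thetaForm w‖ ≤ C) :
    ‖H z‖ ≤ C := by
  have h := norm_sub_le_of_deriv_le hH hz hC √2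
  have hn : ‖Complex.I - 1‖ = √2 := by
    rw [Complex.norm_def, Complex.normSq_apply]; norm_num
  rw [hT z hz, show Complex.I * H z - H z = (Complex.I - 1) * H z by ring, norm_mul, hn,
    abs_of_nonneg (by positivity), mul_comm C] at h
  exact le_of_mul_le_mul_left h (by positivity)

/-- Cauchy's estimate on the disc of radius `z.im / 2`. -/
theorem norm_thetaForm_le_of_norm_primitive_le
    (hH : ∀ z : ℂ, 0 < z.im → HasDerivAt H (thetaForm z) z) {z : ℂ} (hz : 0 < z.im) {C : ℝ}
    (hC : ∀ w : ℂ, z.im / 2 ≤ w.im → w.im ≤ 3 / 2 * z.im → ‖H w‖ ≤ C) :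
    ‖thetaForm z‖ ≤ C / (z.im / 2) := by
  rw [← (hH z hz).deriv]
  have him : ∀ w ∈ Metric.closedBall z (z.im / 2), z.im / 2 ≤ w.im ∧ w.im ≤ 3 / 2 * z.im := by
    intro w hw
    rw [mem_closedBall_iff_norm] at hw
    have := (Complex.abs_im_le_norm (w - z)).trans hw
    rw [Complex.sub_im, abs_le] at this
    constructor <;> linarith
  refine Complex.norm_deriv_le_of_forall_mem_sphere_norm_le (by linarith) ?_ fun w hw => ?_
  · refine DifferentiableOn.diffContOnCl fun w hw => ?_
    have := him w (Metric.closure_ball_subset_closedBall hw)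
    exact (hH w (by linarith)).differentiableAt.differentiableWithinAt
  · have := him w (Metric.sphere_subset_closedBall hw)
    exact hC w this.1 this.2

/-- Bootstrap: the linear bound on the form passes to the primitive along horizontal lines, and
Cauchy's estimate at the scale of the height gains one power of the height. The constant is `3 ·
1634`. One more round, in `norm_primitive_le_inv`, shows that the primitive tends to zero at the
cusp. -/
theorem norm_thetaForm_le_const
    (hH : ∀ z : ℂ, 0 < z.im → HasDerivAt H (thetaForm z) z)
    (hT : ∀ z : ℂ, 0 < z.im → H (z + (√2 : ℝ)) = Complex.I * H z)
    {z : ℂ} (hz : 1 / 2 ≤ z.im) : ‖thetaForm z‖ ≤ 4902 := by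
  rcases le_total z.im 1 with h1 | h1
  · have := norm_thetaForm_le hz
    linarith
  · have := norm_thetaForm_le_of_norm_primitive_le hH (z := z) (by linarith)
      (C := 1634 * (3 / 2 * z.im)) fun w hw hw' => by
        refine norm_primitive_le_of_norm_thetaForm_le hH hT (by linarith) fun v hv => ?_
        refine (norm_thetaForm_le (by linarith)).trans ?_
        rw [hv]; linarith
    refine this.trans (le_of_eq ?_)
    have : z.im ≠ 0 := by linarith
    field_simp; norm_num

theorem norm_primitive_le_const
    (hH : ∀ z : ℂ, 0 < z.im → HasDerivAt H (thetaForm z) z)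
    (hT : ∀ z : ℂ, 0 < z.im → H (z + (√2 : ℝ)) = Complex.I * H z)
    {z : ℂ} (hz : 1 / 2 ≤ z.im) : ‖H z‖ ≤ 4902 :=
  norm_primitive_le_of_norm_thetaForm_le hH hT (by linarith)
    fun _ hw => norm_thetaForm_le_const hH hT (by linarith)

theorem norm_primitive_le_inv
    (hH : ∀ z : ℂ, 0 < z.im → HasDerivAt H (thetaForm z) z)
    (hT : ∀ z : ℂ, 0 < z.im → H (z + (√2 : ℝ)) = Complex.I * H z)
    {z : ℂ} (hz : 1 ≤ z.im) : ‖H z‖ ≤ 4902 / (z.im / 2) :=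
  norm_primitive_le_of_norm_thetaForm_le hH hT (by linarith) fun w hw => by
    rw [← hw]
    exact norm_thetaForm_le_of_norm_primitive_le hH (by linarith)
      fun v hv _ => norm_primitive_le_const hH hT (by linarith)

/-- The function `conj (H (-conj z)) + H z` is constant, and the shift by `√2` multiplies it by `I`;
so it is zero. -/
theorem primitive_neg_conj
    (hH : ∀ z : ℂ, 0 < z.im → HasDerivAt H (thetaForm z) z)
    (hT : ∀ z : ℂ, 0 < z.im → H (z + (√2 : ℝ)) = Complex.I * H z)
    {z : ℂ} (hz : 0 < z.im) : H (-conj z) = -conj (H z) := by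
  have hd : ∀ w : ℂ, 0 < w.im → HasDerivAt (fun w => conj (H (-conj w)) + H w) 0 w := by
    intro w hw
    have h1 := hH (-conj w) (by simpa using hw)
    have h2 : HasDerivAt (fun v => H (-v)) (-thetaForm (-conj w)) (conj w) := by
      have := HasDerivAt.scomp (conj w) h1 (hasDerivAt_neg (conj w))
      simpa [Function.comp_def] using this
    have h3 := h2.conj_conj
    rw [Complex.conj_conj, thetaForm_neg_conj] at h3
    have h4 := h3.add (hH w hw)
    simp only [map_neg, Complex.conj_conj, neg_add_cancel] at h4
    exact h4
  have e1 := eq_of_deriv_eq_zero hd (z := z + (√2 : ℝ)) (w := z) (by simpa using hz) hz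
  have e2 := eq_of_deriv_eq_zero hd (z := z) (w := z) hz hz
  have e3 : H (-conj z) = Complex.I * H (-conj (z + (√2 : ℝ))) := by
    rw [← hT _ (by simpa using hz)]; congr 1; simp
  have e4 : H (-conj (z + (√2 : ℝ))) = -Complex.I * H (-conj z) := by
    rw [e3]; linear_combination H (-conj (z + (√2 : ℝ))) * Complex.I_sq
  simp only [e4, hT z hz, map_mul, map_neg, Complex.conj_I, neg_neg] at e1
  have hI : (1 : ℂ) - Complex.I ≠ 0 := fun h => by simpa using congrArg Complex.re h
  have e5 : conj (H (-conj z)) + H z = 0 := by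
    apply mul_left_cancel₀ hI
    linear_combination -e1
  have := congrArg conj e5
  simp only [map_add, Complex.conj_conj, map_zero] at this
  linear_combination this

/-- By weight two the derivatives of `H (-1 / z)` and `H z` cancel; the constant is read off at the
fixed point `I`. -/
theorem primitive_inv (hH : ∀ z : ℂ, 0 < z.im → HasDerivAt H (thetaForm z) z)
    {z : ℂ} (hz : 0 < z.im) : H (-1 / z) = -H z + 2 * H Complex.I := by
  have hd : ∀ w : ℂ, 0 < w.im → HasDerivAt (fun w => H (-1 / w) + H w) 0 w := by
    intro w hw
    have h0 : w ≠ 0 := fun h => by simp [h] at hw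
    have him : 0 < (-1 / w).im := by
      rw [neg_div, one_div, Complex.neg_im, Complex.inv_im, neg_div, neg_neg]
      exact div_pos hw (Complex.normSq_pos.2 h0)
    have h1 : HasDerivAt (fun w : ℂ => -1 / w) (1 / w ^ 2) w := by
      have := (hasDerivAt_inv h0).neg
      simp only [neg_neg] at this
      convert! this using 1
      · ext v; simp [neg_div]
      · simp
    have h2 := (HasDerivAt.comp w (hH _ him) h1).add (hH w hw)
    rw [thetaForm_inv h0] at h2
    convert! h2 using 1
    field_simp; ring
  have := eq_of_deriv_eq_zero hd hz (w := Complex.I) (by simp)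
  simp only [show -1 / Complex.I = Complex.I by rw [Complex.div_I]; simp] at this
  linear_combination this

/-- Along the imaginary axis the imaginary part of `H` has the nonnegative form as its derivative,
and it tends to zero at the cusp. If it vanished at `I`, it would be constant on `[1, ∞)`, against
`thetaForm_I_ne_zero`. So the square onto which the rectangle develops is not degenerate, and its
side can be normalised to one. -/
theorem primitive_I_im_ne_zero
    (hH : ∀ z : ℂ, 0 < z.im → HasDerivAt H (thetaForm z) z)
    (hT : ∀ z : ℂ, 0 < z.im → H (z + (√2 : ℝ)) = Complex.I * H z) : (H Complex.I).im ≠ 0 := by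
  set h : ℝ → ℝ := fun y => (H (Complex.I * y)).im with hh
  have hd : ∀ y : ℝ, 0 < y → HasDerivAt h (thetaForm (Complex.I * y)).re y := by
    intro y hy
    have h1 : HasDerivAt (fun y : ℝ => Complex.I * (y : ℂ)) Complex.I y := by
      simpa using (Complex.ofRealCLM.hasDerivAt (x := y)).const_mul Complex.I
    have h2 := HasDerivAt.scomp y (hH (Complex.I * y) (by simpa using hy)) h1
    have h3 := (Complex.imCLM.hasFDerivAt (x := H (Complex.I * y))).comp_hasDerivAt y h2
    simp only [smul_eq_mul, Complex.imCLM_apply, Complex.I_mul_im] at h3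
    exact h3
  have hmono : MonotoneOn h (Ici 1) := by
    refine monotoneOn_of_deriv_nonneg (convex_Ici 1) (fun y hy => ?_) (fun y hy => ?_)
      fun y hy => ?_
    · exact (hd y (lt_of_lt_of_le one_pos hy)).continuousAt.continuousWithinAt
    · rw [interior_Ici] at hy
      exact (hd y (one_pos.trans hy)).differentiableAt.differentiableWithinAt
    · rw [interior_Ici] at hy
      rw [(hd y (one_pos.trans hy)).deriv]
      obtain ⟨a, ha, e⟩ := thetaForm_I_mul (one_pos.trans hy)
      rw [e]; exact ha
  have hle : ∀ y, 1 ≤ y → h y ≤ 0 := by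
    intro y hy
    refine ge_of_tendsto (x := atTop) (f := fun t : ℝ => 4902 / (t / 2)) ?_ ?_
    · exact tendsto_const_nhds.div_atTop (tendsto_id.atTop_div_const (by norm_num))
    · filter_upwards [eventually_ge_atTop y] with t ht
      refine (hmono hy (hy.trans ht) ht).trans ?_
      have := norm_primitive_le_inv hH hT (z := Complex.I * t) (by simpa using hy.trans ht)
      simp only [Complex.mul_im, Complex.I_re, Complex.I_im, Complex.ofReal_re,
        Complex.ofReal_im] at this
      refine ((le_abs_self _).trans (Complex.abs_im_le_norm _)).trans (this.trans (le_of_eq ?_))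
      ring
  intro h0
  have h1 : h 1 = 0 := by simp [hh, h0]
  have hz : ∀ y ∈ Ici (1 : ℝ), h y = 0 := fun y hy =>
    le_antisymm (hle y hy) (h1 ▸ hmono (mem_Ici.2 le_rfl) hy hy)
  have hw := (hd 1 one_pos).hasDerivWithinAt (s := Ici 1)
  have hw' : HasDerivWithinAt h 0 (Ici 1) 1 :=
    (hasDerivWithinAt_const 1 (Ici 1) (0 : ℝ)).congr hz h1
  have e := (uniqueDiffOn_Ici (1 : ℝ) 1 (mem_Ici.2 le_rfl)).eq_deriv _ hw hw'
  obtain ⟨a, ha, e2⟩ := thetaForm_I_mul one_pos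
  rw [e2, Complex.ofReal_re] at e
  rw [e] at e2
  simp at e2
  exact thetaForm_I_ne_zero e2
end

/-- A holomorphic function on the upper half-plane that intertwines the reflections in the sides
of the rectangle with the reflections in the sides of a Euclidean square. -/
theorem exists_squareCoordinate : ∃ H : ℂ → ℂ,
    (∀ z : ℂ, 0 < z.im → DifferentiableAt ℂ H z) ∧
    (∃ C : ℝ, ∀ z : ℂ, 1 / 2 ≤ z.im → ‖H z‖ ≤ C) ∧
    (∀ z : ℂ, 0 < z.im → H (-conj z) = -conj (H z)) ∧
    (∀ z : ℂ, 0 < z.im → H (1 / conj z) = conj (H z) + 2 * Complex.I) ∧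
    (∀ z : ℂ, 0 < z.im → H ((√2 : ℝ) + 1 / (conj z - (√2 : ℝ))) = -conj (H z) - 2) ∧
    (∀ z : ℂ, 0 < z.im → H (2 * (√2 : ℝ) - conj z) = conj (H z)) := by
  obtain ⟨H, hH, hT⟩ := exists_thetaForm_primitive
  set b := (H Complex.I).im with hb
  have hb0 : b ≠ 0 := primitive_I_im_ne_zero hH hT
  have hre : (H Complex.I).re = 0 := by
    have := congrArg Complex.re (primitive_neg_conj hH hT (z := Complex.I) (by simp))
    simp at this; linarith
  have hI : H Complex.I = Complex.I * b := by
    apply Complex.ext <;> simp [hre, hb]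
  have hbc : (b : ℂ) ≠ 0 := by exact_mod_cast hb0
  -- This normalisation gives `F I = I`. The four reflections become those in the lines `re = 0`,
  -- `im = 1`, `re = -1` and `im = 0`, which bound a unit square with a corner at `0`.
  set F : ℂ → ℂ := fun z => H z / b with hF
  have f1 : ∀ z : ℂ, 0 < z.im → F (-conj z) = -conj (F z) := fun z hz => by
    simp only [hF, primitive_neg_conj hH hT hz, map_div₀, Complex.conj_ofReal]; ring
  have f2 : ∀ z : ℂ, 0 < z.im → F (-1 / z) = -F z + 2 * Complex.I := fun z hz => by
    simp only [hF, primitive_inv hH hz, hI]; field_simp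
  have f3 : ∀ z : ℂ, 0 < z.im → F (z + (√2 : ℝ)) = Complex.I * F z := fun z hz => by
    simp only [hF, hT z hz]; ring
  have f4 : ∀ z : ℂ, 0 < z.im → F (1 / conj z) = conj (F z) + 2 * Complex.I := fun z hz => by
    have : (1 : ℂ) / conj z = -1 / (-conj z) := by rw [neg_div_neg_eq]
    rw [this, f2 _ (by simpa using hz), f1 z hz, neg_neg]
  have f5 : ∀ z : ℂ, 0 < z.im → F (z - (√2 : ℝ)) = -Complex.I * F z := fun z hz => by
    have := f3 (z - (√2 : ℝ)) (by simpa using hz)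
    rw [sub_add_cancel] at this
    rw [this]; linear_combination F (z - (√2 : ℝ)) * Complex.I_sq
  refine ⟨F, fun z hz => (hH z hz).differentiableAt.div_const _, ⟨4902 / |b|, fun z hz => ?_⟩, f1, f4,
    fun z hz => ?_, fun z hz => ?_⟩
  · rw [hF]
    beta_reduce
    rw [norm_div, Complex.norm_real, Real.norm_eq_abs]
    gcongr
    exact norm_primitive_le_const hH hT hz
  · have h1 : 0 < (z - (√2 : ℝ)).im := by simpa using hz
    have h2 : 0 < (1 / conj (z - (√2 : ℝ))).im := by
      rw [one_div, Complex.inv_im, Complex.conj_im, neg_neg, Complex.normSq_conj]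
      exact div_pos h1 (Complex.normSq_pos.2 fun h => by simp [h] at h1)
    have e : ((√2 : ℝ) : ℂ) + 1 / (conj z - (√2 : ℝ)) = 1 / conj (z - (√2 : ℝ)) + (√2 : ℝ) := by
      rw [map_sub, Complex.conj_ofReal]; ring
    rw [e, f3 _ h2, f4 _ h1, f5 _ hz]
    simp only [map_mul, map_neg, Complex.conj_I, neg_neg]
    linear_combination (conj (F z) + 2) * Complex.I_sq
  · have e : 2 * ((√2 : ℝ) : ℂ) - conj z = -conj z + (√2 : ℝ) + (√2 : ℝ) := by ring
    rw [e, f3 _ (by simpa using hz), f3 _ (by simpa using hz), f1 z hz]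
    linear_combination -conj (F z) * Complex.I_sq

/-! ## The reflection group of the rectangle -/

theorem sqrt_two_mul_self : √2 * √2 = 2 := Real.mul_self_sqrt (by norm_num)

theorem one_lt_sqrt_two : 1 < √2 := by rw [Real.lt_sqrt] <;> norm_num

/-- The sides of the rectangle: on `Re z = 0`, `|z| = 1`, `|z - √2| = 1` and `Re z = √2`. -/
inductive Side
  | left
  | arcLeft
  | arcRight
  | right

/-- The matrix of the reflection in a side of the rectangle. -/
noncomputable def reflMatrix : Side → GL (Fin 2) ℝ
  | .left => Matrix.GeneralLinearGroup.mkOfDetNeZero !![-1, 0; 0, 1] (by simp)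
  | .arcLeft => Matrix.GeneralLinearGroup.mkOfDetNeZero !![0, 1; 1, 0] (by simp)
  | .arcRight => Matrix.GeneralLinearGroup.mkOfDetNeZero !![√2, -1; 1, -√2] (by norm_num)
  | .right => Matrix.GeneralLinearGroup.mkOfDetNeZero !![-1, 2 * √2; 0, 1] (by simp)

theorem det_reflMatrix (s : Side) : (reflMatrix s).det.val = -1 := by
  cases s <;> norm_num [reflMatrix, Matrix.GeneralLinearGroup.mkOfDetNeZero]

/-- The reflection in a side of the rectangle. -/
noncomputable def refl (s : Side) : ℍ ≃ₜ ℍ := Homeomorph.smul (reflMatrix s)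

theorem refl_apply (s : Side) (z : ℍ) : refl s z = reflMatrix s • z := rfl

theorem coe_refl (s : Side) (z : ℍ) :
    (refl s z : ℂ) = conj (num (reflMatrix s) z / denom (reflMatrix s) z) := by
  rw [refl_apply, UpperHalfPlane.coe_smul, σ, if_neg (by rw [det_reflMatrix]; norm_num)]
  rfl

theorem coe_refl_left (z : ℍ) : (refl .left z : ℂ) = -conj (z : ℂ) := by
  rw [coe_refl]; simp [num, denom, reflMatrix, Matrix.GeneralLinearGroup.mkOfDetNeZero]

theorem coe_refl_right (z : ℍ) : (refl .right z : ℂ) = 2 * (√2 : ℝ) - conj (z : ℂ) := by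
  rw [coe_refl]; simp [num, denom, reflMatrix, Matrix.GeneralLinearGroup.mkOfDetNeZero]
  rw [Complex.conj_ofNat]; ring

theorem coe_refl_arcLeft (z : ℍ) : (refl .arcLeft z : ℂ) = 1 / conj (z : ℂ) := by
  rw [coe_refl]; simp [num, denom, reflMatrix, Matrix.GeneralLinearGroup.mkOfDetNeZero]

theorem coe_refl_arcRight (z : ℍ) :
    (refl .arcRight z : ℂ) = (√2 : ℝ) + 1 / (conj (z : ℂ) - (√2 : ℝ)) := by
  rw [coe_refl]
  have h : conj (z : ℂ) - (√2 : ℝ) ≠ 0 := fun h => by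
    have := congrArg Complex.im h
    simp at this
    exact z.im_ne_zero this
  have hs := sqrt_two_complex_sq
  simp [num, denom, reflMatrix, Matrix.GeneralLinearGroup.mkOfDetNeZero]
  rw [← sub_eq_add_neg, ← sub_eq_add_neg, inv_eq_one_div, div_eq_iff h, add_mul,
    div_mul_cancel₀ _ h]
  linear_combination hs

theorem re_refl_left (z : ℍ) : (refl .left z).re = -z.re := by
  rw [← coe_re, coe_refl_left]; simp

theorem im_refl_left (z : ℍ) : (refl .left z).im = z.im := by
  rw [← coe_im, coe_refl_left]; simp

theorem re_refl_right (z : ℍ) : (refl .right z).re = 2 * √2 - z.re := by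
  rw [← coe_re, coe_refl_right]; simp

theorem im_refl_right (z : ℍ) : (refl .right z).im = z.im := by
  rw [← coe_im, coe_refl_right]; simp

theorem re_refl_arcLeft (z : ℍ) : (refl .arcLeft z).re = z.re / (z.re ^ 2 + z.im ^ 2) := by
  rw [← coe_re, coe_refl_arcLeft, one_div, Complex.inv_re, Complex.normSq_conj,
    Complex.normSq_apply]
  simp [sq]

theorem im_refl_arcLeft (z : ℍ) : (refl .arcLeft z).im = z.im / (z.re ^ 2 + z.im ^ 2) := by
  rw [← coe_im, coe_refl_arcLeft, one_div, Complex.inv_im, Complex.normSq_conj,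
    Complex.normSq_apply]
  simp [sq]

theorem re_refl_arcRight (z : ℍ) :
    (refl .arcRight z).re = √2 + (z.re - √2) / ((z.re - √2) ^ 2 + z.im ^ 2) := by
  rw [← coe_re, coe_refl_arcRight, Complex.add_re, one_div, Complex.inv_re, Complex.normSq_apply]
  simp [sq]

theorem im_refl_arcRight (z : ℍ) :
    (refl .arcRight z).im = z.im / ((z.re - √2) ^ 2 + z.im ^ 2) := by
  rw [← coe_im, coe_refl_arcRight, Complex.add_im, one_div, Complex.inv_im, Complex.normSq_apply]
  simp [sq]

theorem refl_mul_self (s : Side) : refl s * refl s = 1 := by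
  ext1 z
  rw [Homeomorph.mul_apply, Homeomorph.one_apply, refl_apply, refl_apply, ← mul_smul]
  have : reflMatrix s * reflMatrix s = 1 := by
    ext i j
    have := sqrt_two_mul_self
    fin_cases i <;> fin_cases j <;> cases s <;>
      simp [reflMatrix, Matrix.GeneralLinearGroup.mkOfDetNeZero, Matrix.mul_apply,
        Fin.sum_univ_two] <;> norm_num
  rw [this, one_smul]

theorem refl_refl (s : Side) (z : ℍ) : refl s (refl s z) = z := by
  rw [← Homeomorph.mul_apply, refl_mul_self]; rfl

theorem refl_inv (s : Side) : (refl s)⁻¹ = refl s := inv_eq_of_mul_eq_one_left (refl_mul_self s)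

/-- The defining function of a side of the rectangle, positive inside of the rectangle. -/
noncomputable def sideFun : Side → ℍ → ℝ
  | .left, z => z.re
  | .arcLeft, z => z.re ^ 2 + z.im ^ 2 - 1
  | .arcRight, z => (z.re - √2) ^ 2 + z.im ^ 2 - 1
  | .right, z => √2 - z.re

theorem continuous_sideFun (s : Side) : Continuous (sideFun s) := by
  have h1 := UpperHalfPlane.continuous_re
  have h2 := UpperHalfPlane.continuous_im
  cases s <;> unfold sideFun <;> fun_prop

theorem norm_coe_sub_sq (z : ℍ) (x : ℝ) :
    ‖(z : ℂ) - x‖ ^ 2 = (z.re - x) ^ 2 + z.im ^ 2 := by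
  rw [← Complex.normSq_eq_norm_sq, Complex.normSq_apply]; simp [sq]

theorem norm_coe_sq (z : ℍ) : ‖(z : ℂ)‖ ^ 2 = z.re ^ 2 + z.im ^ 2 := by
  rw [← Complex.normSq_eq_norm_sq, Complex.normSq_apply]; simp [sq]

theorem mem_rectangle_iff {z : ℍ} : z ∈ rectangle ↔ ∀ s, 0 ≤ sideFun s z := by
  have h1 : 1 ≤ ‖(z : ℂ)‖ ↔ 0 ≤ sideFun .arcLeft z := by
    rw [sideFun, ← norm_coe_sq, sub_nonneg, one_le_sq_iff₀ (norm_nonneg _)]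
  have h2 : 1 ≤ ‖(z : ℂ) - (√2 : ℝ)‖ ↔ 0 ≤ sideFun .arcRight z := by
    rw [sideFun, ← norm_coe_sub_sq, sub_nonneg, one_le_sq_iff₀ (norm_nonneg _)]
  constructor
  · rintro ⟨a, b, c, d⟩ s
    cases s
    · exact a
    · exact h1.1 c
    · exact h2.1 d
    · exact sub_nonneg.2 b
  · intro h
    exact ⟨h .left, sub_nonneg.1 (h .right), h1.2 (h .arcLeft), h2.2 (h .arcRight)⟩

/-- The group generated by the reflections in the sides of the rectangle. -/
noncomputable def reflGroup : Subgroup (ℍ ≃ₜ ℍ) := Subgroup.closure (range refl)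

theorem refl_mem (s : Side) : refl s ∈ reflGroup := Subgroup.subset_closure ⟨s, rfl⟩

theorem reflGroup_induction {p : (ℍ ≃ₜ ℍ) → Prop} (one : p 1)
    (mul : ∀ s γ, γ ∈ reflGroup → p γ → p (refl s * γ)) {γ : ℍ ≃ₜ ℍ} (hγ : γ ∈ reflGroup) : p γ := by
  refine Subgroup.closure_induction_left (p := fun γ _ => p γ) one ?_ ?_ hγ
  · rintro _ ⟨s, rfl⟩ y hy h
    exact mul s y hy h
  · rintro _ ⟨s, rfl⟩ y hy h
    rw [refl_inv]
    exact mul s y hy h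

/-! ### The square coordinate -/

/-- A holomorphic function that maps the rectangle to a Euclidean square. -/
noncomputable def squareCoord : ℂ → ℂ := exists_squareCoordinate.choose

theorem differentiableAt_squareCoord {z : ℂ} (hz : 0 < z.im) : DifferentiableAt ℂ squareCoord z :=
  exists_squareCoordinate.choose_spec.1 z hz

theorem exists_norm_squareCoord_le : ∃ C : ℝ, ∀ z : ℂ, 1 / 2 ≤ z.im → ‖squareCoord z‖ ≤ C :=
  exists_squareCoordinate.choose_spec.2.1

/-- The horizontal coordinate of a point in the pattern of unit squares. -/
noncomputable def hCoord (z : ℍ) : ℝ := -(squareCoord z).re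

/-- The vertical coordinate of a point in the pattern of unit squares. -/
noncomputable def vCoord (z : ℍ) : ℝ := (squareCoord z).im

theorem coord_refl_left (z : ℍ) :
    hCoord (refl .left z) = -hCoord z ∧ vCoord (refl .left z) = vCoord z := by
  unfold hCoord vCoord
  rw [coe_refl_left]
  have := exists_squareCoordinate.choose_spec.2.2.1 z z.im_pos
  change squareCoord _ = -conj (squareCoord z) at this
  rw [this]; simp

theorem coord_refl_arcLeft (z : ℍ) :
    hCoord (refl .arcLeft z) = hCoord z ∧ vCoord (refl .arcLeft z) = 2 - vCoord z := by
  unfold hCoord vCoord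
  rw [coe_refl_arcLeft]
  have := exists_squareCoordinate.choose_spec.2.2.2.1 z z.im_pos
  change squareCoord _ = conj (squareCoord z) + _ at this
  rw [this]; simp; ring

theorem coord_refl_arcRight (z : ℍ) :
    hCoord (refl .arcRight z) = 2 - hCoord z ∧ vCoord (refl .arcRight z) = vCoord z := by
  unfold hCoord vCoord
  rw [coe_refl_arcRight]
  have := exists_squareCoordinate.choose_spec.2.2.2.2.1 z z.im_pos
  change squareCoord _ = -conj (squareCoord z) - _ at this
  rw [this]; simp

theorem coord_refl_right (z : ℍ) :
    hCoord (refl .right z) = hCoord z ∧ vCoord (refl .right z) = -vCoord z := by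
  unfold hCoord vCoord
  rw [coe_refl_right]
  have := exists_squareCoordinate.choose_spec.2.2.2.2.2 z z.im_pos
  change squareCoord _ = conj (squareCoord z) at this
  rw [this]; simp

/-- The isometry of the real line that maps `[0, 1]` onto `[m, m + 1]` and respects the pattern of
alternating reflections. -/
noncomputable def fold (m : ℤ) (x : ℝ) : ℝ := if Even m then m + x else m + 1 - x

theorem fold_even {m : ℤ} (h : Even m) (x : ℝ) : fold m x = m + x := if_pos h

theorem fold_odd {m : ℤ} (h : ¬ Even m) (x : ℝ) : fold m x = m + 1 - x := if_neg h

theorem fold_neg (m : ℤ) (x : ℝ) : -fold m x = fold (-1 - m) x := by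
  by_cases h : Even m
  · rw [fold_even h, fold_odd (by simpa [parity_simps] using h)]; push_cast; ring
  · rw [fold_odd h, fold_even (by simpa [parity_simps] using h)]; push_cast; ring

theorem two_sub_fold (m : ℤ) (x : ℝ) : 2 - fold m x = fold (1 - m) x := by
  by_cases h : Even m
  · rw [fold_even h, fold_odd (by simpa [parity_simps] using h)]; push_cast; ring
  · rw [fold_odd h, fold_even (by simpa [parity_simps] using h)]; push_cast; ring

theorem fold_zero_one_injective {m m' : ℤ} (h0 : fold m 0 = fold m' 0) (h1 : fold m 1 = fold m' 1) :
    m = m' := by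
  by_cases h : Even m <;> by_cases h' : Even m' <;>
    simp only [fold_even, fold_odd, h, h', not_false_eq_true] at h0 h1 <;>
    (have : (m : ℝ) = m' := by linarith) <;> exact_mod_cast this

/-- `γ` maps the rectangle to a copy that is developed to the square `(m, n)`. -/
def IsIndex (γ : ℍ ≃ₜ ℍ) (m n : ℤ) : Prop :=
  ∀ z, hCoord (γ z) = fold m (hCoord z) ∧ vCoord (γ z) = fold n (vCoord z)

theorem isIndex_one : IsIndex 1 0 0 := fun z => by simp [fold]

/-- A point fixed by a reflection has a coordinate that the functional equation determines. These
four values are enough to make indices unique; no injectivity or surjectivity of the square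
coordinate is involved. -/
theorem exists_coord_values : (∃ z, hCoord z = 0) ∧ (∃ z, hCoord z = 1) ∧ (∃ z, vCoord z = 0) ∧
    ∃ z, vCoord z = 1 := by
  have e1 : refl .left UpperHalfPlane.I = UpperHalfPlane.I := by
    apply UpperHalfPlane.ext; rw [coe_refl_left]; simp
  have e2 : refl .arcLeft UpperHalfPlane.I = UpperHalfPlane.I := by
    apply UpperHalfPlane.ext; rw [coe_refl_arcLeft]; simp
  have e3 : refl .arcRight vertexRight = vertexRight := by
    apply UpperHalfPlane.ext_re_im
    · rw [re_refl_arcRight]; simp [vertexRight]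
    · rw [im_refl_arcRight]; simp [vertexRight]
  have e4 : refl .right vertexRight = vertexRight := by
    apply UpperHalfPlane.ext_re_im
    · rw [re_refl_right]; simp [vertexRight]; ring
    · rw [im_refl_right]
  refine ⟨⟨UpperHalfPlane.I, ?_⟩, ⟨vertexRight, ?_⟩, ⟨vertexRight, ?_⟩, ⟨UpperHalfPlane.I, ?_⟩⟩
  · have := (coord_refl_left UpperHalfPlane.I).1; rw [e1] at this; linarith
  · have := (coord_refl_arcRight vertexRight).1; rw [e3] at this; linarith
  · have := (coord_refl_right vertexRight).2; rw [e4] at this; linarith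
  · have := (coord_refl_arcLeft UpperHalfPlane.I).2; rw [e2] at this; linarith

theorem IsIndex.unique {γ : ℍ ≃ₜ ℍ} {m n m' n' : ℤ} (h : IsIndex γ m n) (h' : IsIndex γ m' n') :
    m = m' ∧ n = n' := by
  obtain ⟨⟨a, ha⟩, ⟨b, hb⟩, ⟨c, hc⟩, ⟨d, hd⟩⟩ := exists_coord_values
  constructor
  · apply fold_zero_one_injective
    · rw [← ha, ← (h a).1, ← (h' a).1]
    · rw [← hb, ← (h b).1, ← (h' b).1]
  · apply fold_zero_one_injective
    · rw [← hc, ← (h c).2, ← (h' c).2]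
    · rw [← hd, ← (h d).2, ← (h' d).2]

/-- The effect of the left multiplication by a reflection on the index. -/
def reflIndex : Side → ℤ × ℤ → ℤ × ℤ
  | .left, (m, n) => (-1 - m, n)
  | .arcLeft, (m, n) => (m, 1 - n)
  | .arcRight, (m, n) => (1 - m, n)
  | .right, (m, n) => (m, -1 - n)

theorem IsIndex.refl_mul {γ : ℍ ≃ₜ ℍ} {m n : ℤ} (h : IsIndex γ m n) (s : Side) :
    IsIndex (refl s * γ) (reflIndex s (m, n)).1 (reflIndex s (m, n)).2 := by
  intro z
  rw [Homeomorph.mul_apply]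
  have := h z
  cases s
  · rw [(coord_refl_left _).1, (coord_refl_left _).2, this.1, this.2]
    exact ⟨fold_neg _ _, rfl⟩
  · rw [(coord_refl_arcLeft _).1, (coord_refl_arcLeft _).2, this.1, this.2]
    exact ⟨rfl, two_sub_fold _ _⟩
  · rw [(coord_refl_arcRight _).1, (coord_refl_arcRight _).2, this.1, this.2]
    exact ⟨two_sub_fold _ _, rfl⟩
  · rw [(coord_refl_right _).1, (coord_refl_right _).2, this.1, this.2]
    exact ⟨rfl, fold_neg _ _⟩

/-! ### Arithmetic of the reflection group -/

/-- `M` is a matrix of one of the two arithmetic shapes that occur in the reflection group, for an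
element that maps the rectangle to the copy with index `(m, n)`. -/
def IsArith (M : GL (Fin 2) ℝ) (m n : ℤ) : Prop :=
  ∃ a b c d ε : ℤ, ((ε = 1 ∧ Even (m + n)) ∨ (ε = -1 ∧ ¬ Even (m + n))) ∧
    ((M.val = !![(a : ℝ), b * √2; c * √2, d] ∧ a * d - 2 * (b * c) = ε ∧ Even (b + c) ∧
      Even ((m + 1) / 2 + (n + 1) / 2)) ∨
    (M.val = !![a * √2, (b : ℝ); c, d * √2] ∧ 2 * (a * d) - b * c = ε ∧ Even (a + d) ∧
      ¬ Even ((m + 1) / 2 + (n + 1) / 2)))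

theorem isArith_one : IsArith 1 0 0 :=
  ⟨1, 0, 0, 1, 1, Or.inl ⟨rfl, by simp⟩, Or.inl ⟨by
    ext i j; fin_cases i <;> fin_cases j <;> simp, by norm_num, by simp, by simp⟩⟩

/-- Reflections in the vertical sides keep the shape of a matrix, those in the arcs exchange the two
shapes. The floor quotients keep track of this: `m ↦ -1 - m` changes the sign of `(m + 1) / 2`,
while `m ↦ 1 - m` replaces it by one minus itself. The parity condition on the coefficients of `√2`
excludes matrices such as that of `z ↦ z + √2`, which maps a tile to a neighbour without being in
the group. -/
theorem IsArith.refl_mul {M : GL (Fin 2) ℝ} {m n : ℤ} (h : IsArith M m n) (s : Side) :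
    IsArith (reflMatrix s * M) (reflIndex s (m, n)).1 (reflIndex s (m, n)).2 := by
  obtain ⟨a, b, c, d, ε, hε, h⟩ := h
  have hs1 (x : ℝ) : √2 * (x * √2) = 2 * x := by linear_combination x * sqrt_two_mul_self
  have hs2 (x : ℝ) : 2 * √2 * (x * √2) = 4 * x := by linear_combination 2 * x * sqrt_two_mul_self
  have hε' : Odd ε := by rcases hε with ⟨h, -⟩ | ⟨h, -⟩ <;> rw [h] <;> decide
  have hε2 : ((-ε = 1 ∧ Even ((reflIndex s (m, n)).1 + (reflIndex s (m, n)).2)) ∨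
      (-ε = -1 ∧ ¬ Even ((reflIndex s (m, n)).1 + (reflIndex s (m, n)).2))) := by
    rw [Int.even_iff] at hε ⊢
    cases s <;> simp only [reflIndex] <;> omega
  rcases h with ⟨hM, hdet, hev, hpar⟩ | ⟨hM, hdet, hev, hpar⟩
  -- The determinant is odd, so both integral entries of the diagonal are odd; this decides the
  -- parities after a reflection in an arc.
  · have had : Odd (a * d) := by
      rw [← hdet] at hε'
      have h2 : Even (2 * (b * c)) := even_two_mul _
      have := hε'.add_even h2
      simpa using this
    rw [Int.odd_mul, Int.odd_iff, Int.odd_iff] at had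
    rw [Int.even_iff] at hev hpar
    cases s
    · refine ⟨-a, -b, c, d, -ε, hε2, Or.inl ⟨?_, by linarith, ?_, ?_⟩⟩
      · ext i j
        fin_cases i <;> fin_cases j <;> simp [reflMatrix,
          Matrix.GeneralLinearGroup.mkOfDetNeZero, Matrix.mul_apply, Fin.sum_univ_two, hM]
      · rw [Int.even_iff]; omega
      · rw [Int.even_iff]; simp only [reflIndex]; omega
    · refine ⟨c, d, a, b, -ε, hε2, Or.inr ⟨?_, by linarith, ?_, ?_⟩⟩
      · ext i j
        fin_cases i <;> fin_cases j <;> simp [reflMatrix,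
          Matrix.GeneralLinearGroup.mkOfDetNeZero, Matrix.mul_apply, Fin.sum_univ_two, hM]
      · rw [Int.even_iff]; omega
      · rw [Int.even_iff]; simp only [reflIndex]; omega
    · refine ⟨a - c, 2 * b - d, a - 2 * c, b - d, -ε, hε2, Or.inr ⟨?_, by linarith, ?_, ?_⟩⟩
      · ext i j
        fin_cases i <;> fin_cases j <;> simp [reflMatrix,
          Matrix.GeneralLinearGroup.mkOfDetNeZero, Matrix.mul_apply, Fin.sum_univ_two, hM, hs1, hs2] <;>
          ring
      · rw [Int.even_iff]; omega
      · rw [Int.even_iff]; simp only [reflIndex]; omega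
    · refine ⟨-a + 4 * c, -b + 2 * d, c, d, -ε, hε2, Or.inl ⟨?_, by linarith, ?_, ?_⟩⟩
      · ext i j
        fin_cases i <;> fin_cases j <;> simp [reflMatrix,
          Matrix.GeneralLinearGroup.mkOfDetNeZero, Matrix.mul_apply, Fin.sum_univ_two, hM, hs1, hs2] <;>
          ring
      · rw [Int.even_iff]; omega
      · rw [Int.even_iff]; simp only [reflIndex]; omega
  · have had : Odd (b * c) := by
      rw [← hdet] at hε'
      have h2 : Even (2 * (a * d)) := even_two_mul _
      have := h2.sub_odd hε'
      simpa using this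
    rw [Int.odd_mul, Int.odd_iff, Int.odd_iff] at had
    rw [Int.even_iff] at hev hpar
    cases s
    · refine ⟨-a, -b, c, d, -ε, hε2, Or.inr ⟨?_, by linarith, ?_, ?_⟩⟩
      · ext i j
        fin_cases i <;> fin_cases j <;> simp [reflMatrix,
          Matrix.GeneralLinearGroup.mkOfDetNeZero, Matrix.mul_apply, Fin.sum_univ_two, hM]
      · rw [Int.even_iff]; omega
      · rw [Int.even_iff]; simp only [reflIndex]; omega
    · refine ⟨c, d, a, b, -ε, hε2, Or.inl ⟨?_, by linarith, ?_, ?_⟩⟩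
      · ext i j
        fin_cases i <;> fin_cases j <;> simp [reflMatrix,
          Matrix.GeneralLinearGroup.mkOfDetNeZero, Matrix.mul_apply, Fin.sum_univ_two, hM]
      · rw [Int.even_iff]; omega
      · rw [Int.even_iff]; simp only [reflIndex]; omega
    · refine ⟨2 * a - c, b - d, a - c, b - 2 * d, -ε, hε2, Or.inl ⟨?_, by linarith, ?_, ?_⟩⟩
      · ext i j
        fin_cases i <;> fin_cases j <;> simp [reflMatrix,
          Matrix.GeneralLinearGroup.mkOfDetNeZero, Matrix.mul_apply, Fin.sum_univ_two, hM, hs1, hs2] <;>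
          ring
      · rw [Int.even_iff]; omega
      · rw [Int.even_iff]; simp only [reflIndex]; omega
    · refine ⟨-a + 2 * c, -b + 4 * d, c, d, -ε, hε2, Or.inr ⟨?_, by linarith, ?_, ?_⟩⟩
      · ext i j
        fin_cases i <;> fin_cases j <;> simp [reflMatrix,
          Matrix.GeneralLinearGroup.mkOfDetNeZero, Matrix.mul_apply, Fin.sum_univ_two, hM, hs1, hs2] <;>
          ring
      · rw [Int.even_iff]; omega
      · rw [Int.even_iff]; simp only [reflIndex]; omega

/-- Every element of the reflection group is given by an arithmetic matrix and has an index. -/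
theorem exists_isArith {γ : ℍ ≃ₜ ℍ} (hγ : γ ∈ reflGroup) :
    ∃ (m n : ℤ) (M : GL (Fin 2) ℝ), IsIndex γ m n ∧ (∀ z, γ z = M • z) ∧ IsArith M m n := by
  refine reflGroup_induction (p := fun γ => ∃ (m n : ℤ) (M : GL (Fin 2) ℝ),
    IsIndex γ m n ∧ (∀ z, γ z = M • z) ∧ IsArith M m n) ?_ ?_ hγ
  · exact ⟨0, 0, 1, isIndex_one, fun z => by simp, isArith_one⟩
  · rintro s γ - ⟨m, n, M, h1, h2, h3⟩
    refine ⟨_, _, reflMatrix s * M, h1.refl_mul s, fun z => ?_, h3.refl_mul s⟩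
    rw [Homeomorph.mul_apply, h2, refl_apply, mul_smul]

theorem IsArith.det {M : GL (Fin 2) ℝ} {m n : ℤ} (h : IsArith M m n) :
    (M.det.val = 1 ∧ Even (m + n)) ∨ (M.det.val = -1 ∧ ¬ Even (m + n)) := by
  obtain ⟨a, b, c, d, ε, hε, h⟩ := h
  have hd : M.det.val = ε := by
    rw [Matrix.GeneralLinearGroup.val_det_apply]
    have hs := sqrt_two_mul_self
    rcases h with ⟨hM, hdet, -, -⟩ | ⟨hM, hdet, -, -⟩
    · rw [hM, Matrix.det_fin_two_of, ← hdet]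
      push_cast
      linear_combination (-b * c : ℝ) * hs
    · rw [hM, Matrix.det_fin_two_of, ← hdet]
      push_cast
      linear_combination (a * d : ℝ) * hs
  rcases hε with ⟨h1, h2⟩ | ⟨h1, h2⟩
  · exact Or.inl ⟨by rw [hd, h1]; norm_num, h2⟩
  · exact Or.inr ⟨by rw [hd, h1]; norm_num, h2⟩

/-! ### Denominators and heights along orbits -/

theorem IsArith.im_smul {M : GL (Fin 2) ℝ} {m n : ℤ} (h : IsArith M m n) (z : ℍ) :
    (M • z).im = z.im / ((M 1 0 * z.re + M 1 1) ^ 2 + (M 1 0 * z.im) ^ 2) := by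
  have h1 : |M.det.val| = 1 := by rcases h.det with ⟨h, -⟩ | ⟨h, -⟩ <;> rw [h] <;> norm_num
  rw [im_smul_eq_div_normSq, h1, one_mul, denom, Complex.normSq_apply]
  simp [sq]

/-- In the second shape a vanishing entry `c` would make the determinant even; in the first shape it
makes `a` and `d` units. -/
theorem IsArith.denom {M : GL (Fin 2) ℝ} {m n : ℤ} (h : IsArith M m n) :
    ∃ c d : ℤ, (M 1 0 = c * √2 ∧ M 1 1 = d ∧ (c = 0 → d ^ 2 = 1)) ∨
      (M 1 0 = c ∧ M 1 1 = d * √2 ∧ c ≠ 0) := by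
  obtain ⟨a, b, c, d, ε, hε, h⟩ := h
  have hε1 : ε ^ 2 = 1 := by rcases hε with ⟨h, -⟩ | ⟨h, -⟩ <;> rw [h] <;> norm_num
  refine ⟨c, d, ?_⟩
  rcases h with ⟨hM, hdet, -, -⟩ | ⟨hM, hdet, -, -⟩
  · refine Or.inl ⟨by simp [hM], by simp [hM], fun hc => ?_⟩
    rw [hc] at hdet
    have : a * d = ε := by linarith
    have h2 : (a * d) * (a * d) = 1 := by rw [this, ← sq, hε1]
    have : IsUnit d := IsUnit.of_mul_eq_one (a * (a * d)) (by linarith)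
    rcases Int.isUnit_iff.1 this with h | h <;> rw [h] <;> norm_num
  · refine Or.inr ⟨by simp [hM], by simp [hM], fun hc => ?_⟩
    rw [hc] at hdet
    rcases hε with ⟨h, -⟩ | ⟨h, -⟩ <;> rw [h] at hdet <;> omega

/-- The lowest point is the vertex between the two arcs. In each half of the strip the arc on that
side gives the bound. -/
theorem half_le_im_sq {r : ℍ} (hr : r ∈ rectangle) : 1 / 2 ≤ r.im ^ 2 := by
  rw [mem_rectangle_iff] at hr
  have h1 := hr .left
  have h2 := hr .right
  have h3 := hr .arcLeft
  have h4 := hr .arcRight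
  simp only [sideFun] at h1 h2 h3 h4
  have hs := sqrt_two_mul_self
  rcases le_total r.re (√2 / 2) with h | h <;> nlinarith

theorem half_le_im {r : ℍ} (hr : r ∈ rectangle) : 1 / 2 ≤ r.im := by
  have := half_le_im_sq hr
  nlinarith [r.im_pos]

/-- The rectangle lies outside all unit circles centred at integral multiples of `√2`, and touches
only the two that carry its finite sides. -/
theorem one_le_sq_add_int_mul {r : ℍ} (hr : r ∈ rectangle) (k : ℤ) :
    1 ≤ (r.re + k * √2) ^ 2 + r.im ^ 2 ∧ ((r.re + k * √2) ^ 2 + r.im ^ 2 = 1 →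
      (k = 0 ∧ sideFun .arcLeft r = 0) ∨ (k = -1 ∧ sideFun .arcRight r = 0)) := by
  rw [mem_rectangle_iff] at hr
  have h1 := hr .left
  have h2 := hr .right
  have h3 := hr .arcLeft
  have h4 := hr .arcRight
  simp only [sideFun] at h1 h2 h3 h4 ⊢
  have hs := sqrt_two_mul_self
  have hs1 := one_lt_sqrt_two
  have hy := r.im_pos
  rcases lt_trichotomy k 0 with hk | hk | hk
  · rcases eq_or_ne k (-1) with rfl | hk'
    · push_cast
      exact ⟨by nlinarith, fun h => Or.inr ⟨trivial, by nlinarith⟩⟩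
    · have : (k : ℝ) ≤ -2 := by exact_mod_cast (by omega : k ≤ -2)
      have h5 : r.re + k * √2 ≤ -√2 := by nlinarith
      have : 1 < (r.re + k * √2) ^ 2 + r.im ^ 2 := by nlinarith
      exact ⟨this.le, fun h => absurd h this.ne'⟩
  · subst hk
    push_cast
    exact ⟨by nlinarith, fun h => Or.inl ⟨trivial, by nlinarith⟩⟩
  · have : (1 : ℝ) ≤ k := by exact_mod_cast hk
    have h5 : √2 ≤ r.re + k * √2 := by nlinarith
    have : 1 < (r.re + k * √2) ^ 2 + r.im ^ 2 := by nlinarith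
    exact ⟨this.le, fun h => absurd h this.ne'⟩

theorem one_le_int_sq {c : ℤ} (hc : c ≠ 0) : (1 : ℝ) ≤ (c : ℝ) ^ 2 := by
  have := Int.one_le_abs hc
  have h2 : (1 : ℝ) ≤ |(c : ℝ)| := by exact_mod_cast this
  rw [← sq_abs]; nlinarith

theorem four_le_int_sq {c : ℤ} (hc : c ≠ 0) (hc1 : c ^ 2 ≠ 1) : (4 : ℝ) ≤ (c : ℝ) ^ 2 := by
  have h2 : 2 ≤ |c| := by
    have h1 := Int.one_le_abs hc
    rcases h1.lt_or_eq with h | h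
    · exact h
    · exact absurd (by rw [← sq_abs, ← h]; norm_num) hc1
  have h2 : (2 : ℝ) ≤ |(c : ℝ)| := by exact_mod_cast h2
  rw [← sq_abs]; nlinarith

/-- The denominators of the elements of the group have norm at least one on the rectangle, with
equality only in a few cases. -/
theorem one_le_denom_even {r : ℍ} (hr : r ∈ rectangle) {c d : ℤ} (hcd : c = 0 → d ^ 2 = 1) :
    1 ≤ (c * √2 * r.re + d) ^ 2 + (c * √2 * r.im) ^ 2 ∧
      ((c * √2 * r.re + d) ^ 2 + (c * √2 * r.im) ^ 2 = 1 → c ≠ 0 →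
        c ^ 2 = 1 ∧ d = -c ∧ sideFun .arcLeft r = 0 ∧ sideFun .arcRight r = 0) := by
  have him := half_le_im_sq hr
  rw [mem_rectangle_iff] at hr
  have h1 := hr .left
  have h2 := hr .right
  have h3 := hr .arcLeft
  have h4 := hr .arcRight
  simp only [sideFun] at h1 h2 h3 h4 ⊢
  have hs := sqrt_two_mul_self
  have hs1 := one_lt_sqrt_two
  -- As `2 im² ≥ 1` on the rectangle, this term alone is at least `c ^ 2`. Equality forces `c = ±1`
  -- and `r` to be the vertex between the arcs.
  have e : ((c : ℝ) * √2 * r.im) ^ 2 = c ^ 2 * (2 * r.im ^ 2) := by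
    linear_combination (c * r.im) ^ 2 * hs
  rw [e]
  by_cases h0 : c = 0
  · have : (d : ℝ) ^ 2 = 1 := by exact_mod_cast hcd h0
    rw [h0]; push_cast
    exact ⟨by nlinarith, fun _ h => absurd trivial (by simpa using h)⟩
  have hc := one_le_int_sq h0
  have hq := sq_nonneg (c * √2 * r.re + d)
  refine ⟨by nlinarith, fun h _ => ?_⟩
  have hc1 : c ^ 2 = 1 := by
    by_contra hne
    have := four_le_int_sq h0 hne
    nlinarith
  have hc1' : (c : ℝ) ^ 2 = 1 := by exact_mod_cast hc1
  rw [hc1', one_mul] at h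
  have hy : r.im ^ 2 = 1 / 2 := by nlinarith
  have hq0 : (c * √2 * r.re + d) ^ 2 = 0 := by nlinarith
  have hq1 : c * √2 * r.re + d = 0 := by simpa using hq0
  have hx : r.re = √2 / 2 := by nlinarith
  have hd : (d : ℝ) = -c := by rw [hx] at hq1; linear_combination hq1 - c / 2 * hs
  refine ⟨hc1, by exact_mod_cast hd, ?_, ?_⟩ <;> rw [hx, hy] <;> nlinarith

/-- For `c = ±1` this concerns the unit circles centred at multiples of `√2`; for `|c| ≥ 2` the
imaginary term is already at least two. -/
theorem one_le_denom_odd {r : ℍ} (hr : r ∈ rectangle) {c d : ℤ} (h0 : c ≠ 0) :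
    1 ≤ (c * r.re + d * √2) ^ 2 + (c * r.im) ^ 2 ∧
      ((c * r.re + d * √2) ^ 2 + (c * r.im) ^ 2 = 1 → c ^ 2 = 1 ∧
        ((d = 0 ∧ sideFun .arcLeft r = 0) ∨ (d = -c ∧ sideFun .arcRight r = 0))) := by
  by_cases hc1 : c ^ 2 = 1
  · have hc1' : (c : ℝ) ^ 2 = 1 := by exact_mod_cast hc1
    have e : (c * r.re + d * √2) ^ 2 + (c * r.im) ^ 2
        = (r.re + ((c * d : ℤ) : ℝ) * √2) ^ 2 + r.im ^ 2 := by
      push_cast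
      linear_combination (r.re ^ 2 + r.im ^ 2 - d ^ 2 * √2 ^ 2) * hc1'
    rw [e]
    obtain ⟨h1, h2⟩ := one_le_sq_add_int_mul hr (c * d)
    refine ⟨h1, fun h => ⟨hc1, ?_⟩⟩
    rcases h2 h with ⟨h3, h4⟩ | ⟨h3, h4⟩
    · exact Or.inl ⟨(mul_eq_zero.1 h3).resolve_left h0, h4⟩
    · exact Or.inr ⟨by linear_combination c * h3 - d * hc1, h4⟩
  · have h4 := four_le_int_sq h0 hc1
    have him := half_le_im_sq hr
    have : 1 < (c * r.re + d * √2) ^ 2 + (c * r.im) ^ 2 := by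
      nlinarith [sq_nonneg (c * r.re + d * √2)]
    exact ⟨this.le, fun h => absurd h this.ne'⟩

/-- Points of the rectangle have the largest imaginary part in their orbits. -/
theorem im_apply_le {γ : ℍ ≃ₜ ℍ} (hγ : γ ∈ reflGroup) {r : ℍ} (hr : r ∈ rectangle) :
    (γ r).im ≤ r.im := by
  obtain ⟨m, n, M, -, hM, hA⟩ := exists_isArith hγ
  rw [hM, hA.im_smul]
  apply div_le_self r.im_pos.le
  obtain ⟨c, d, ⟨hc, hd, hcd⟩ | ⟨hc, hd, hcd⟩⟩ := hA.denom <;> rw [hc, hd]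
  · exact (one_le_denom_even hr hcd).1
  · exact (one_le_denom_odd hr hcd).1

/-! ### Stabilizers of points of the rectangle -/

/-- The stabilizer of a point of the rectangle, generated by the reflections in the sides that
contain it. -/
noncomputable def sideStabilizer (r : ℍ) : Subgroup (ℍ ≃ₜ ℍ) :=
  Subgroup.closure (refl '' {s | sideFun s r = 0})

theorem refl_mem_sideStabilizer {s : Side} {r : ℍ} (h : sideFun s r = 0) :
    refl s ∈ sideStabilizer r := Subgroup.subset_closure ⟨s, h, rfl⟩

theorem sideStabilizer_le_reflGroup (r : ℍ) : sideStabilizer r ≤ reflGroup :=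
  Subgroup.closure_mono (image_subset_range _ _)

theorem refl_eq_self {s : Side} {r : ℍ} (h : sideFun s r = 0) : refl s r = r := by
  cases s <;> simp only [sideFun] at h <;> apply UpperHalfPlane.ext_re_im
  · rw [re_refl_left]; linarith
  · rw [im_refl_left]
  · rw [re_refl_arcLeft, sub_eq_zero.1 h, div_one]
  · rw [im_refl_arcLeft, sub_eq_zero.1 h, div_one]
  · rw [re_refl_arcRight, sub_eq_zero.1 h, div_one]; ring
  · rw [im_refl_arcRight, sub_eq_zero.1 h, div_one]
  · rw [re_refl_right]; linarith
  · rw [im_refl_right]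

theorem sideStabilizer_induction {r : ℍ} {p : (ℍ ≃ₜ ℍ) → Prop} (one : p 1)
    (mul : ∀ s γ, sideFun s r = 0 → γ ∈ sideStabilizer r → p γ → p (refl s * γ)) {γ : ℍ ≃ₜ ℍ}
    (hγ : γ ∈ sideStabilizer r) : p γ := by
  refine Subgroup.closure_induction_left (p := fun γ _ => p γ) one ?_ ?_ hγ
  · rintro _ ⟨s, hs, rfl⟩ y hy h
    exact mul s y hs hy h
  · rintro _ ⟨s, hs, rfl⟩ y hy h
    rw [refl_inv]
    exact mul s y hs hy h

theorem apply_eq_self_of_mem_sideStabilizer {r : ℍ} {γ : ℍ ≃ₜ ℍ} (hγ : γ ∈ sideStabilizer r) :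
    γ r = r :=
  sideStabilizer_induction (p := fun γ => γ r = r) rfl
    (fun s γ hs _ h => by rw [Homeomorph.mul_apply, h, refl_eq_self hs]) hγ

/-! ### The rectangle as a strict fundamental domain -/

theorem re_im_of_upperTriangular {M : GL (Fin 2) ℝ} {a b d : ℤ}
    (hM : M.val = !![(a : ℝ), b * √2; 0, d]) (had : a * d = 1 ∨ a * d = -1) (z : ℍ) :
    (M • z).re = (a * d : ℤ) * z.re + ((b * d : ℤ) : ℝ) * √2 ∧ (M • z).im = z.im := by
  have hd2 : d ^ 2 = 1 := by
    have h : IsUnit d := by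
      rcases had with h | h
      · exact IsUnit.of_mul_eq_one a (by linarith)
      · exact IsUnit.of_mul_eq_one (-a) (by linarith)
    rcases Int.isUnit_iff.1 h with h | h <;> rw [h] <;> norm_num
  have hd2' : (d : ℝ) ^ 2 = 1 := by exact_mod_cast hd2
  have hd0 : (d : ℝ) ≠ 0 := fun h => by rw [h] at hd2'; norm_num at hd2'
  have hdet : |M.det.val| = 1 := by
    rw [Matrix.GeneralLinearGroup.val_det_apply, hM, Matrix.det_fin_two_of]
    have : (a : ℝ) * d = 1 ∨ (a : ℝ) * d = -1 := by exact_mod_cast had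
    rcases this with h | h <;> rw [h] <;> norm_num
  constructor
  · rw [re_smul, num, denom]
    simp only [hM, Matrix.of_apply, Matrix.cons_val', Matrix.cons_val_zero, Matrix.cons_val_one,
      Matrix.cons_val_fin_one]
    rw [show ((0 : ℝ) : ℂ) * (z : ℂ) + ((d : ℝ) : ℂ) = ((d : ℝ) : ℂ) by simp,
      Complex.div_ofReal_re]
    simp
    field_simp
    linear_combination (-(a * z.re + b * √2)) * hd2'
  · rw [im_smul_eq_div_normSq, hdet, denom]
    simp only [hM, Matrix.of_apply, Matrix.cons_val', Matrix.cons_val_zero, Matrix.cons_val_one,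
      Matrix.cons_val_fin_one]
    simp [Complex.normSq_apply, ← sq, hd2']

/-- Such a map is `x ↦ ±x + 2 k √2` on real parts, the factor two coming from `Even b`. If it keeps
a point within the strip of width `√2`, it is the identity or the reflection in a vertical side
through that point. -/
theorem mem_sideStabilizer_of_upperTriangular {γ : ℍ ≃ₜ ℍ} {M : GL (Fin 2) ℝ}
    (hγ : ∀ z, γ z = M • z) {a b d : ℤ} (hM : M.val = !![(a : ℝ), b * √2; 0, d])
    (had : a * d = 1 ∨ a * d = -1) (hb : Even b) {r : ℍ} (hr : r ∈ rectangle)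
    (hr' : γ r ∈ rectangle) : γ ∈ sideStabilizer r := by
  have hf := re_im_of_upperTriangular hM had
  have hs := one_lt_sqrt_two
  rw [mem_rectangle_iff] at hr hr'
  have h1 := hr .left
  have h2 := hr .right
  have h1' := hr' .left
  have h2' := hr' .right
  obtain ⟨k, hk⟩ : Even (b * d) := hb.mul_right d
  simp only [sideFun, hγ, (hf _).1] at h1 h2 h1' h2'
  rw [hk] at hf h1' h2'
  rcases had with had | had
  · rw [had] at hf h1' h2'
    push_cast at h1' h2'
    have hk0 : k = 0 := by
      by_contra hne
      rcases lt_or_gt_of_ne hne with h | h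
      · have : (k : ℝ) ≤ -1 := by exact_mod_cast (by omega : k ≤ -1)
        nlinarith
      · have : (1 : ℝ) ≤ k := by exact_mod_cast h
        nlinarith
    have : γ = 1 := by
      ext1 z
      rw [hγ]
      apply UpperHalfPlane.ext_re_im
      · rw [(hf z).1, hk0]; simp
      · rw [(hf z).2]; simp
    rw [this]; exact one_mem _
  · rw [had] at hf h1' h2'
    push_cast at h1' h2'
    have hk01 : k = 0 ∨ k = 1 := by
      by_contra hne
      push Not at hne
      rcases lt_or_gt_of_ne hne.1 with h | h
      · have : (k : ℝ) ≤ -1 := by exact_mod_cast (by omega : k ≤ -1)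
        nlinarith
      · have : (2 : ℝ) ≤ k := by exact_mod_cast (by omega : 2 ≤ k)
        nlinarith
    rcases hk01 with hk0 | hk0
    · have : γ = refl .left := by
        ext1 z
        rw [hγ]
        apply UpperHalfPlane.ext_re_im
        · rw [(hf z).1, hk0, re_refl_left]; simp
        · rw [(hf z).2, im_refl_left]
      rw [this]
      rw [hk0] at h1'
      exact refl_mem_sideStabilizer (by simp only [sideFun]; push_cast at h1'; nlinarith)
    · have : γ = refl .right := by
        ext1 z
        rw [hγ]
        apply UpperHalfPlane.ext_re_im
        · rw [(hf z).1, hk0, re_refl_right]; push_cast; ring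
        · rw [(hf z).2, im_refl_right]
      rw [this]
      rw [hk0] at h2'
      exact refl_mem_sideStabilizer (by simp only [sideFun]; push_cast at h2'; nlinarith)

/-- The rectangle is a strict fundamental domain of the reflection group, and stabilizers are
generated by reflections. -/
theorem mem_sideStabilizer_of_mem_rectangle {γ : ℍ ≃ₜ ℍ} (hγ : γ ∈ reflGroup) {r : ℍ}
    (hr : r ∈ rectangle) (hr' : γ r ∈ rectangle) : γ ∈ sideStabilizer r := by
  -- Both points are in the rectangle, so each is highest in their common orbit. The denominator of
  -- `γ` at `r` therefore has norm one, and the equality cases of the denominator bounds apply.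
  have him : (γ r).im = r.im := by
    refine le_antisymm (im_apply_le hγ hr) ?_
    have := im_apply_le (inv_mem hγ) hr'
    rwa [← Homeomorph.mul_apply, inv_mul_cancel, Homeomorph.one_apply] at this
  obtain ⟨m, n, M, -, hM, hA⟩ := exists_isArith hγ
  have hden : (M 1 0 * r.re + M 1 1) ^ 2 + (M 1 0 * r.im) ^ 2 = 1 := by
    rw [hM, hA.im_smul] at him
    have h0 := r.im_ne_zero
    set D := (M 1 0 * r.re + M 1 1) ^ 2 + (M 1 0 * r.im) ^ 2
    have hD : D ≠ 0 := fun h => by rw [h, div_zero] at him; exact h0 him.symm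
    rw [div_eq_iff hD] at him
    exact mul_left_cancel₀ h0 (by linarith)
  have hs1 (x : ℝ) : x * √2 * √2 = 2 * x := by linear_combination x * sqrt_two_mul_self
  obtain ⟨a, b, c, d, ε, hε, h⟩ := hA
  have hε1 : ε = 1 ∨ ε = -1 := by tauto
  have hε' : Odd ε := by rcases hε1 with h | h <;> rw [h] <;> decide
  rcases h with ⟨hv, hdet, hev, -⟩ | ⟨hv, hdet, hev, -⟩
  · have had : Odd (a * d) := by
      rw [← hdet] at hε'
      simpa using hε'.add_even (even_two_mul (b * c))
    rw [Int.odd_mul, Int.odd_iff, Int.odd_iff] at had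
    by_cases hc : c = 0
    · subst hc
      refine mem_sideStabilizer_of_upperTriangular (a := a) (b := b) (d := d) hM ?_ ?_ ?_ hr hr'
      · rw [hv]; simp
      · rw [mul_zero, mul_zero, sub_zero] at hdet; rwa [hdet]
      · simpa using hev
    · have hd0 : c = 0 → d ^ 2 = 1 := fun h => absurd h hc
      obtain ⟨hc1, hd, hL, hR⟩ := (one_le_denom_even hr hd0).2 (by simpa [hv] using hden) hc
      subst hd
      -- Equality places `r` at the vertex on both arcs. Undoing the two arc reflections, which fix
      -- `r`, leaves an upper triangular matrix.
      have hmem : γ * refl .arcRight * refl .arcLeft ∈ sideStabilizer r := by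
        refine mem_sideStabilizer_of_upperTriangular
          (M := M * reflMatrix .arcRight * reflMatrix .arcLeft)
          (a := -a - 2 * b) (b := a + b) (d := c) (fun z => ?_) ?_ ?_ ?_ hr ?_
        · rw [Homeomorph.mul_apply, Homeomorph.mul_apply, hM, refl_apply, refl_apply, mul_smul,
            mul_smul]
        · ext i j
          fin_cases i <;> fin_cases j <;> simp [reflMatrix,
            Matrix.GeneralLinearGroup.mkOfDetNeZero, Matrix.mul_apply, Fin.sum_univ_two, hv, hs1]
            <;> ring
        · have : (-a - 2 * b) * c = ε := by linarith
          rwa [this]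
        · rw [Int.even_iff] at hev ⊢; omega
        · rw [Homeomorph.mul_apply, Homeomorph.mul_apply, refl_eq_self hL, refl_eq_self hR]
          exact hr'
      have := mul_mem (mul_mem hmem (refl_mem_sideStabilizer hL)) (refl_mem_sideStabilizer hR)
      rwa [mul_assoc (γ * refl .arcRight), refl_mul_self, mul_one, mul_assoc, refl_mul_self,
        mul_one] at this
  · have had : Odd (b * c) := by
      rw [← hdet] at hε'
      simpa using (even_two_mul (a * d)).sub_odd hε'
    rw [Int.odd_mul, Int.odd_iff, Int.odd_iff] at had
    have hc : c ≠ 0 := by omega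
    obtain ⟨hc1, ⟨hd, hL⟩ | ⟨hd, hR⟩⟩ := (one_le_denom_odd hr hc).2 (by simpa [hv] using hden)
    · subst hd
      -- In the second shape a single arc reflection suffices, and it leads back to the upper
      -- triangular first shape.
      have hmem : γ * refl .arcLeft ∈ sideStabilizer r := by
        refine mem_sideStabilizer_of_upperTriangular (M := M * reflMatrix .arcLeft)
          (a := b) (b := a) (d := c) (fun z => ?_) ?_ ?_ ?_ hr ?_
        · rw [Homeomorph.mul_apply, hM, refl_apply, mul_smul]
        · ext i j
          fin_cases i <;> fin_cases j <;> simp [reflMatrix,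
            Matrix.GeneralLinearGroup.mkOfDetNeZero, Matrix.mul_apply, Fin.sum_univ_two, hv]
        · have : b * c = -ε := by linarith
          rw [this]; omega
        · simpa using hev
        · rw [Homeomorph.mul_apply, refl_eq_self hL]; exact hr'
      have := mul_mem hmem (refl_mem_sideStabilizer hL)
      rwa [mul_assoc, refl_mul_self, mul_one] at this
    · subst hd
      have hmem : γ * refl .arcRight ∈ sideStabilizer r := by
        refine mem_sideStabilizer_of_upperTriangular (M := M * reflMatrix .arcRight)
          (a := 2 * a + b) (b := -a - b) (d := c) (fun z => ?_) ?_ ?_ ?_ hr ?_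
        · rw [Homeomorph.mul_apply, hM, refl_apply, mul_smul]
        · ext i j
          fin_cases i <;> fin_cases j <;> simp [reflMatrix,
            Matrix.GeneralLinearGroup.mkOfDetNeZero, Matrix.mul_apply, Fin.sum_univ_two, hv, hs1]
            <;> ring
        · have : (2 * a + b) * c = -ε := by linarith
          rw [this]; omega
        · rw [Int.even_iff] at hev ⊢; omega
        · rw [Homeomorph.mul_apply, refl_eq_self hR]; exact hr'
      have := mul_mem hmem (refl_mem_sideStabilizer hR)
      rwa [mul_assoc, refl_mul_self, mul_one] at this

theorem exists_translation (k : ℤ) :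
    ∃ γ ∈ reflGroup, ∀ z, (γ z).re = z.re + k * (2 * √2) ∧ (γ z).im = z.im := by
  induction k using Int.induction_on with
  | zero => exact ⟨1, one_mem _, fun z => by simp⟩
  | succ k ih =>
    obtain ⟨γ, hγ, h⟩ := ih
    refine ⟨refl .right * refl .left * γ, mul_mem (mul_mem (refl_mem _) (refl_mem _)) hγ,
      fun z => ?_⟩
    rw [Homeomorph.mul_apply, Homeomorph.mul_apply, re_refl_right, re_refl_left, im_refl_right,
      im_refl_left, (h z).1, (h z).2]
    push_cast
    exact ⟨by ring, rfl⟩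
  | pred k ih =>
    obtain ⟨γ, hγ, h⟩ := ih
    refine ⟨refl .left * refl .right * γ, mul_mem (mul_mem (refl_mem _) (refl_mem _)) hγ,
      fun z => ?_⟩
    rw [Homeomorph.mul_apply, Homeomorph.mul_apply, re_refl_left, re_refl_right, im_refl_left,
      im_refl_right, (h z).1, (h z).2]
    push_cast
    exact ⟨by ring, rfl⟩

/-- Some point of each orbit has the largest imaginary part. -/
theorem exists_max_im_apply (z : ℍ) :
    ∃ γ ∈ reflGroup, ∀ γ' ∈ reflGroup, (γ' z).im ≤ (γ z).im := by
  have hs : (0 : ℝ) < √2 := by positivity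
  -- The denominators of the two shapes are those of integral rows at `√2 z` and, up to a factor
  -- `√2`, at `z / √2`. So only finitely many rows have a denominator of norm at most one, and only
  -- those do not lower `z`.
  have f1 := (ModularGroup.tendsto_normSq_coprime_pair ((⟨√2, hs⟩ : {x : ℝ // 0 < x}) • z)).eventually
    (eventually_gt_atTop 1)
  have f2 := (ModularGroup.tendsto_normSq_coprime_pair
    ((⟨(√2)⁻¹, inv_pos.2 hs⟩ : {x : ℝ // 0 < x}) • z)).eventually (eventually_gt_atTop 1)
  rw [eventually_cofinite] at f1 f2
  set S : Set ℝ := {y | z.im ≤ y ∧ ∃ γ ∈ reflGroup, y = (γ z).im} with hS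
  have hfin : S.Finite := by
    refine ((f1.image fun p : Fin 2 → ℤ =>
      z.im / ((p 0 * √2 * z.re + p 1) ^ 2 + (p 0 * √2 * z.im) ^ 2)).union
      (f2.image fun p : Fin 2 → ℤ =>
      z.im / ((p 0 * z.re + p 1 * √2) ^ 2 + (p 0 * z.im) ^ 2))).subset ?_
    rintro y ⟨hy, γ, hγ, rfl⟩
    obtain ⟨m, n, M, -, hM, hA⟩ := exists_isArith hγ
    rw [hM, hA.im_smul] at hy ⊢
    have hD : (M 1 0 * z.re + M 1 1) ^ 2 + (M 1 0 * z.im) ^ 2 ≤ 1 := by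
      by_contra hlt
      exact absurd hy (not_le.2 (div_lt_self z.im_pos (not_le.1 hlt)))
    obtain ⟨c, d, ⟨hc, hd, -⟩ | ⟨hc, hd, -⟩⟩ := hA.denom
    · refine Or.inl ⟨![c, d], ?_, by simp [hc, hd]⟩
      rw [hc, hd] at hD
      simp only [mem_ofPred_eq, not_lt]
      refine le_trans (le_of_eq ?_) hD
      rw [Complex.normSq_apply]
      simp
      ring
    · refine Or.inr ⟨![c, d], ?_, by simp [hc, hd]⟩
      rw [hc, hd] at hD
      simp only [mem_ofPred_eq, not_lt]
      have e : 2 * Complex.normSq (((![c, d] : Fin 2 → ℤ) 0 : ℂ) *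
          (((⟨(√2)⁻¹, inv_pos.2 hs⟩ : {x : ℝ // 0 < x}) • z : ℍ) : ℂ) + ((![c, d] : Fin 2 → ℤ) 1 : ℂ))
          = (c * z.re + d * √2) ^ 2 + (c * z.im) ^ 2 := by
        rw [Complex.normSq_apply]
        simp
        have := sqrt_two_mul_self
        field_simp
        linear_combination (c ^ 2 * z.re ^ 2 + c ^ 2 * z.im ^ 2 - 2 * d ^ 2 : ℝ) * this
      nlinarith [Complex.normSq_nonneg (((![c, d] : Fin 2 → ℤ) 0 : ℂ) *
          (((⟨(√2)⁻¹, inv_pos.2 hs⟩ : {x : ℝ // 0 < x}) • z : ℍ) : ℂ) + ((![c, d] : Fin 2 → ℤ) 1 : ℂ))]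
  obtain ⟨y, ⟨hy, γ, hγ, rfl⟩, hmax⟩ := Set.exists_max_image S id hfin
    ⟨z.im, le_rfl, 1, one_mem _, rfl⟩
  refine ⟨γ, hγ, fun γ' hγ' => ?_⟩
  by_cases h : z.im ≤ (γ' z).im
  · exact hmax _ ⟨h, γ', hγ', rfl⟩
  · exact (not_le.1 h).le.trans hy

/-- Every orbit meets the rectangle. -/
theorem exists_apply_mem_rectangle (z : ℍ) : ∃ γ ∈ reflGroup, γ z ∈ rectangle := by
  have hs : (0 : ℝ) < √2 := by positivity
  obtain ⟨γ, hγ, hmax⟩ := exists_max_im_apply z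
  obtain ⟨δ, hδ, hre, him⟩ : ∃ δ ∈ reflGroup, (0 ≤ (δ (γ z)).re ∧ (δ (γ z)).re ≤ √2) ∧
      (δ (γ z)).im = (γ z).im := by
    obtain ⟨τ, hτ, h⟩ := exists_translation (-⌊(γ z).re / (2 * √2)⌋)
    have h1 := Int.floor_le ((γ z).re / (2 * √2))
    have h2 := Int.lt_floor_add_one ((γ z).re / (2 * √2))
    rw [le_div_iff₀ (by positivity)] at h1
    rw [div_lt_iff₀ (by positivity)] at h2
    have h3 := (h (γ z)).1
    push_cast at h3
    by_cases hle : (τ (γ z)).re ≤ √2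
    · exact ⟨τ, hτ, ⟨by rw [h3]; linarith, hle⟩, (h _).2⟩
    · refine ⟨refl .right * τ, mul_mem (refl_mem _) hτ, ?_, ?_⟩
      · rw [Homeomorph.mul_apply, re_refl_right]
        constructor
        · rw [h3]; linarith
        · linarith
      · rw [Homeomorph.mul_apply, im_refl_right, (h _).2]
  refine ⟨δ * γ, mul_mem hδ hγ, ?_⟩
  set w := (δ * γ) z with hw
  have hw' : w = δ (γ z) := rfl
  -- A point inside the unit circle of an arc would be raised by the reflection in it, so maximal
  -- height keeps `w` outside both circles.
  have hwmax : ∀ s, (refl s w).im ≤ w.im := fun s => by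
    rw [hw' , him]
    exact hmax (refl s * δ * γ) (mul_mem (mul_mem (refl_mem _) hδ) hγ)
  rw [mem_rectangle_iff]
  have hpos := w.im_pos
  intro s
  cases s
  · exact hre.1
  · by_contra hlt
    have := hwmax .arcLeft
    rw [im_refl_arcLeft] at this
    simp only [sideFun, not_le] at hlt
    have hN : 0 < w.re ^ 2 + w.im ^ 2 := by positivity
    rw [div_le_iff₀ hN] at this
    nlinarith
  · by_contra hlt
    have := hwmax .arcRight
    rw [im_refl_arcRight] at this
    simp only [sideFun, not_le] at hlt
    have hN : 0 < (w.re - √2) ^ 2 + w.im ^ 2 := by positivity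
    rw [div_le_iff₀ hN] at this
    nlinarith
  · exact sub_nonneg.2 hre.2

/-! ### The local structure of the tessellation -/

/-- Two sides are adjacent if they meet in a finite vertex. -/
inductive Adjacent : Side → Side → Prop
  | left_arcLeft : Adjacent .left .arcLeft
  | arcLeft_arcRight : Adjacent .arcLeft .arcRight
  | right_arcRight : Adjacent .right .arcRight

/-- The geodesics that carry opposite sides do not meet, so at most two sides, adjacent ones, pass
through a point. -/
theorem exists_adjacent (r : ℍ) :
    ∃ i j, Adjacent i j ∧ ∀ t, sideFun t r = 0 → t = i ∨ t = j := by
  have hs := sqrt_two_mul_self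
  have hs1 := one_lt_sqrt_two
  have hy := r.im_pos
  by_cases hL : r.re = 0
  · refine ⟨_, _, .left_arcLeft, fun t ht => ?_⟩
    cases t <;> simp only [sideFun, hL] at ht <;> simp only [reduceCtorEq, or_false, or_true]
    · nlinarith
    · linarith
  by_cases hR : r.re = √2
  · refine ⟨_, _, .right_arcRight, fun t ht => ?_⟩
    cases t <;> simp only [sideFun, hR] at ht <;> simp only [reduceCtorEq, or_false, or_true]
    · linarith
    · nlinarith
  · refine ⟨_, _, .arcLeft_arcRight, fun t ht => ?_⟩
    cases t <;> simp only [sideFun] at ht <;> simp only [reduceCtorEq, or_false, or_true]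
    · exact hL ht
    · exact hR (by linarith)

theorem sideFun_refl_self (s : Side) (z : ℍ) :
    ∃ c > 0, sideFun s (refl s z) = -(c * sideFun s z) := by
  have hy := z.im_pos
  cases s
  · exact ⟨1, one_pos, by simp [sideFun, re_refl_left]⟩
  · refine ⟨1 / (z.re ^ 2 + z.im ^ 2), by positivity, ?_⟩
    simp only [sideFun, re_refl_arcLeft, im_refl_arcLeft]
    have : z.re ^ 2 + z.im ^ 2 ≠ 0 := by positivity
    field_simp; ring
  · refine ⟨1 / ((z.re - √2) ^ 2 + z.im ^ 2), by positivity, ?_⟩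
    simp only [sideFun, re_refl_arcRight, im_refl_arcRight]
    have : (z.re - √2) ^ 2 + z.im ^ 2 ≠ 0 := by positivity
    rw [add_sub_cancel_left]
    field_simp; ring
  · exact ⟨1, one_pos, by simp only [sideFun, re_refl_right]; ring⟩

/-- Adjacent sides are orthogonal, so the reflection in `j` preserves the two half-planes bounded by
`i`. -/
theorem Adjacent.sideFun_refl {i j : Side} (h : Adjacent i j) (z : ℍ) :
    ∃ c > 0, sideFun i (refl j z) = c * sideFun i z := by
  have hy := z.im_pos
  have hs := sqrt_two_mul_self
  cases h
  · refine ⟨1 / (z.re ^ 2 + z.im ^ 2), by positivity, ?_⟩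
    simp only [sideFun, re_refl_arcLeft]; ring
  · refine ⟨1 / ((z.re - √2) ^ 2 + z.im ^ 2), by positivity, ?_⟩
    simp only [sideFun, re_refl_arcRight, im_refl_arcRight]
    have : (z.re - √2) ^ 2 + z.im ^ 2 ≠ 0 := by positivity
    field_simp
    linear_combination (((z.re - √2) ^ 2 + z.im ^ 2) ^ 2 - ((z.re - √2) ^ 2 + z.im ^ 2)) * hs
  · refine ⟨1 / ((z.re - √2) ^ 2 + z.im ^ 2), by positivity, ?_⟩
    simp only [sideFun, re_refl_arcRight]; ring

theorem Adjacent.commute {i j : Side} (h : Adjacent i j) : refl i * refl j = refl j * refl i := by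
  have hs := sqrt_two_mul_self
  ext1 z
  have hy := z.im_pos
  rw [Homeomorph.mul_apply, Homeomorph.mul_apply]
  cases h
  · apply UpperHalfPlane.ext_re_im
    · simp only [re_refl_left, re_refl_arcLeft, im_refl_left]; ring
    · simp only [re_refl_left, im_refl_arcLeft, im_refl_left]; ring
  · have h1 : (z : ℂ) ≠ 0 := z.ne_zero
    have h2 : (z : ℂ) - (√2 : ℝ) ≠ 0 := sub_ne_zero.2 (z.ne_ofReal _)
    have h3 : 1 - (√2 : ℝ) * (z : ℂ) ≠ 0 := fun h => by
      have := congrArg Complex.im h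
      simp at this
      exact z.im_ne_zero this
    have h4 : (√2 : ℝ) * ((z : ℂ) - (√2 : ℝ)) + 1 ≠ 0 := fun h => by
      have := congrArg Complex.im h
      simp at this
      exact z.im_ne_zero this
    have hs' := sqrt_two_complex_sq
    apply UpperHalfPlane.ext
    rw [coe_refl_arcLeft, coe_refl_arcRight, coe_refl_arcRight, coe_refl_arcLeft]
    simp only [map_add, map_div₀, map_one, map_sub, Complex.conj_conj, Complex.conj_ofReal]
    have e1 : 1 / (z : ℂ) - (√2 : ℝ) = (1 - (√2 : ℝ) * z) / z := by field_simp
    have e2 : ((√2 : ℝ) : ℂ) + 1 / ((z : ℂ) - (√2 : ℝ))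
      = ((√2 : ℝ) * ((z : ℂ) - (√2 : ℝ)) + 1) / ((z : ℂ) - (√2 : ℝ)) := by field_simp
    rw [e1, e2, one_div_div, one_div_div, div_eq_iff h4, add_mul, div_mul_eq_mul_div]
    rw [eq_comm, ← eq_sub_iff_add_eq', div_eq_iff h3]
    linear_combination ((√2 : ℝ) ^ 2 * (z : ℂ) - (√2 : ℝ) * (z : ℂ) ^ 2 - (√2 : ℝ)) * hs'
  · apply UpperHalfPlane.ext_re_im
    · simp only [re_refl_right, re_refl_arcRight, im_refl_right]
      rw [show (2 * √2 - z.re - √2) ^ 2 = (z.re - √2) ^ 2 by ring]; ring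
    · simp only [re_refl_right, im_refl_arcRight, im_refl_right]
      rw [show (2 * √2 - z.re - √2) ^ 2 = (z.re - √2) ^ 2 by ring]

/-- Two commuting reflections generate a Klein four-group: at most four tiles meet at a point. -/
theorem exists_adjacent_mem_sideStabilizer (r : ℍ) : ∃ i j, Adjacent i j ∧
    ∀ γ ∈ sideStabilizer r, γ ∈ ({1, refl i, refl j, refl i * refl j} : Set (ℍ ≃ₜ ℍ)) := by
  obtain ⟨i, j, hij, h⟩ := exists_adjacent r
  have hc := hij.commute
  refine ⟨i, j, hij, fun γ hγ => ?_⟩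
  refine sideStabilizer_induction
    (p := fun γ => γ ∈ ({1, refl i, refl j, refl i * refl j} : Set (ℍ ≃ₜ ℍ))) (by simp) ?_ hγ
  intro s γ hs _ hγ
  simp only [mem_insert_iff, mem_singleton_iff] at hγ ⊢
  rcases h s hs with rfl | rfl <;> rcases hγ with rfl | rfl | rfl | rfl
  · simp
  · simp [refl_mul_self]
  · simp
  · simp [← mul_assoc, refl_mul_self]
  · simp
  · simp [hc]
  · simp [refl_mul_self]
  · rw [hc, ← mul_assoc, refl_mul_self, one_mul]; simp

theorem finite_sideStabilizer (r : ℍ) : (sideStabilizer r : Set (ℍ ≃ₜ ℍ)).Finite := by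
  obtain ⟨i, j, -, h⟩ := exists_adjacent_mem_sideStabilizer r
  exact (Set.toFinite {1, refl i, refl j, refl i * refl j}).subset h

/-- Near a point `r` of the rectangle the images of the rectangle under the stabilizer of `r` cover
the plane. -/
theorem eventually_exists_mem_rectangle {r : ℍ} (hr : r ∈ rectangle) :
    ∀ᶠ z in 𝓝 r, ∃ s ∈ sideStabilizer r, s z ∈ rectangle ∧
      ∀ t, sideFun t (s z) = 0 → sideFun t r = 0 := by
  rw [mem_rectangle_iff] at hr
  obtain ⟨i, j, hij, h⟩ := exists_adjacent r
  -- Sides that do not contain `r` stay at a distance near `r`, uniformly over the finite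
  -- stabilizer; only the sides through `r` need correction.
  have hev : ∀ᶠ z in 𝓝 r, ∀ s ∈ (sideStabilizer r : Set (ℍ ≃ₜ ℍ)), ∀ t, sideFun t r ≠ 0 →
      0 < sideFun t (s z) := by
    rw [(finite_sideStabilizer r).eventually_all]
    intro s hs
    have hone : ∀ t, ∀ᶠ z in 𝓝 r, sideFun t r ≠ 0 → 0 < sideFun t (s z) := by
      intro t
      by_cases ht : sideFun t r = 0
      · exact Eventually.of_forall fun z h => absurd ht h
      · have hc : ContinuousAt (fun z => sideFun t (s z)) r :=
          ((continuous_sideFun t).comp s.continuous).continuousAt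
        have hlt : 0 < sideFun t (s r) := by
          rw [apply_eq_self_of_mem_sideStabilizer hs]
          exact lt_of_le_of_ne (hr t) (Ne.symm ht)
        filter_upwards [hc.eventually (lt_mem_nhds hlt)] with z hz _ using hz
    filter_upwards [hone .left, hone .arcLeft, hone .arcRight, hone .right] with z h1 h2 h3 h4 t
    cases t <;> assumption
  filter_upwards [hev] with z hz
  -- The sign for side `i` is corrected first, then that for `j`; by orthogonality the second
  -- reflection does not undo the first correction.
  obtain ⟨s₁, hs₁, h₁⟩ : ∃ s₁ ∈ sideStabilizer r, sideFun i r = 0 → 0 ≤ sideFun i (s₁ z) := by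
    by_cases hi : sideFun i r = 0 ∧ sideFun i z < 0
    · refine ⟨refl i, refl_mem_sideStabilizer hi.1, fun _ => ?_⟩
      obtain ⟨c, hc, e⟩ := sideFun_refl_self i z
      rw [e]; nlinarith [hi.2]
    · refine ⟨1, one_mem _, fun h => ?_⟩
      by_contra hlt
      exact hi ⟨h, not_le.1 hlt⟩
  obtain ⟨s₂, hs₂, h₂, h₃⟩ : ∃ s₂ ∈ sideStabilizer r, (sideFun j r = 0 → 0 ≤ sideFun j (s₂ (s₁ z)))
      ∧ (sideFun i r = 0 → 0 ≤ sideFun i (s₂ (s₁ z))) := by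
    by_cases hi : sideFun j r = 0 ∧ sideFun j (s₁ z) < 0
    · refine ⟨refl j, refl_mem_sideStabilizer hi.1, fun _ => ?_, fun h => ?_⟩
      · obtain ⟨c, hc, e⟩ := sideFun_refl_self j (s₁ z)
        rw [e]; nlinarith [hi.2]
      · obtain ⟨c, hc, e⟩ := hij.sideFun_refl (s₁ z)
        rw [e]; exact mul_nonneg hc.le (h₁ h)
    · refine ⟨1, one_mem _, fun h => ?_, h₁⟩
      by_contra hlt
      exact hi ⟨h, not_le.1 hlt⟩
  refine ⟨s₂ * s₁, mul_mem hs₂ hs₁, ?_, fun t ht => ?_⟩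
  · rw [mem_rectangle_iff]
    intro t
    by_cases ht : sideFun t r = 0
    · rcases h t ht with rfl | rfl
      · exact h₃ ht
      · exact h₂ ht
    · exact (hz _ (mul_mem hs₂ hs₁) t ht).le
  · by_contra hne
    exact (hz _ (mul_mem hs₂ hs₁) t hne).ne' ht

/-! ## The universal covering of the glued surface -/

/-- The index of the neighbour of the rectangle `(m, n)` across a side. -/
def neighbour : Side → ℤ × ℤ → ℤ × ℤ
  | .left, (m, n) => (if Even m then m - 1 else m + 1, n)
  | .arcLeft, (m, n) => (m, if Even n then n + 1 else n - 1)
  | .arcRight, (m, n) => (if Even m then m + 1 else m - 1, n)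
  | .right, (m, n) => (m, if Even n then n - 1 else n + 1)

theorem fold_neg_arg (m : ℤ) (x : ℝ) : fold m (-x) = fold (if Even m then m - 1 else m + 1) x := by
  by_cases h : Even m
  · rw [if_pos h, fold_even h, fold_odd (by simpa [parity_simps] using h)]; push_cast; ring
  · rw [if_neg h, fold_odd h, fold_even (by simpa [parity_simps] using h)]; push_cast; ring

theorem fold_two_sub (m : ℤ) (x : ℝ) :
    fold m (2 - x) = fold (if Even m then m + 1 else m - 1) x := by
  by_cases h : Even m
  · rw [if_pos h, fold_even h, fold_odd (by simpa [parity_simps] using h)]; push_cast; ring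
  · rw [if_neg h, fold_odd h, fold_even (by simpa [parity_simps] using h)]; push_cast; ring

/-- Multiplication on the right crosses one side of the tile of `γ`, and so passes to a neighbouring
grid square; multiplication on the left, as in `IsIndex.refl_mul`, reflects the whole grid. -/
theorem IsIndex.mul_refl {γ : ℍ ≃ₜ ℍ} {m n : ℤ} (h : IsIndex γ m n) (s : Side) :
    IsIndex (γ * refl s) (neighbour s (m, n)).1 (neighbour s (m, n)).2 := by
  intro z
  rw [Homeomorph.mul_apply, (h _).1, (h _).2]
  cases s
  · rw [(coord_refl_left _).1, (coord_refl_left _).2]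
    exact ⟨fold_neg_arg _ _, rfl⟩
  · rw [(coord_refl_arcLeft _).1, (coord_refl_arcLeft _).2]
    exact ⟨rfl, fold_two_sub _ _⟩
  · rw [(coord_refl_arcRight _).1, (coord_refl_arcRight _).2]
    exact ⟨fold_two_sub _ _, rfl⟩
  · rw [(coord_refl_right _).1, (coord_refl_right _).2]
    exact ⟨rfl, fold_neg_arg _ _⟩

theorem exists_isIndex (m n : ℤ) : ∃ γ ∈ reflGroup, IsIndex γ m n := by
  have step : ∀ m n : ℤ, (∃ γ ∈ reflGroup, IsIndex γ m n) → ∀ s,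
      ∃ γ ∈ reflGroup, IsIndex γ (neighbour s (m, n)).1 (neighbour s (m, n)).2 := by
    rintro m n ⟨γ, hγ, h⟩ s
    exact ⟨γ * refl s, mul_mem hγ (refl_mem s), h.mul_refl s⟩
  have hm : ∀ m : ℤ, ∃ γ ∈ reflGroup, IsIndex γ m 0 := by
    intro m
    induction m using Int.induction_on with
    | zero => exact ⟨1, one_mem _, isIndex_one⟩
    | succ k ih =>
      by_cases h : Even (k : ℤ)
      · simpa [neighbour, h] using step _ _ ih .arcRight
      · simpa [neighbour, h] using step _ _ ih .left
    | pred k ih =>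
      by_cases h : Even (-k : ℤ)
      · have := step _ _ ih .left
        simp only [neighbour, if_pos h] at this; exact this
      · have := step _ _ ih .arcRight
        simp only [neighbour, if_neg h] at this; exact this
  induction n using Int.induction_on with
  | zero => exact hm m
  | succ k ih =>
    by_cases h : Even (k : ℤ)
    · simpa [neighbour, h] using step _ _ ih .arcLeft
    · simpa [neighbour, h] using step _ _ ih .right
  | pred k ih =>
    by_cases h : Even (-k : ℤ)
    · have := step _ _ ih .right
      simp only [neighbour, if_pos h] at this; exact this
    · have := step _ _ ih .arcLeft
      simp only [neighbour, if_neg h] at this; exact this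

theorem norm_eq_one_of_sideFun {r : ℍ} (h : sideFun .arcLeft r = 0) : ‖(r : ℂ)‖ = 1 := by
  rw [sideFun, ← norm_coe_sq, sub_eq_zero] at h
  nlinarith [norm_nonneg (r : ℂ)]

theorem norm_sub_eq_one_of_sideFun {r : ℍ} (h : sideFun .arcRight r = 0) :
    ‖(r : ℂ) - (√2 : ℝ)‖ = 1 := by
  rw [sideFun, ← norm_coe_sub_sq, sub_eq_zero] at h
  nlinarith [norm_nonneg ((r : ℂ) - (√2 : ℝ))]

theorem sideFun_arcLeft_eq_zero {r : ℍ} (h : ‖(r : ℂ)‖ = 1) : sideFun .arcLeft r = 0 := by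
  rw [sideFun, ← norm_coe_sq, h]; norm_num

theorem sideFun_arcRight_eq_zero {r : ℍ} (h : ‖(r : ℂ) - (√2 : ℝ)‖ = 1) :
    sideFun .arcRight r = 0 := by
  rw [sideFun, ← norm_coe_sub_sq, h]; norm_num

theorem tile_neighbour {s : Side} {r : rectangle} (h : sideFun s r = 0) (m n : ℤ) :
    tile (neighbour s (m, n)).1 (neighbour s (m, n)).2 r = tile m n r := by
  cases s
  · by_cases hm : Even m
    · obtain ⟨k, rfl⟩ := hm.exists_two_nsmul
      simp only [neighbour, if_pos hm]
      rw [nsmul_eq_mul]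
      exact Quot.sound (Glue.horizontal_infinite k n r h)
    · obtain ⟨k, rfl⟩ := Int.not_even_iff_odd.1 hm
      simp only [neighbour, if_neg hm]
      have := Quot.sound (Glue.horizontal_infinite (k + 1) n r h)
      rw [show 2 * (k + 1) - 1 = 2 * k + 1 by ring, show 2 * (k + 1) = 2 * k + 1 + 1 by ring] at this
      exact this.symm
  · by_cases hm : Even n
    · obtain ⟨k, rfl⟩ := hm.exists_two_nsmul
      simp only [neighbour, if_pos hm]
      rw [nsmul_eq_mul]
      exact (Quot.sound (Glue.vertical_finite m k r (norm_eq_one_of_sideFun h))).symm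
    · obtain ⟨k, rfl⟩ := Int.not_even_iff_odd.1 hm
      simp only [neighbour, if_neg hm]
      have := Quot.sound (Glue.vertical_finite m k r (norm_eq_one_of_sideFun h))
      rw [show 2 * k + 1 - 1 = 2 * k by ring]
      exact this
  · by_cases hm : Even m
    · obtain ⟨k, rfl⟩ := hm.exists_two_nsmul
      simp only [neighbour, if_pos hm]
      rw [nsmul_eq_mul]
      exact (Quot.sound (Glue.horizontal_finite k n r (norm_sub_eq_one_of_sideFun h))).symm
    · obtain ⟨k, rfl⟩ := Int.not_even_iff_odd.1 hm
      simp only [neighbour, if_neg hm]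
      have := Quot.sound (Glue.horizontal_finite k n r (norm_sub_eq_one_of_sideFun h))
      rw [show 2 * k + 1 - 1 = 2 * k by ring]
      exact this
  · by_cases hm : Even n
    · obtain ⟨k, rfl⟩ := hm.exists_two_nsmul
      simp only [neighbour, if_pos hm]
      rw [nsmul_eq_mul]
      exact Quot.sound (Glue.vertical_infinite m k r (by simp only [sideFun] at h; linarith))
    · obtain ⟨k, rfl⟩ := Int.not_even_iff_odd.1 hm
      simp only [neighbour, if_neg hm]
      have := Quot.sound (Glue.vertical_infinite m (k + 1) r (by simp only [sideFun] at h; linarith))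
      rw [show 2 * (k + 1) - 1 = 2 * k + 1 by ring, show 2 * (k + 1) = 2 * k + 1 + 1 by ring] at this
      exact this.symm

/-- Moving around `r` within its stabilizer crosses only sides through `r`, and across these the
gluing identifies the copies of `r`. -/
theorem tile_mul_sideStabilizer {r : rectangle} {s : ℍ ≃ₜ ℍ} (hs : s ∈ sideStabilizer r) :
    ∀ {γ : ℍ ≃ₜ ℍ} {m n m' n' : ℤ}, IsIndex γ m n → IsIndex (γ * s) m' n' →
      tile m' n' r = tile m n r := by
  refine sideStabilizer_induction (p := fun s => ∀ {γ : ℍ ≃ₜ ℍ} {m n m' n' : ℤ}, IsIndex γ m n →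
    IsIndex (γ * s) m' n' → tile m' n' r = tile m n r) ?_ ?_ hs
  · intro γ m n m' n' h h'
    rw [mul_one] at h'
    obtain ⟨rfl, rfl⟩ := h.unique h'
    rfl
  · intro t s ht _ ih γ m n m' n' h h'
    rw [← mul_assoc] at h'
    rw [ih (h.mul_refl t) h', tile_neighbour ht]

theorem exists_tile_lift (z : ℍ) : ∃ p : ℤ × ℤ × rectangle, ∃ γ ∈ reflGroup,
    IsIndex γ p.1 p.2.1 ∧ γ p.2.2 = z := by
  obtain ⟨γ, hγ, h⟩ := exists_apply_mem_rectangle z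
  obtain ⟨m, n, -, hi, -⟩ := exists_isArith (inv_mem hγ)
  refine ⟨(m, n, ⟨γ z, h⟩), γ⁻¹, inv_mem hγ, hi, ?_⟩
  rw [← Homeomorph.mul_apply, inv_mul_cancel, Homeomorph.one_apply]

/-- The universal covering of the surface by the tessellated hyperbolic plane. -/
noncomputable def proj (z : ℍ) : Surface := Quot.mk Glue (exists_tile_lift z).choose

/-- The choice made in `proj` is immaterial: two lifts differ by a group element that carries a
point of the rectangle into the rectangle, hence by an element of its stabilizer, around which the
copies are glued. -/
theorem proj_apply {γ : ℍ ≃ₜ ℍ} (hγ : γ ∈ reflGroup) {m n : ℤ} (h : IsIndex γ m n)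
    (r : rectangle) : proj (γ r) = tile m n r := by
  obtain ⟨γ', hγ', h', e⟩ := (exists_tile_lift (γ r)).choose_spec
  change Quot.mk Glue (exists_tile_lift (γ r)).choose = _
  generalize (exists_tile_lift (γ r)).choose = p at h' e
  obtain ⟨m', n', r'⟩ := p
  simp only at h' e
  change tile m' n' r' = _
  have e1 : (γ'⁻¹ * γ) r = r' := by
    rw [Homeomorph.mul_apply, ← e, ← Homeomorph.mul_apply, inv_mul_cancel, Homeomorph.one_apply]
  have hs := mem_sideStabilizer_of_mem_rectangle (mul_mem (inv_mem hγ') hγ) r.2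
    (by rw [e1]; exact r'.2)
  have e2 : r' = r := Subtype.ext (by rw [← e1, apply_eq_self_of_mem_sideStabilizer hs])
  subst e2
  exact (tile_mul_sideStabilizer hs h' (by rwa [mul_inv_cancel_left])).symm

theorem exists_eq_apply (z : ℍ) : ∃ γ ∈ reflGroup, ∃ m n : ℤ, ∃ r : rectangle,
    IsIndex γ m n ∧ γ r = z := by
  obtain ⟨p, γ, hγ, h, e⟩ := exists_tile_lift z
  exact ⟨γ, hγ, p.1, p.2.1, p.2.2, h, e⟩

theorem continuous_tile (m n : ℤ) : Continuous (tile m n) :=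
  continuous_quot_mk.comp (by fun_prop)

/-- Near `γ r` only the finitely many tiles of `γ * s⁻¹`, with `s` in the stabilizer of `r`, occur,
and on each of them `proj` is given by a continuous `tile`. -/
theorem continuous_proj : Continuous proj := by
  rw [continuous_iff_continuousAt]
  intro z
  obtain ⟨γ, hγ, m, n, r, hi, rfl⟩ := exists_eq_apply z
  suffices h : ContinuousAt (proj ∘ γ) r by
    have := ContinuousAt.comp (x := γ r) (g := proj ∘ γ) (f := γ.symm)
      (by rwa [γ.symm_apply_apply]) γ.symm.continuous.continuousAt
    refine this.congr (Eventually.of_forall fun w => ?_)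
    simp
  rw [ContinuousAt, Function.comp_apply, proj_apply hγ hi r]
  intro O hO
  have hev : ∀ᶠ z in 𝓝 (r : ℍ), ∀ s ∈ (sideStabilizer r : Set (ℍ ≃ₜ ℍ)), ∀ m' n',
      IsIndex (γ * s⁻¹) m' n' → ∀ hz : s z ∈ rectangle, tile m' n' ⟨s z, hz⟩ ∈ O := by
    rw [(finite_sideStabilizer r).eventually_all]
    intro s hs
    obtain ⟨m', n', -, hi', -⟩ := exists_isArith
      (mul_mem hγ (inv_mem (sideStabilizer_le_reflGroup _ hs)))
    have e : tile m' n' r = tile m n r := tile_mul_sideStabilizer (inv_mem hs) hi hi'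
    have h1 : ∀ᶠ w in 𝓝 r, tile m' n' w ∈ O :=
      (continuous_tile m' n').continuousAt.eventually (by rw [e]; exact hO)
    rw [nhds_subtype, eventually_comap] at h1
    have h2 : Tendsto s (𝓝 (r : ℍ)) (𝓝 r) := by
      have := s.continuous.continuousAt (x := (r : ℍ))
      rwa [ContinuousAt, apply_eq_self_of_mem_sideStabilizer hs] at this
    filter_upwards [h2.eventually h1] with z hz m'' n'' hi'' hmem
    obtain ⟨rfl, rfl⟩ := hi'.unique hi''
    exact hz ⟨_, hmem⟩ rfl
  rw [mem_map]
  filter_upwards [hev, eventually_exists_mem_rectangle r.2] with z hz hz'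
  obtain ⟨s, hs, hmem, -⟩ := hz'
  obtain ⟨m', n', -, hi', -⟩ := exists_isArith
    (mul_mem hγ (inv_mem (sideStabilizer_le_reflGroup _ hs)))
  have := proj_apply (mul_mem hγ (inv_mem (sideStabilizer_le_reflGroup _ hs))) hi' ⟨_, hmem⟩
  have e : (γ * s⁻¹) (s z) = γ z := by
    rw [← Homeomorph.mul_apply, inv_mul_cancel_right]
  rw [e] at this
  change proj (γ z) ∈ O
  rw [this]
  exact hz s hs m' n' hi' hmem

theorem surjective_proj : Function.Surjective proj := by
  rintro ⟨m, n, r⟩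
  obtain ⟨γ, hγ, hi⟩ := exists_isIndex m n
  exact ⟨γ r, proj_apply hγ hi r⟩

/-- Placing every copy of the rectangle as a tile of `ℍ` is a continuous map whose composition with
`proj` is the quotient map that defines the surface. -/
theorem isQuotientMap_proj : IsQuotientMap proj := by
  choose γ hγ hi using exists_isIndex
  have hf : Continuous fun p : ℤ × ℤ × rectangle => γ p.1 p.2.1 p.2.2 := by
    rw [continuous_prod_of_discrete_left]
    intro m
    rw [continuous_prod_of_discrete_left]
    intro n
    exact (γ m n).continuous.comp continuous_subtype_val
  refine IsQuotientMap.of_comp hf continuous_proj ?_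
  convert (isQuotientMap_quot_mk : IsQuotientMap (Quot.mk Glue)) using 1
  funext p
  exact proj_apply (hγ _ _) (hi _ _) p.2.2

/-! ### Deck transformations and the covering property -/

/-- The group of deck transformations of the universal covering. -/
noncomputable def deckGroup : Subgroup (ℍ ≃ₜ ℍ) where
  carrier := {γ | γ ∈ reflGroup ∧ ∀ z, hCoord (γ z) = hCoord z ∧ vCoord (γ z) = vCoord z}
  mul_mem' := by
    rintro a b ⟨ha, ha'⟩ ⟨hb, hb'⟩
    refine ⟨mul_mem ha hb, fun z => ?_⟩
    rw [Homeomorph.mul_apply, (ha' _).1, (ha' _).2]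
    exact hb' z
  one_mem' := ⟨one_mem _, fun z => ⟨rfl, rfl⟩⟩
  inv_mem' := by
    rintro a ⟨ha, ha'⟩
    refine ⟨inv_mem ha, fun z => ?_⟩
    have := ha' (a⁻¹ z)
    rw [← Homeomorph.mul_apply, mul_inv_cancel, Homeomorph.one_apply] at this
    exact ⟨this.1.symm, this.2.symm⟩

theorem mem_reflGroup_of_mem_deckGroup {k : ℍ ≃ₜ ℍ} (hk : k ∈ deckGroup) : k ∈ reflGroup := hk.1

theorem isIndex_of_mem_deckGroup {k : ℍ ≃ₜ ℍ} (hk : k ∈ deckGroup) : IsIndex k 0 0 := fun z => by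
  have := hk.2 z
  simpa [fold] using this

theorem IsIndex.deck_mul {γ k : ℍ ≃ₜ ℍ} {m n : ℤ} (h : IsIndex γ m n) (hk : k ∈ deckGroup) :
    IsIndex (k * γ) m n := fun z => by
  rw [Homeomorph.mul_apply, (hk.2 _).1, (hk.2 _).2]
  exact h z

theorem mul_inv_mem_deckGroup {γ γ' : ℍ ≃ₜ ℍ} (hγ : γ ∈ reflGroup) (hγ' : γ' ∈ reflGroup)
    {m n : ℤ} (h : IsIndex γ m n) (h' : IsIndex γ' m n) : γ' * γ⁻¹ ∈ deckGroup := by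
  refine ⟨mul_mem hγ' (inv_mem hγ), fun z => ?_⟩
  have h1 := h (γ⁻¹ z)
  have h2 := h' (γ⁻¹ z)
  rw [← Homeomorph.mul_apply, mul_inv_cancel, Homeomorph.one_apply] at h1
  rw [Homeomorph.mul_apply, h1.1, h1.2, h2.1, h2.2]
  exact ⟨rfl, rfl⟩

theorem Glue.exists_neighbour {p q : ℤ × ℤ × rectangle} (h : Glue p q) : ∃ s : Side,
    sideFun s p.2.2 = 0 ∧ q.2.2 = p.2.2 ∧ neighbour s (p.1, p.2.1) = (q.1, q.2.1) ∧
      neighbour s (q.1, q.2.1) = (p.1, p.2.1) := by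
  cases h with
  | horizontal_infinite k n z hz =>
    refine ⟨.left, hz, rfl, ?_, ?_⟩
    · have : ¬ Even (2 * k - 1) := by simp [parity_simps]
      simp [neighbour, this]
    · simp [neighbour]
  | horizontal_finite k n z hz =>
    refine ⟨.arcRight, sideFun_arcRight_eq_zero hz, rfl, ?_, ?_⟩
    · simp [neighbour]
    · have : ¬ Even (2 * k + 1) := by simp [parity_simps]
      simp [neighbour, this]
  | vertical_infinite m k z hz =>
    refine ⟨.right, by simp [sideFun, hz], rfl, ?_, ?_⟩
    · have : ¬ Even (2 * k - 1) := by simp [parity_simps]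
      simp [neighbour, this]
    · simp [neighbour]
  | vertical_finite m k z hz =>
    refine ⟨.arcLeft, sideFun_arcLeft_eq_zero hz, rfl, ?_, ?_⟩
    · simp [neighbour]
    · have : ¬ Even (2 * k + 1) := by simp [parity_simps]
      simp [neighbour, this]

theorem fiber_subset_neighbour {s : Side} {r : rectangle} (hs : sideFun s r = 0) {p q : ℤ × ℤ}
    (h : neighbour s p = q) {z : ℍ} (hz : ∃ γ ∈ reflGroup, IsIndex γ p.1 p.2 ∧ γ r = z) :
    ∃ γ ∈ reflGroup, IsIndex γ q.1 q.2 ∧ γ r = z := by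
  obtain ⟨γ, hγ, hi, rfl⟩ := hz
  refine ⟨γ * refl s, mul_mem hγ (refl_mem s), h ▸ hi.mul_refl s, ?_⟩
  rw [Homeomorph.mul_apply, refl_eq_self hs]

/-- The set of positions in `ℍ` of a point of a copy is unchanged by each elementary gluing, so it
descends to the quotient as the fibre. This avoids any description of the equivalence relation
generated by `Glue`. -/
theorem exists_of_tile_eq {m n m' n' : ℤ} {r r' : rectangle} (h : tile m n r = tile m' n' r')
    {γ : ℍ ≃ₜ ℍ} (hγ : γ ∈ reflGroup) (hi : IsIndex γ m' n') :
    ∃ γ' ∈ reflGroup, IsIndex γ' m n ∧ γ' r = γ r' := by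
  let F : Surface → Set ℍ := Quot.lift
    (fun p => {z | ∃ γ ∈ reflGroup, IsIndex γ p.1 p.2.1 ∧ γ p.2.2 = z}) (by
      intro p q hpq
      obtain ⟨s, hs, hr, h1, h2⟩ := hpq.exists_neighbour
      apply Subset.antisymm
      · intro z hz
        have := fiber_subset_neighbour hs h1 hz
        rw [← hr] at this
        exact this
      · intro z hz
        rw [← hr] at hs
        have := fiber_subset_neighbour hs h2 hz
        rw [hr] at this
        exact this)
  have hF : γ r' ∈ F (tile m' n' r') := ⟨γ, hγ, hi, rfl⟩
  rw [← h] at hF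
  exact hF

theorem proj_eq_iff {z w : ℍ} : proj z = proj w ↔ ∃ k ∈ deckGroup, k z = w := by
  obtain ⟨γ, hγ, m, n, r, hi, rfl⟩ := exists_eq_apply z
  constructor
  · intro h
    obtain ⟨γ', hγ', m', n', r', hi', rfl⟩ := exists_eq_apply w
    rw [proj_apply hγ hi, proj_apply hγ' hi'] at h
    obtain ⟨γ'', hγ'', hi'', e⟩ := exists_of_tile_eq h hγ' hi'
    refine ⟨γ'' * γ⁻¹, mul_inv_mem_deckGroup hγ hγ'' hi hi'', ?_⟩
    rw [← e, ← Homeomorph.mul_apply, inv_mul_cancel_right]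
  · rintro ⟨k, hk, rfl⟩
    rw [← Homeomorph.mul_apply, proj_apply hγ hi, proj_apply (mul_mem hk.1 hγ) (hi.deck_mul hk)]

/-- The tiles that meet at a point lie over different grid squares. This is why nontrivial deck
transformations have no fixed points. -/
theorem eq_one_of_isIndex_mul {γ s : ℍ ≃ₜ ℍ} {r : ℍ} (hs : s ∈ sideStabilizer r) {m n : ℤ}
    (h : IsIndex γ m n) (h' : IsIndex (γ * s) m n) : s = 1 := by
  obtain ⟨i, j, hij, hst⟩ := exists_adjacent_mem_sideStabilizer r
  rcases hst s hs with rfl | rfl | rfl | rfl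
  · rfl
  · exfalso
    have := (h.mul_refl i).unique h'
    cases hij <;> simp only [neighbour] at this <;> split_ifs at this <;> omega
  · exfalso
    have := (h.mul_refl j).unique h'
    cases hij <;> simp only [neighbour] at this <;> split_ifs at this <;> omega
  · exfalso
    rw [← mul_assoc] at h'
    have := ((h.mul_refl i).mul_refl j).unique h'
    cases hij <;> simp only [neighbour] at this <;> split_ifs at this <;> omega

noncomputable instance : MulAction deckGroup ℍ where
  smul k z := k.1 z
  one_smul _ := rfl
  mul_smul _ _ _ := rfl

theorem isQuotientCoveringMap_proj : IsQuotientCoveringMap proj deckGroup where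
  toIsQuotientMap := isQuotientMap_proj
  continuous_const_smul k := k.1.continuous
  apply_eq_iff_mem_orbit {z w} := by
    rw [eq_comm, proj_eq_iff]
    constructor
    · rintro ⟨k, hk, h⟩
      exact ⟨⟨k, hk⟩, h⟩
    · rintro ⟨k, h⟩
      exact ⟨k.1, k.2, h⟩
  disjoint z := by
    obtain ⟨γ, hγ, m, n, r, hi, rfl⟩ := exists_eq_apply z
    -- The evenly covered neighbourhood is the star of the tiles around the point.
    refine ⟨γ.symm ⁻¹' _, γ.symm.continuous.continuousAt.preimage_mem_nhds
      (by rw [γ.symm_apply_apply]; exact eventually_exists_mem_rectangle r.2), ?_⟩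
    rintro ⟨k, hk⟩ ⟨_, ⟨w, ⟨s, hs, hsr, hsw⟩, rfl⟩, ⟨s', hs', hsr', hsw'⟩⟩
    have hs0 := sideStabilizer_le_reflGroup _ hs
    have hs0' := sideStabilizer_le_reflGroup _ hs'
    -- If `k` returns a point of the star to the star, folding both points into the rectangle gives
    -- `σ`, which lies in a side stabilizer by strictness of the fundamental domain. By `hsw` that
    -- stabilizer is contained in the one of `r`.
    set σ := s' * (γ⁻¹ * k * γ) * s⁻¹ with hσ
    have e : σ (s (γ.symm w)) = s' (γ.symm (k w)) := by
      rw [hσ]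
      simp only [Homeomorph.mul_apply]
      rw [← Homeomorph.mul_apply s⁻¹ s, inv_mul_cancel, Homeomorph.one_apply, γ.apply_symm_apply]
      rfl
    have h1 := mem_sideStabilizer_of_mem_rectangle (γ := σ)
      (mul_mem (mul_mem hs0' (mul_mem (mul_mem (inv_mem hγ) hk.1) hγ)) (inv_mem hs0)) hsr
      (by rw [e]; exact hsr')
    have h2 : σ ∈ sideStabilizer r :=
      Subgroup.closure_mono (image_mono fun t ht => hsw t ht) h1
    have h3 : γ⁻¹ * k * γ ∈ sideStabilizer r := by
      have : γ⁻¹ * k * γ = s'⁻¹ * σ * s := by rw [hσ]; group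
      rw [this]
      exact mul_mem (mul_mem (inv_mem hs') h2) hs
    have h4 := eq_one_of_isIndex_mul h3 hi (by
      rw [← mul_assoc, mul_inv_cancel_left]
      exact hi.deck_mul hk)
    apply Subtype.ext
    have : k = γ * (γ⁻¹ * k * γ) * γ⁻¹ := by group
    change k = 1
    rw [this, h4]; group

theorem isCoveringMap_proj : IsCoveringMap proj :=
  IsQuotientCoveringMap.isCoveringMap proj deckGroup isQuotientCoveringMap_proj

/-! ## The hyperbolic structure of the glued surface -/

/-! ### The surface is a connected Hausdorff space -/

theorem fold_mem_Icc (m : ℤ) {x : ℝ} (h0 : 0 ≤ x) (h1 : x ≤ 1) :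
    (m : ℝ) ≤ fold m x ∧ fold m x ≤ m + 1 := by
  by_cases h : Even m
  · rw [fold_even h]; constructor <;> linarith
  · rw [fold_odd h]; constructor <;> linarith

theorem eq_or_eq_of_fold_eq {m m' : ℤ} {x : ℝ} (h0 : 0 ≤ x) (h1 : x ≤ 1)
    (h : fold m x = fold m' x) : m' = m ∨ (x = 0 ∧ m' = if Even m then m - 1 else m + 1) ∨
      (x = 1 ∧ m' = if Even m then m + 1 else m - 1) := by
  have hm := fold_mem_Icc m h0 h1
  have hm' := fold_mem_Icc m' h0 h1
  rw [← h] at hm'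
  have a1 : m' ≤ m + 1 := by exact_mod_cast hm'.1.trans hm.2
  have a2 : m ≤ m' + 1 := by exact_mod_cast hm.1.trans hm'.2
  rcases (by omega : m' = m ∨ m' = m + 1 ∨ m' = m - 1) with rfl | rfl | rfl
  · exact Or.inl rfl
  · push_cast at hm'
    by_cases hm0 : Even m
    · rw [fold_even hm0] at hm'
      exact Or.inr (Or.inr ⟨by linarith, by rw [if_pos hm0]⟩)
    · rw [fold_odd hm0] at hm'
      exact Or.inr (Or.inl ⟨by linarith, by rw [if_neg hm0]⟩)
  · push_cast at hm'
    by_cases hm0 : Even m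
    · rw [fold_even hm0] at hm'
      exact Or.inr (Or.inl ⟨by linarith, by rw [if_pos hm0]⟩)
    · rw [fold_odd hm0] at hm'
      exact Or.inr (Or.inr ⟨by linarith, by rw [if_neg hm0]⟩)

/-- A continuous function on the rectangle with values `0` and `1` on two opposite sides. -/
noncomputable def sideRatio (s t : Side) (r : ℍ) : ℝ := sideFun s r / (sideFun s r + sideFun t r)

/-- Opposite sides are disjoint, so their defining functions never vanish together; this makes
`sideRatio` continuous on the rectangle. -/
theorem sideFun_add_pos {r : ℍ} (hr : r ∈ rectangle) :
    0 < sideFun .left r + sideFun .arcRight r ∧ 0 < sideFun .right r + sideFun .arcLeft r := by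
  rw [mem_rectangle_iff] at hr
  have h1 := hr .left
  have h2 := hr .right
  have h3 := hr .arcLeft
  have h4 := hr .arcRight
  simp only [sideFun] at h1 h2 h3 h4 ⊢
  have hs := sqrt_two_mul_self
  have hs1 := one_lt_sqrt_two
  have hy := r.im_pos
  constructor <;> nlinarith

theorem sideRatio_mem_Icc {s t : Side} {r : ℍ} (hr : r ∈ rectangle)
    (h : 0 < sideFun s r + sideFun t r) : 0 ≤ sideRatio s t r ∧ sideRatio s t r ≤ 1 := by
  rw [mem_rectangle_iff] at hr
  unfold sideRatio
  exact ⟨div_nonneg (hr s) h.le, (div_le_one h).2 (by linarith [hr t])⟩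

theorem sideRatio_eq_zero_iff {s t : Side} {r : ℍ} (h : 0 < sideFun s r + sideFun t r) :
    sideRatio s t r = 0 ↔ sideFun s r = 0 := by
  rw [sideRatio, div_eq_zero_iff, or_iff_left h.ne']

theorem sideRatio_eq_one_iff {s t : Side} {r : ℍ} (h : 0 < sideFun s r + sideFun t r) :
    sideRatio s t r = 1 ↔ sideFun t r = 0 := by
  rw [sideRatio, div_eq_one_iff_eq h.ne']
  constructor <;> intro h <;> linarith

theorem fold_neighbour_zero (m : ℤ) : fold (if Even m then m - 1 else m + 1) 0 = fold m 0 := by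
  rw [← fold_neg_arg, neg_zero]

theorem fold_neighbour_one (m : ℤ) : fold (if Even m then m + 1 else m - 1) 1 = fold m 1 := by
  rw [← fold_two_sub]; norm_num

/-- A continuous injection of the surface into a Hausdorff space. -/
noncomputable def surfaceEmbedding : Surface → ℝ × ℝ × rectangle := Quot.lift
  (fun p => (fold p.1 (sideRatio .left .arcRight p.2.2),
    fold p.2.1 (sideRatio .right .arcLeft p.2.2), p.2.2)) (by
    rintro ⟨m, n, r⟩ ⟨m', n', r'⟩ h
    obtain ⟨s, hs, hr, h1, -⟩ := h.exists_neighbour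
    simp only at hs hr h1 ⊢
    subst hr
    obtain ⟨p1, p2⟩ := sideFun_add_pos r'.2
    cases s <;> simp only [neighbour, Prod.mk.injEq] at h1 <;> obtain ⟨rfl, rfl⟩ := h1
    · rw [(sideRatio_eq_zero_iff p1).2 hs, fold_neighbour_zero]
    · rw [(sideRatio_eq_one_iff p2).2 hs, fold_neighbour_one]
    · rw [(sideRatio_eq_one_iff p1).2 hs, fold_neighbour_one]
    · rw [(sideRatio_eq_zero_iff p2).2 hs, fold_neighbour_zero])

theorem continuous_fold (m : ℤ) : Continuous (fold m) := by
  by_cases h : Even m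
  · have : fold m = fun x => (m : ℝ) + x := funext (fold_even h)
    rw [this]; fun_prop
  · have : fold m = fun x => (m : ℝ) + 1 - x := funext (fold_odd h)
    rw [this]; fun_prop

theorem continuous_surfaceEmbedding : Continuous surfaceEmbedding := by
  refine continuous_quot_lift _ ?_
  rw [continuous_prod_of_discrete_left]
  intro m
  rw [continuous_prod_of_discrete_left]
  intro n
  have c : ∀ s, Continuous fun r : rectangle => sideFun s r := fun s =>
    (continuous_sideFun s).comp continuous_subtype_val
  refine ((continuous_fold m).comp ?_).prodMk (((continuous_fold n).comp ?_).prodMk continuous_id)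
  · exact (c _).div ((c _).add (c _)) fun r => (sideFun_add_pos r.2).1.ne'
  · exact (c _).div ((c _).add (c _)) fun r => (sideFun_add_pos r.2).2.ne'

theorem injective_surfaceEmbedding : Function.Injective surfaceEmbedding := by
  rintro ⟨m, n, r⟩ ⟨m', n', r'⟩ h
  change (_, _, r) = (_, _, r') at h
  simp only [Prod.mk.injEq] at h
  obtain ⟨h1, h2, rfl⟩ := h
  obtain ⟨p1, p2⟩ := sideFun_add_pos r.2
  obtain ⟨a1, b1⟩ := sideRatio_mem_Icc r.2 p1
  obtain ⟨a2, b2⟩ := sideRatio_mem_Icc r.2 p2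
  change tile m n r = tile m' n' r
  have e1 : tile m n r = tile m' n r := by
    rcases eq_or_eq_of_fold_eq a1 b1 h1 with rfl | ⟨h, rfl⟩ | ⟨h, rfl⟩
    · rfl
    · exact (tile_neighbour (s := .left) ((sideRatio_eq_zero_iff p1).1 h) m n).symm
    · exact (tile_neighbour (s := .arcRight) ((sideRatio_eq_one_iff p1).1 h) m n).symm
  rw [e1]
  rcases eq_or_eq_of_fold_eq a2 b2 h2 with rfl | ⟨h, rfl⟩ | ⟨h, rfl⟩
  · rfl
  · exact (tile_neighbour (s := .right) ((sideRatio_eq_zero_iff p2).1 h) m' n).symm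
  · exact (tile_neighbour (s := .arcLeft) ((sideRatio_eq_one_iff p2).1 h) m' n).symm

instance t2Space_surface : T2Space Surface :=
  T2Space.of_injective_continuous injective_surfaceEmbedding continuous_surfaceEmbedding

instance connectedSpace_surface : ConnectedSpace Surface :=
  surjective_proj.connectedSpace continuous_proj

/-! ### Möbius transformations -/

theorem exists_specialLinear_smul_eq {g : GL (Fin 2) ℝ} (hg : 0 < g.det.val) :
    ∃ h : SL(2, ℝ), ∀ z : ℍ, h • z = g • z := by
  have hd : √g.det.val * √g.det.val = g.det.val := Real.mul_self_sqrt hg.le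
  have hs : 0 < √g.det.val := Real.sqrt_pos.2 hg
  have hdet : g.det.val = g 0 0 * g 1 1 - g 0 1 * g 1 0 := by
    rw [Matrix.GeneralLinearGroup.val_det_apply, Matrix.det_fin_two]
  set d := √g.det.val
  let h : SL(2, ℝ) := ⟨!![g 0 0 / d, g 0 1 / d; g 1 0 / d, g 1 1 / d], by
    rw [Matrix.det_fin_two_of]
    field_simp
    nlinarith⟩
  have h00 : h 0 0 = g 0 0 / d := rfl
  have h01 : h 0 1 = g 0 1 / d := rfl
  have h10 : h 1 0 = g 1 0 / d := rfl
  have h11 : h 1 1 = g 1 1 / d := rfl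
  refine ⟨h, fun z => UpperHalfPlane.ext ?_⟩
  rw [coe_specialLinearGroup_apply, coe_smul_of_det_pos hg]
  have hd' : (d : ℂ) ≠ 0 := by exact_mod_cast hs.ne'
  simp only [num, denom, Algebra.algebraMap_self, RingHom.id_apply, h00, h01, h10, h11,
    Complex.ofReal_div]
  have e (x y : ℂ) : x / d * z + y / d = (x * z + y) / d := by field_simp
  rw [e, e, div_div_div_cancel_right₀ hd']

/-- Fixed points solve a real quadratic equation, which has at most one root in the upper half-plane
unless it is trivial. -/
theorem smul_eq_self_of_two_fixed {g : GL (Fin 2) ℝ} (hg : 0 < g.det.val) {z w : ℍ} (hne : w ≠ z)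
    (hz : g • z = z) (hw : g • w = w) (x : ℍ) : g • x = x := by
  rw [gl_smul_eq_self_iff_quadratic hg] at hz hw ⊢
  have hre := fun u : ℍ => fun h : (g 1 0 : ℂ) * (u * u) + (g 1 1 - g 0 0) * u + -g 0 1 = 0 =>
    And.intro (congrArg Complex.re h) (congrArg Complex.im h)
  obtain ⟨hz1, hz2⟩ := hre z hz
  obtain ⟨hw1, hw2⟩ := hre w hw
  simp at hz1 hz2 hw1 hw2
  have pz := z.im_pos
  have pw := w.im_pos
  have ez : g 1 0 * (2 * z.re) + (g 1 1 - g 0 0) = 0 := by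
    have : z.im * (g 1 0 * (2 * z.re) + (g 1 1 - g 0 0)) = 0 := by linarith
    exact (mul_eq_zero.1 this).resolve_left pz.ne'
  have ew : g 1 0 * (2 * w.re) + (g 1 1 - g 0 0) = 0 := by
    have : w.im * (g 1 0 * (2 * w.re) + (g 1 1 - g 0 0)) = 0 := by linarith
    exact (mul_eq_zero.1 this).resolve_left pw.ne'
  have hc : g 1 0 = 0 := by
    by_contra hc
    apply hne
    have er : w.re = z.re := by
      have : g 1 0 * (w.re - z.re) = 0 := by linarith
      linarith [(mul_eq_zero.1 this).resolve_left hc]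
    refine UpperHalfPlane.ext_re_im er ?_
    rw [er] at hw1
    have : g 1 0 * (z.im * z.im - w.im * w.im) = 0 := by linarith
    have := (mul_eq_zero.1 this).resolve_left hc
    nlinarith
  have hda : g 1 1 - g 0 0 = 0 := by rw [hc] at ez; linarith
  have hb : g 0 1 = 0 := by rw [hc, hda] at hz1; linarith
  have hda' : (g 1 1 : ℂ) - g 0 0 = 0 := by exact_mod_cast congrArg Complex.ofReal hda
  rw [hda', hc, hb]; simp

theorem smul_eq_smul_of_two_points {g h : GL (Fin 2) ℝ} (hgh : 0 < g.det.val ↔ 0 < h.det.val)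
    {z w : ℍ} (hne : w ≠ z) (hz : g • z = h • z) (hw : g • w = h • w) (x : ℍ) : g • x = h • x := by
  have := smul_eq_self_of_two_fixed (g := h⁻¹ * g) ?_ hne (by rw [mul_smul, hz, inv_smul_smul])
    (by rw [mul_smul, hw, inv_smul_smul]) x
  · rwa [mul_smul, inv_smul_eq_iff] at this
  · rw [map_mul, map_inv, Units.val_mul, Units.val_inv_eq_inv_val]
    by_cases hg : 0 < g.det.val
    · exact mul_pos (inv_pos.2 (hgh.1 hg)) hg
    · have h1 : g.det.val < 0 := lt_of_le_of_ne (not_lt.1 hg) g.det.ne_zero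
      have h2 : h.det.val < 0 :=
        lt_of_le_of_ne (not_lt.1 (fun h' => hg (hgh.2 h'))) h.det.ne_zero
      exact mul_pos_of_neg_of_neg (inv_lt_zero.2 h2) h1

/-! ### The charts -/

theorem exists_nonneg_im_sq {x : ℝ} (h0 : 0 ≤ x) (h1 : x ≤ √2 / 2) :
    0 < √(1 - x ^ 2) ∧ √(1 - x ^ 2) ^ 2 = 1 - x ^ 2 := by
  have hs := sqrt_two_mul_self
  have : 0 < 1 - x ^ 2 := by nlinarith
  exact ⟨Real.sqrt_pos.2 this, Real.sq_sqrt this.le⟩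

/-- The points of a side of the rectangle are accumulation points of the side. -/
theorem accPt_side {r : ℍ} (hr : r ∈ rectangle) {s : Side} (hs : sideFun s r = 0) :
    AccPt r (𝓟 {w | w ∈ rectangle ∧ sideFun s w = 0}) := by
  -- Each side is parametrised by an interval, and a preconnected set with more than one point has
  -- no isolated points.
  have key : ∀ (J : Set ℝ) (f g : ℝ → ℝ) (hpos : ∀ x ∈ J, 0 < g x), Convex ℝ J → Continuous f →
      Continuous g → (∃ x ∈ J, ∃ y ∈ J, f x ≠ f y ∨ g x ≠ g y) →
      (∀ x (hx : x ∈ J), (⟨⟨f x, g x⟩, hpos x hx⟩ : ℍ) ∈ {w | w ∈ rectangle ∧ sideFun s w = 0}) →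
      (∃ x ∈ J, r.re = f x ∧ r.im = g x) → AccPt r (𝓟 {w | w ∈ rectangle ∧ sideFun s w = 0}) := by
    rintro J f g hpos hJ hf hg ⟨x, hx, y, hy, hxy⟩ hsub ⟨u, hu, h1, h2⟩
    have : PreconnectedSpace J := Subtype.preconnectedSpace hJ.isPreconnected
    let φ : J → ℍ := fun x => ⟨⟨f x, g x⟩, hpos x x.2⟩
    have hφ : Continuous φ := by
      rw [isEmbedding_coe.continuous_iff]
      exact Complex.equivRealProdCLM.symm.continuous.comp
        ((hf.comp continuous_subtype_val).prodMk (hg.comp continuous_subtype_val))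
    have hn : (range φ).Nontrivial := by
      refine ⟨φ ⟨x, hx⟩, mem_range_self _, φ ⟨y, hy⟩, mem_range_self _, fun h => ?_⟩
      rcases hxy with h' | h'
      · exact h' (congrArg UpperHalfPlane.re h)
      · exact h' (congrArg UpperHalfPlane.im h)
    have := (isPreconnected_range hφ).preperfect_of_nontrivial hn r
      ⟨⟨u, hu⟩, UpperHalfPlane.ext_re_im h1.symm h2.symm⟩
    refine this.mono (principal_mono.2 ?_)
    rintro _ ⟨⟨x, hx⟩, rfl⟩
    exact hsub x hx
  have hs0 := sqrt_two_mul_self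
  have hs1 := one_lt_sqrt_two
  have hr' := mem_rectangle_iff.1 hr
  have r1 := hr' .left
  have r2 := hr' .right
  have r3 := hr' .arcLeft
  have r4 := hr' .arcRight
  have hy := r.im_pos
  have hmem : ∀ w : ℍ, 0 ≤ w.re → w.re ≤ √2 → 0 ≤ w.re ^ 2 + w.im ^ 2 - 1 →
      0 ≤ (w.re - √2) ^ 2 + w.im ^ 2 - 1 → w ∈ rectangle := by
    intro w h1 h2 h3 h4
    rw [mem_rectangle_iff]
    intro s
    cases s
    · exact h1
    · exact h3
    · exact h4
    · exact sub_nonneg.2 h2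
  cases s <;> simp only [sideFun] at hs r1 r2 r3 r4
  · refine key (Ici 1) (fun _ => 0) id (fun x hx => one_pos.trans_le hx) (convex_Ici 1)
      continuous_const continuous_id ⟨1, self_mem_Ici, 2, by norm_num, by norm_num⟩ ?_
      ⟨r.im, ?_, hs, rfl⟩
    · intro x hx
      have hx : 1 ≤ x := hx
      refine ⟨hmem _ ?_ ?_ ?_ ?_, ?_⟩ <;> simp only [sideFun, UpperHalfPlane.re,
        UpperHalfPlane.im, id] <;> nlinarith
    · rw [hs] at r3
      change 1 ≤ r.im
      nlinarith
  · have him : r.im = √(1 - r.re ^ 2) := by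
      rw [eq_comm, Real.sqrt_eq_iff_mul_self_eq_of_pos hy]; linarith
    refine key (Icc 0 (√2 / 2)) id (fun x => √(1 - x ^ 2))
      (fun x hx => (exists_nonneg_im_sq hx.1 hx.2).1) (convex_Icc _ _) continuous_id (by fun_prop)
      ⟨0, ⟨le_rfl, by positivity⟩, √2 / 2, ⟨by positivity, le_rfl⟩, Or.inl ?_⟩ ?_
      ⟨r.re, ⟨r1, by nlinarith⟩, rfl, him⟩
    · have : 0 < √2 / 2 := by positivity
      exact this.ne
    · intro x hx
      have h2 := (exists_nonneg_im_sq hx.1 hx.2).2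
      obtain ⟨h3, h4⟩ := hx
      refine ⟨hmem _ ?_ ?_ ?_ ?_, ?_⟩ <;> simp only [sideFun, UpperHalfPlane.re, UpperHalfPlane.im, id]
        <;> nlinarith
  · have him : r.im = √(1 - (√2 - r.re) ^ 2) := by
      rw [eq_comm, Real.sqrt_eq_iff_mul_self_eq_of_pos hy]; linarith
    refine key (Icc 0 (√2 / 2)) (fun x => √2 - x) (fun x => √(1 - x ^ 2))
      (fun x hx => (exists_nonneg_im_sq hx.1 hx.2).1) (convex_Icc _ _) (by fun_prop) (by fun_prop)
      ⟨0, ⟨le_rfl, by positivity⟩, √2 / 2, ⟨by positivity, le_rfl⟩, Or.inl ?_⟩ ?_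
      ⟨√2 - r.re, ⟨r2, by nlinarith⟩, by ring, him⟩
    · have : 0 < √2 / 2 := by positivity
      linarith
    · intro x hx
      have h2 := (exists_nonneg_im_sq hx.1 hx.2).2
      obtain ⟨h3, h4⟩ := hx
      refine ⟨hmem _ ?_ ?_ ?_ ?_, ?_⟩ <;> simp only [sideFun, UpperHalfPlane.re, UpperHalfPlane.im]
        <;> nlinarith
  · refine key (Ici 1) (fun _ => √2) id (fun x hx => one_pos.trans_le hx) (convex_Ici 1)
      continuous_const continuous_id ⟨1, self_mem_Ici, 2, by norm_num, by norm_num⟩ ?_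
      ⟨r.im, ?_, by linarith, rfl⟩
    · intro x hx
      have hx : 1 ≤ x := hx
      refine ⟨hmem _ ?_ ?_ ?_ ?_, ?_⟩ <;> simp only [sideFun, UpperHalfPlane.re,
        UpperHalfPlane.im, id] <;> nlinarith
    · change 1 ≤ r.im
      have : r.re = √2 := by linarith
      rw [this] at r4
      nlinarith

theorem exists_isIndex_apply_eq {m n : ℤ} {r : rectangle} {z : ℍ} (h : proj z = tile m n r) :
    ∃ γ ∈ reflGroup, IsIndex γ m n ∧ γ r = z := by
  obtain ⟨γ, hγ, m', n', r', hi, rfl⟩ := exists_eq_apply z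
  rw [proj_apply hγ hi] at h
  exact exists_of_tile_eq h.symm hγ hi

/-- The elements of the reflection group, as matrices. -/
theorem exists_matrix {γ : ℍ ≃ₜ ℍ} (hγ : γ ∈ reflGroup) {m n : ℤ} (hi : IsIndex γ m n) :
    ∃ M : GL (Fin 2) ℝ, (∀ z, γ z = M • z) ∧ (0 < M.det.val ↔ Even (m + n)) ∧ IsArith M m n := by
  obtain ⟨m', n', M, h1, h2, h3⟩ := exists_isArith hγ
  obtain ⟨rfl, rfl⟩ := hi.unique h1
  refine ⟨M, h2, ?_, h3⟩
  rcases h3.det with ⟨h, h'⟩ | ⟨h, h'⟩ <;> rw [h] <;> simp [h']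

theorem symm_mem_charts {e : OpenPartialHomeomorph ℍ Surface} (he : ⇑e = proj) :
    e.symm ∈ charts := by
  intro m n r hr
  have hr' : tile m n r ∈ e.target := hr
  have h1 : proj (e.symm (tile m n r)) = tile m n r := by
    rw [← he]; exact e.right_inv hr'
  obtain ⟨γ, hγ, hi, hγr⟩ := exists_isIndex_apply_eq h1
  obtain ⟨M, hM, hdet, -⟩ := exists_matrix hγ hi
  refine ⟨M, hdet, ?_⟩
  have hc : ContinuousAt (fun w : rectangle => γ w) r :=
    (γ.continuous.comp continuous_subtype_val).continuousAt
  have : e.source ∈ 𝓝 (γ r) := by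
    rw [hγr]; exact e.open_source.mem_nhds (e.map_target hr')
  filter_upwards [hc this] with w hw
  rw [← hM, ← proj_apply hγ hi, ← he]
  exact e.left_inv hw

theorem exists_chart (z : ℍ) : ∃ e ∈ charts, proj z ∈ e.source := by
  obtain ⟨e, hz, he⟩ := isCoveringMap_proj.isLocalHomeomorph z
  refine ⟨e.symm, symm_mem_charts he.symm, ?_⟩
  rw [he]
  exact e.map_source hz

/-- Every chart is locally the inverse of the universal covering, up to an isometry. -/
theorem exists_smul_eq_chart {e : OpenPartialHomeomorph Surface ℍ} (he : e ∈ charts) {z : ℍ}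
    (hz : proj z ∈ e.source) : ∃ g : SL(2, ℝ), ∀ᶠ w in 𝓝 z, e (proj w) = g • w := by
  obtain ⟨γ, hγ, m, n, r, hi, rfl⟩ := exists_eq_apply z
  have hst : ∀ s ∈ sideStabilizer r, s ∈ reflGroup := fun s hs => sideStabilizer_le_reflGroup _ hs
  have H : ∀ s ∈ sideStabilizer r, ∃ (m' n' : ℤ) (h : GL (Fin 2) ℝ) (M : GL (Fin 2) ℝ),
      IsIndex (γ * s⁻¹) m' n' ∧ (∀ x, (γ * s⁻¹) x = M • x) ∧ (0 < M.det.val ↔ Even (m' + n')) ∧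
      (0 < h.det.val ↔ Even (m' + n')) ∧ ∀ᶠ w in 𝓝 r, e (tile m' n' w) = h • (w : ℍ) := by
    intro s hs
    obtain ⟨m', n', -, hi', -⟩ := exists_isArith (mul_mem hγ (inv_mem (hst s hs)))
    obtain ⟨M, hM, hdet, -⟩ := exists_matrix (mul_mem hγ (inv_mem (hst s hs))) hi'
    have ht : tile m' n' r = tile m n r := tile_mul_sideStabilizer (inv_mem hs) hi hi'
    obtain ⟨h, hd, hev⟩ := he m' n' r (by rw [ht, ← proj_apply hγ hi]; exact hz)
    exact ⟨m', n', h, M, hi', hM, hdet, hd, hev⟩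
  choose! m' n' h M hi' hM hdet hd hev using H
  -- The chart on a tile and the placement of that tile in `ℍ` have the same orientation, given by
  -- the parity of `m' + n'`.
  have hpos : ∀ s ∈ sideStabilizer r, 0 < (h s * (M s)⁻¹).det.val := by
    intro s hs
    have h1 := (hd s hs).trans (hdet s hs).symm
    rw [map_mul, map_inv, Units.val_mul, Units.val_inv_eq_inv_val]
    by_cases hg : 0 < (h s).det.val
    · exact mul_pos hg (inv_pos.2 (h1.1 hg))
    · have h3 : (h s).det.val < 0 := lt_of_le_of_ne (not_lt.1 hg) (h s).det.ne_zero
      have h2 : (M s).det.val < 0 :=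
        lt_of_le_of_ne (not_lt.1 (fun h' => hg (h1.2 h'))) (M s).det.ne_zero
      exact mul_pos_of_neg_of_neg h3 (inv_lt_zero.2 h2)
  -- Neighbouring tiles share a side through `r`, on which the two expressions of the chart agree;
  -- besides `r` it contains another point nearby. Two points determine an orientation preserving
  -- isometry, so all tiles around `r` give the same one.
  have hagree : ∀ s ∈ sideStabilizer r, ∀ x : ℍ, (h s * (M s)⁻¹) • x = (h 1 * (M 1)⁻¹) • x := by
    intro s hs
    refine (sideStabilizer_induction (p := fun s => s ∈ sideStabilizer r ∧
      ∀ x : ℍ, (h s * (M s)⁻¹) • x = (h 1 * (M 1)⁻¹) • x) ⟨one_mem _, fun x => rfl⟩ ?_ hs).2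
    rintro t s ht - ⟨hs, ih⟩
    have hts : refl t * s ∈ sideStabilizer r := mul_mem (refl_mem_sideStabilizer ht) hs
    refine ⟨hts, fun x => ?_⟩
    rw [← ih]
    have hacc := accPt_side r.2 ht
    have heq : ∀ᶠ w in 𝓝 (r : ℍ), ∀ hw : w ∈ rectangle, sideFun t w = 0 →
        (h (refl t * s) * (M (refl t * s))⁻¹) • ((γ * s⁻¹) w) =
          (h s * (M s)⁻¹) • ((γ * s⁻¹) w) := by
      have h1 := hev _ hts
      have h2 := hev _ hs
      rw [nhds_subtype, eventually_comap] at h1 h2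
      filter_upwards [h1, h2] with w h1 h2 hw hwt
      have h1 := h1 ⟨w, hw⟩ rfl
      have h2 := h2 ⟨w, hw⟩ rfl
      have e0 : (γ * (refl t * s)⁻¹) w = (γ * s⁻¹) w := by
        rw [mul_inv_rev, refl_inv, ← mul_assoc, Homeomorph.mul_apply, refl_eq_self hwt]
      have e1 : tile (m' (refl t * s)) (n' (refl t * s)) ⟨w, hw⟩ =
          tile (m' s) (n' s) ⟨w, hw⟩ := by
        rw [← proj_apply (mul_mem hγ (inv_mem (hst _ hts))) (hi' _ hts),
          ← proj_apply (mul_mem hγ (inv_mem (hst _ hs))) (hi' _ hs), e0]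
      rw [mul_smul, mul_smul, ← e0, hM _ hts, inv_smul_smul, ← hM _ hts, e0, hM _ hs,
        inv_smul_smul, ← h1, ← h2, e1]
    obtain ⟨w, ⟨hw1, hw2⟩, hw3⟩ := ((accPt_iff_frequently.1 hacc).and_eventually heq).exists
    refine smul_eq_smul_of_two_points (iff_of_true (hpos _ hts) (hpos _ hs))
      (z := (γ * s⁻¹) r) (w := (γ * s⁻¹) w) (fun h => hw1 ((γ * s⁻¹).injective h)) ?_
      (hw3 hw2.1 hw2.2) x
    exact heq.self_of_nhds r.2 ht
  obtain ⟨g, hg⟩ := exists_specialLinear_smul_eq (hpos 1 (one_mem _))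
  refine ⟨g, ?_⟩
  have hev' : ∀ᶠ w in 𝓝 (r : ℍ), ∀ s ∈ (sideStabilizer r : Set (ℍ ≃ₜ ℍ)),
      ∀ hw : s w ∈ rectangle, e (tile (m' s) (n' s) ⟨s w, hw⟩) = h s • (s w) := by
    rw [(finite_sideStabilizer r).eventually_all]
    intro s hs
    have h1 := hev s hs
    rw [nhds_subtype, eventually_comap] at h1
    have h2 : Tendsto s (𝓝 (r : ℍ)) (𝓝 r) := by
      have := s.continuous.continuousAt (x := (r : ℍ))
      rwa [ContinuousAt, apply_eq_self_of_mem_sideStabilizer hs] at this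
    filter_upwards [h2.eventually h1] with w hw hmem
    exact hw ⟨_, hmem⟩ rfl
  have hγs : Tendsto γ.symm (𝓝 (γ r)) (𝓝 r) := by
    have := γ.symm.continuous.continuousAt (x := γ r)
    rwa [ContinuousAt, γ.symm_apply_apply] at this
  filter_upwards [hγs.eventually hev', hγs.eventually (eventually_exists_mem_rectangle r.2)]
    with w hw hw'
  obtain ⟨s, hs, hmem, -⟩ := hw'
  have e1 : (γ * s⁻¹) (s (γ.symm w)) = w := by
    rw [← Homeomorph.mul_apply, inv_mul_cancel_right, γ.apply_symm_apply]
  have e2 := proj_apply (mul_mem hγ (inv_mem (hst s hs))) (hi' s hs) ⟨_, hmem⟩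
  rw [e1] at e2
  rw [e2, hw s hs hmem, hg, ← hagree s hs, mul_smul]
  congr 1
  rw [eq_inv_smul_iff, ← hM s hs, e1]

theorem map_nhds_proj (z : ℍ) : map proj (𝓝 z) = 𝓝 (proj z) :=
  isCoveringMap_proj.isLocalHomeomorph.map_nhds_eq z

theorem isHyperbolicSurface_charts : HypSurface.IsHyperbolicSurface charts where
  t2 := inferInstance
  connected := inferInstance
  cover p := by
    obtain ⟨z, rfl⟩ := surjective_proj p
    exact exists_chart z
  compatible := by
    rintro e he e' he' p ⟨hp, hp'⟩
    obtain ⟨z, rfl⟩ := surjective_proj p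
    obtain ⟨g, hg⟩ := exists_smul_eq_chart he hp
    obtain ⟨g', hg'⟩ := exists_smul_eq_chart he' hp'
    refine ⟨g' * g⁻¹, ?_⟩
    rw [← map_nhds_proj, eventually_map]
    filter_upwards [hg, hg'] with w h h'
    rw [h, h', mul_smul, inv_smul_smul]

theorem isLocalIsometryOn_proj_smul (g : SL(2, ℝ)) (S : Set ℍ) :
    HypSurface.IsLocalIsometryOn charts S fun z => proj (g • z) := by
  intro z _
  obtain ⟨e, he, hz⟩ := exists_chart (g • z)
  obtain ⟨k, hk⟩ := exists_smul_eq_chart he hz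
  refine ⟨e, he, k * g, ?_⟩
  apply Filter.Eventually.filter_mono nhdsWithin_le_nhds
  have hc : ContinuousAt (fun z : ℍ => g • z) z := (continuous_const_smul g).continuousAt
  have hs : ∀ᶠ w in 𝓝 (g • z), proj w ∈ e.source :=
    continuous_proj.continuousAt.eventually (e.open_source.mem_nhds hz)
  filter_upwards [hc.eventually hk, hc.eventually hs] with w h1 h2
  exact ⟨h2, by rw [h1, mul_smul]⟩

/-! ## The covering group is a subgroup of the modular group -/

/-- The matrix of `z ↦ z / √2`. -/
noncomputable def scaleMatrix : GL (Fin 2) ℝ :=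
  Matrix.GeneralLinearGroup.mkOfDetNeZero !![1, 0; 0, √2] (by simp)

theorem det_scaleMatrix : scaleMatrix.det.val = √2 := by
  simp [scaleMatrix, Matrix.GeneralLinearGroup.mkOfDetNeZero]

theorem exists_scaling : ∃ h : SL(2, ℝ), ∀ z : ℍ, h • z = scaleMatrix • z :=
  exists_specialLinear_smul_eq (by rw [det_scaleMatrix]; positivity)

/-- The isometry `z ↦ z / √2`. -/
noncomputable def scaling : SL(2, ℝ) := exists_scaling.choose

theorem scaling_smul (z : ℍ) : scaling • z = scaleMatrix • z := exists_scaling.choose_spec z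

theorem coe_scaling_smul (z : ℍ) : ((scaling • z : ℍ) : ℂ) = z / (√2 : ℝ) := by
  rw [scaling_smul, coe_smul_of_det_pos (by rw [det_scaleMatrix]; positivity)]
  simp [num, denom, scaleMatrix, Matrix.GeneralLinearGroup.mkOfDetNeZero]

/-- The universal covering, normalized in such a way that the covering group consists of integral
matrices. -/
noncomputable def unif (z : ℍ) : Surface := proj (scaling • z)

theorem isCoveringMap_unif : IsCoveringMap unif :=
  isCoveringMap_proj.comp_homeomorph (Homeomorph.smul scaling)

theorem continuous_unif : Continuous unif := isCoveringMap_unif.continuous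

theorem isOpenMap_unif : IsOpenMap unif := isCoveringMap_unif.isOpenMap

theorem surjective_unif : Function.Surjective unif := fun p => by
  obtain ⟨z, rfl⟩ := surjective_proj p
  exact ⟨scaling⁻¹ • z, by rw [unif, smul_inv_smul]⟩

theorem isLocalIsometryOn_unif_smul (g : SL(2, ℝ)) (S : Set ℍ) :
    HypSurface.IsLocalIsometryOn charts S fun z => unif (g • z) := by
  have := isLocalIsometryOn_proj_smul (scaling * g) S
  simp only [mul_smul] at this
  exact this

theorem isUniformization_unif : HypSurface.IsUniformization charts unif where
  covering := isCoveringMap_unif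
  surjective := surjective_unif
  isometry := by
    have := isLocalIsometryOn_unif_smul 1 univ
    simp only [one_smul] at this
    exact this

/-- The covering group, as a group of matrices. -/
noncomputable def fundamentalGroup : Subgroup SL(2, ℤ) where
  carrier := {g | ∀ z : ℍ, unif (g • z) = unif z}
  mul_mem' {a b} ha hb z := by rw [mul_smul, ha, hb]
  one_mem' z := by rw [one_smul]
  inv_mem' {a} ha z := by rw [← ha, smul_inv_smul]

theorem coe_smul_int (g : SL(2, ℤ)) (z : ℍ) :
    ((g • z : ℍ) : ℂ) = ((g 0 0 : ℤ) * z + (g 0 1 : ℤ)) / ((g 1 0 : ℤ) * z + (g 1 1 : ℤ)) := by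
  rw [coe_specialLinearGroup_apply]
  simp

/-- An integral matrix, as a real matrix. -/
noncomputable def toReal (g : SL(2, ℤ)) : SL(2, ℝ) :=
  Matrix.SpecialLinearGroup.map (Int.castRingHom ℝ) g

theorem toReal_smul (g : SL(2, ℤ)) (z : ℍ) : toReal g • z = g • z := rfl

theorem continuous_smul_int (g : SL(2, ℤ)) : Continuous fun z : ℍ => g • z :=
  continuous_const_smul (toReal g)

theorem sqrt_two_complex_ne_zero : ((√2 : ℝ) : ℂ) ≠ 0 := by
  have : √2 ≠ 0 := by positivity
  exact_mod_cast this

/-- The index `(0, 0)` allows only the first shape with determinant one, and conjugation by `z ↦ z /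
√2` turns the entries `b √2` and `c √2` into `2 b` and `c`. -/
theorem exists_integral_matrix {k : ℍ ≃ₜ ℍ} (hk : k ∈ deckGroup) :
    ∃ g : SL(2, ℤ), ∀ z : ℍ, k (scaling • z) = scaling • g • z := by
  obtain ⟨M, hM, hdet, a, b, c, d, ε, hε, h⟩ :=
    exists_matrix (mem_reflGroup_of_mem_deckGroup hk) (isIndex_of_mem_deckGroup hk)
  have hε : ε = 1 := by simpa using hε
  subst hε
  rcases h with ⟨hM', h1, -, -⟩ | ⟨-, -, -, h⟩
  · let g : SL(2, ℤ) := ⟨!![a, 2 * b; c, d], by rw [Matrix.det_fin_two_of]; linarith⟩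
    have h00 : g 0 0 = a := rfl
    have h01 : g 0 1 = 2 * b := rfl
    have h10 : g 1 0 = c := rfl
    have h11 : g 1 1 = d := rfl
    refine ⟨g, fun z => UpperHalfPlane.ext ?_⟩
    rw [hM, coe_smul_of_det_pos (hdet.2 (by simp)), coe_scaling_smul, coe_scaling_smul,
      coe_smul_int, h00, h01, h10, h11, num, denom, hM']
    have hs := sqrt_two_complex_ne_zero
    have hs2 := sqrt_two_complex_sq
    simp only [Matrix.of_apply, Matrix.cons_val', Matrix.cons_val_zero, Matrix.cons_val_one,
      Matrix.cons_val_fin_one]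
    push_cast
    have e1 : (c : ℂ) * (√2 : ℝ) * (z / (√2 : ℝ)) + d = c * z + d := by field_simp
    have e2 : (a : ℂ) * (z / (√2 : ℝ)) + b * (√2 : ℝ) = (a * z + 2 * b) / (√2 : ℝ) := by
      field_simp
      linear_combination (b : ℂ) * hs2
    rw [e1, e2, div_right_comm]
  · exact absurd (by simp) h

theorem unif_eq_iff {z w : ℍ} : unif z = unif w ↔ ∃ g ∈ fundamentalGroup, g • z = w := by
  constructor
  · intro h
    obtain ⟨k, hk, e⟩ := proj_eq_iff.1 h
    obtain ⟨g, hg⟩ := exists_integral_matrix hk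
    refine ⟨g, fun x => ?_, ?_⟩
    · rw [unif, ← hg]
      exact (proj_eq_iff.2 ⟨k, hk, rfl⟩).symm
    · rw [hg] at e
      exact smul_left_cancel _ e
  · rintro ⟨g, hg, rfl⟩
    exact (hg z).symm

/-- A covering homeomorphism agrees at `i` with some modular transformation of the covering group;
both are lifts of `unif`, hence equal. -/
theorem coveringGroup_unif_le : HypSurface.coveringGroup unif ≤ HypSurface.modularGroup := by
  intro h hh
  obtain ⟨g, hg, e⟩ := unif_eq_iff.1 (hh UpperHalfPlane.I).symm
  refine ⟨g, fun z => ?_⟩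
  have := isCoveringMap_unif.eq_of_comp_eq h.continuous (continuous_smul_int g)
    (funext fun z => (hh z).trans (hg z).symm) UpperHalfPlane.I e.symm
  exact congrFun this z

/-- The covering group acts freely. -/
theorem smul_eq_self_of_fixed {g : SL(2, ℤ)} (hg : g ∈ fundamentalGroup) {z : ℍ} (hz : g • z = z)
    (w : ℍ) : g • w = w := by
  have := isCoveringMap_unif.eq_of_comp_eq (continuous_smul_int g) continuous_id
    (funext hg) z hz
  exact congrFun this w

/-! ### Parabolic elements -/

theorem fold_injective (m : ℤ) : Function.Injective (fold m) := fun x y h => by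
  by_cases hm : Even m
  · rw [fold_even hm, fold_even hm] at h; linarith
  · rw [fold_odd hm, fold_odd hm] at h; linarith

/-- The deck group is the kernel of the action of the reflection group on the square coordinate, so
it is normal. -/
theorem conj_mem_deckGroup {γ k : ℍ ≃ₜ ℍ} (hγ : γ ∈ reflGroup) (hk : k ∈ deckGroup) :
    γ⁻¹ * k * γ ∈ deckGroup := by
  refine ⟨mul_mem (mul_mem (inv_mem hγ) hk.1) hγ, fun z => ?_⟩
  obtain ⟨m, n, -, hi, -⟩ := exists_isArith hγ
  have e : γ ((γ⁻¹ * k * γ) z) = k (γ z) := by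
    rw [← Homeomorph.mul_apply, mul_assoc, mul_inv_cancel_left, Homeomorph.mul_apply]
  constructor
  · apply fold_injective m
    rw [← (hi _).1, e, (hk.2 _).1, (hi _).1]
  · apply fold_injective n
    rw [← (hi _).2, e, (hk.2 _).2, (hi _).2]

/-- The product of the reflections in the two vertical sides translates by `2 √2` and changes the
sign of the square coordinate, a half turn about the ideal vertex. Its square passes all four
rectangles around that vertex and is a deck transformation. -/
theorem exists_deck_translation (j : ℤ) :
    ∃ k ∈ deckGroup, ∀ z, (k z : ℂ) = z + (j * (4 * √2) : ℝ) := by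
  have ht : refl .right * refl .left * (refl .right * refl .left) ∈ deckGroup := by
    refine ⟨mul_mem (mul_mem (refl_mem _) (refl_mem _)) (mul_mem (refl_mem _) (refl_mem _)),
      fun z => ?_⟩
    simp only [Homeomorph.mul_apply, coord_refl_left, coord_refl_right, neg_neg, and_self]
  have hz : ∀ z, ((refl .right * refl .left * (refl .right * refl .left)) z : ℂ)
      = z + (4 * √2 : ℝ) := fun z => by
    simp only [Homeomorph.mul_apply, coe_refl_left, coe_refl_right, map_sub, map_neg, map_mul,
      Complex.conj_conj, Complex.conj_ofReal, Complex.conj_ofNat]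
    push_cast; ring
  set t := refl .right * refl .left * (refl .right * refl .left)
  have hz' : ∀ z, (t⁻¹ z : ℂ) = z - (4 * √2 : ℝ) := fun z => by
    have := hz (t⁻¹ z)
    rw [← Homeomorph.mul_apply, mul_inv_cancel, Homeomorph.one_apply] at this
    rw [this]; ring
  induction j using Int.induction_on with
  | zero => exact ⟨1, one_mem _, fun z => by simp⟩
  | succ j ih =>
    obtain ⟨k, hk, h⟩ := ih
    refine ⟨t * k, mul_mem ht hk, fun z => ?_⟩
    rw [Homeomorph.mul_apply, hz, h]; push_cast; ring
  | pred j ih =>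
    obtain ⟨k, hk, h⟩ := ih
    refine ⟨t⁻¹ * k, mul_mem (inv_mem ht) hk, fun z => ?_⟩
    rw [Homeomorph.mul_apply, hz', h]; push_cast; ring

theorem units_of_int_mul {α δ : ℤ} (h : α * δ = 1 ∨ α * δ = -1) :
    (α = δ ∨ α = -δ) ∧ (δ = 1 ∨ δ = -1) := by
  have h0 : IsUnit (α * δ) := by rw [Int.isUnit_iff]; exact h
  rcases Int.isUnit_iff.1 (isUnit_of_mul_isUnit_left h0) with h1 | h1 <;>
    rcases Int.isUnit_iff.1 (isUnit_of_mul_isUnit_right h0) with h2 | h2 <;> simp [h1, h2]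

/-- Near a cusp, an element of the reflection group conjugates the covering group to a group that
is normalized by a translation. -/
theorem exists_translate_eq (g : SL(2, ℤ)) : ∃ γ ∈ reflGroup, ∃ j : ℤ, ∀ z : ℍ,
    (γ (scaling • g • ((8 : ℝ) +ᵥ z)) : ℂ) = γ (scaling • g • z) + (j * (4 * √2) : ℝ) := by
  -- The height `4` is large enough: once `γ` has brought the image of `y` into the rectangle, where
  -- `im ≥ 1 / 2`, the lower left entry of the total matrix `N` is less than one in absolute value.
  -- It is an integer or an integral multiple of `√2`, hence zero, and `N` fixes `∞`.
  let y : ℍ := ⟨⟨0, 4⟩, by norm_num⟩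
  obtain ⟨γ, hγ, hmem⟩ := exists_apply_mem_rectangle (scaling • g • y)
  have him := half_le_im hmem
  obtain ⟨m, n, M, -, hM, hA⟩ := exists_isArith hγ
  have hs := sqrt_two_mul_self
  have hs1 := one_lt_sqrt_two
  set N : GL (Fin 2) ℝ := M * scaleMatrix * Matrix.SpecialLinearGroup.toGL (toReal g) with hN
  have hNz : ∀ z : ℍ, γ (scaling • g • z) = N • z := fun z => by
    rw [hM, scaling_smul, hN, mul_smul, mul_smul]
    rfl
  have hgdet : g 0 0 * g 1 1 - g 0 1 * g 1 0 = 1 := by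
    rw [← Matrix.det_fin_two, g.det_coe]
  have hdet : |N.det.val| = √2 := by
    rw [hN, map_mul, map_mul, Units.val_mul, Units.val_mul, det_scaleMatrix, abs_mul, abs_mul,
      Matrix.GeneralLinearGroup.val_det_apply (Matrix.SpecialLinearGroup.toGL (toReal g))]
    have h1 : |M.det.val| = 1 := by rcases hA.det with ⟨h, -⟩ | ⟨h, -⟩ <;> rw [h] <;> norm_num
    have h2 : (Matrix.SpecialLinearGroup.toGL (toReal g)).val.det = 1 := (toReal g).det_coe
    rw [h1, h2, abs_of_pos (by positivity)]; simp
  have hdet' : N.det.val = N 0 0 * N 1 1 - N 0 1 * N 1 0 := by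
    rw [Matrix.GeneralLinearGroup.val_det_apply, Matrix.det_fin_two]
  have g00 : (Matrix.SpecialLinearGroup.toGL (toReal g)).val 0 0 = g 0 0 := rfl
  have g01 : (Matrix.SpecialLinearGroup.toGL (toReal g)).val 0 1 = g 0 1 := rfl
  have g10 : (Matrix.SpecialLinearGroup.toGL (toReal g)).val 1 0 = g 1 0 := rfl
  have g11 : (Matrix.SpecialLinearGroup.toGL (toReal g)).val 1 1 = g 1 1 := rfl
  have hval : ∀ i j : Fin 2, N i j = M i 0 * (Matrix.SpecialLinearGroup.toGL (toReal g)).val 0 j +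
      M i 1 * √2 * (Matrix.SpecialLinearGroup.toGL (toReal g)).val 1 j := by
    intro i j
    rw [hN, Units.val_mul, Units.val_mul, Matrix.mul_apply, Fin.sum_univ_two, Matrix.mul_apply,
      Fin.sum_univ_two, Matrix.mul_apply, Fin.sum_univ_two]
    simp [scaleMatrix, Matrix.GeneralLinearGroup.mkOfDetNeZero]
  have hzero : (N 1 0) ^ 2 < 1 := by
    rw [hNz, im_smul_eq_div_normSq, hdet, denom, Complex.normSq_apply] at him
    have hy1 : y.im = 4 := rfl
    have hy2 : (y : ℂ) = ⟨0, 4⟩ := rfl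
    rw [hy1, hy2] at him
    simp at him
    by_contra hge
    rw [not_lt] at hge
    have hp : 0 < N 1 1 * N 1 1 + N 1 0 * 4 * (N 1 0 * 4) := by nlinarith [mul_self_nonneg (N 1 1)]
    rw [le_div_iff₀ hp] at him
    nlinarith [mul_self_nonneg (N 1 1)]
  have hmain : ∀ q : ℝ, N 1 0 = 0 → N 0 0 / N 1 1 * 8 = q → ∀ z : ℍ,
      (γ (scaling • g • ((8 : ℝ) +ᵥ z)) : ℂ) = γ (scaling • g • z) + (q : ℝ) := by
    intro q h0 hq z
    rw [hNz, hNz, UpperHalfPlane.coe_smul, UpperHalfPlane.coe_smul, ← σ_ofReal N q, ← map_add]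
    congr 1
    have h1 : (N 1 1 : ℂ) ≠ 0 := by
      intro h
      have h : N 1 1 = 0 := by exact_mod_cast h
      rw [hdet', h, h0] at hdet
      simp at hdet
      linarith
    rw [← hq, num, denom, num, denom, h0, coe_vadd]
    simp only [Complex.ofReal_zero, zero_mul, zero_add, Complex.ofReal_mul, Complex.ofReal_div]
    generalize (N 1 1 : ℂ) = n at *
    field_simp
    push_cast
    ring
  obtain ⟨a, b, c, d, ε, hε, h⟩ := hA
  rcases h with ⟨hMv, hd, -, -⟩ | ⟨hMv, hd, -, -⟩
  · have n10 : N 1 0 = (c * g 0 0 + d * g 1 0 : ℤ) * √2 := by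
      rw [hval, hMv, g00, g10]; simp; ring
    have n00 : N 0 0 = (a * g 0 0 + 2 * b * g 1 0 : ℤ) := by
      rw [hval, hMv, g00, g10]; simp only [Matrix.of_apply, Matrix.cons_val',
        Matrix.cons_val_zero, Matrix.cons_val_one, Matrix.cons_val_fin_one]
      push_cast; linear_combination (b * g 1 0 : ℝ) * hs
    have n11 : N 1 1 = (c * g 0 1 + d * g 1 1 : ℤ) * √2 := by
      rw [hval, hMv, g01, g11]; simp; ring
    have hl : c * g 0 0 + d * g 1 0 = 0 := by
      by_contra hne
      have := one_le_int_sq hne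
      rw [n10] at hzero
      nlinarith
    have h0 : N 1 0 = 0 := by rw [n10, hl]; simp
    have hu : (a * g 0 0 + 2 * b * g 1 0) * (c * g 0 1 + d * g 1 1) = ε := by
      linear_combination hd + (a * d - 2 * b * c) * hgdet + (a * g 0 1 + 2 * b * g 1 1) * hl
    obtain ⟨h1, h2⟩ := units_of_int_mul (by rw [hu]; omega)
    -- The scale factor is `±1 / √2` here and `±√2` for the second shape. Eight times it is `±4 √2`
    -- or `±8 √2`, in both cases a multiple of the deck translation `4 √2`; so `8` serves all cusps
    -- at once.
    have hgoal : N 0 0 / N 1 1 * 8 = (1 : ℤ) * (4 * √2) ∨ N 0 0 / N 1 1 * 8 = (-1 : ℤ) * (4 * √2) := by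
      rw [n00, n11]
      generalize a * g 0 0 + 2 * b * g 1 0 = α at *
      generalize c * g 0 1 + d * g 1 1 = δ at *
      have hδ : (δ : ℝ) ≠ 0 := by rcases h2 with rfl | rfl <;> norm_num
      rcases h1 with rfl | rfl
      · left; field_simp; push_cast; nlinarith
      · right; push_cast; field_simp; nlinarith
    rcases hgoal with h | h
    · exact ⟨γ, hγ, 1, hmain _ h0 h⟩
    · exact ⟨γ, hγ, -1, hmain _ h0 h⟩
  · have n10 : N 1 0 = (c * g 0 0 + 2 * d * g 1 0 : ℤ) := by
      rw [hval, hMv, g00, g10]; simp only [Matrix.of_apply, Matrix.cons_val',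
        Matrix.cons_val_zero, Matrix.cons_val_one, Matrix.cons_val_fin_one]
      push_cast; linear_combination (d * g 1 0 : ℝ) * hs
    have n00 : N 0 0 = (a * g 0 0 + b * g 1 0 : ℤ) * √2 := by
      rw [hval, hMv, g00, g10]; simp; ring
    have n11 : N 1 1 = (c * g 0 1 + 2 * d * g 1 1 : ℤ) := by
      rw [hval, hMv, g01, g11]; simp only [Matrix.of_apply, Matrix.cons_val',
        Matrix.cons_val_zero, Matrix.cons_val_one, Matrix.cons_val_fin_one]
      push_cast; linear_combination (d * g 1 1 : ℝ) * hs
    have hl : c * g 0 0 + 2 * d * g 1 0 = 0 := by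
      by_contra hne
      have := one_le_int_sq hne
      rw [n10] at hzero
      linarith
    have h0 : N 1 0 = 0 := by rw [n10, hl]; simp
    have hu : (a * g 0 0 + b * g 1 0) * (c * g 0 1 + 2 * d * g 1 1) = ε := by
      linear_combination hd + (2 * a * d - b * c) * hgdet + (a * g 0 1 + b * g 1 1) * hl
    obtain ⟨h1, h2⟩ := units_of_int_mul (by rw [hu]; omega)
    have hgoal : N 0 0 / N 1 1 * 8 = (2 : ℤ) * (4 * √2) ∨ N 0 0 / N 1 1 * 8 = (-2 : ℤ) * (4 * √2) := by
      rw [n00, n11]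
      generalize a * g 0 0 + b * g 1 0 = α at *
      generalize c * g 0 1 + 2 * d * g 1 1 = δ at *
      have hδ : (δ : ℝ) ≠ 0 := by rcases h2 with rfl | rfl <;> norm_num
      rcases h1 with rfl | rfl
      · left; field_simp; push_cast; ring
      · right; push_cast; field_simp; ring
    rcases hgoal with h | h
    · exact ⟨γ, hγ, 2, hmain _ h0 h⟩
    · exact ⟨γ, hγ, -2, hmain _ h0 h⟩

/-- The translation by `8` belongs to every conjugate of the covering group by a modular
transformation. -/
theorem unif_smul_eight_vadd (g : SL(2, ℤ)) (z : ℍ) : unif (g • ((8 : ℝ) +ᵥ z)) = unif (g • z) := by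
  obtain ⟨γ, hγ, j, h⟩ := exists_translate_eq g
  obtain ⟨k, hk, hkj⟩ := exists_deck_translation j
  refine (proj_eq_iff.2 ⟨γ⁻¹ * k * γ, conj_mem_deckGroup hγ hk, ?_⟩).symm
  have e : k (γ (scaling • g • z)) = γ (scaling • g • ((8 : ℝ) +ᵥ z)) :=
    UpperHalfPlane.ext (by rw [hkj, h])
  rw [Homeomorph.mul_apply, Homeomorph.mul_apply, e, ← Homeomorph.mul_apply, inv_mul_cancel,
    Homeomorph.one_apply]

/-! ## The Farey tessellation -/

theorem det_int (g : SL(2, ℤ)) : g 0 0 * g 1 1 - g 0 1 * g 1 0 = 1 := by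
  rw [← Matrix.det_fin_two, g.det_coe]

/-- The functions `|z|² - re`, `re` and `1 - re` vanish on the three sides of the triangle `0, 1,
∞`. Their coefficients are the products of numerator and denominator of the images of the opposite
vertices `∞`, `1` and `0`, so their signs tell on which side of the imaginary axis these images lie.
-/
theorem re_smul_int (g : SL(2, ℤ)) (z : ℍ) : ∃ D > 0, (g • z).re * D =
    (g 0 0 * g 1 0 : ℤ) * (z.re ^ 2 + z.im ^ 2 - z.re) +
      ((g 0 0 + g 0 1) * (g 1 0 + g 1 1) : ℤ) * z.re + (g 0 1 * g 1 1 : ℤ) * (1 - z.re) := by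
  have h0 : ((g 1 0 : ℤ) * (z : ℂ) + (g 1 1 : ℤ)) ≠ 0 := by
    have := denom_ne_zero (Matrix.SpecialLinearGroup.toGL (toReal g)) z
    exact this
  refine ⟨_, Complex.normSq_pos.2 h0, ?_⟩
  have h1 := congrArg Complex.re (coe_smul_int g z)
  rw [coe_re, Complex.div_re, ← add_div] at h1
  rw [h1, div_mul_cancel₀ _ (Complex.normSq_pos.2 h0).ne']
  simp
  ring

theorem im_smul_int (g : SL(2, ℤ)) (z : ℍ) : (g • z).im =
    z.im / ((g 1 0 * z.re + g 1 1) ^ 2 + (g 1 0 * z.im) ^ 2) := by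
  rw [ModularGroup.im_smul_eq_div_normSq, ModularGroup.denom_apply, Complex.normSq_apply]
  simp [sq]

theorem mem_openIdealTriangle_iff {z : ℍ} : z ∈ openIdealTriangle 0 1 ↔
    0 < z.re ∧ z.re < 1 ∧ 0 < z.re ^ 2 + z.im ^ 2 - z.re := by
  change (0 < z.re ∧ z.re < 1 ∧ (1 - 0) / 2 < ‖(z : ℂ) - (((0 + 1) / 2 : ℝ) : ℂ)‖) ↔ _
  have h := norm_coe_sub_sq z ((0 + 1) / 2)
  have h0 := norm_nonneg ((z : ℂ) - (((0 + 1) / 2 : ℝ) : ℂ))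
  refine and_congr_right fun _ => and_congr_right fun _ => ?_
  constructor <;> intro h' <;> nlinarith

theorem mem_idealTriangle_iff {z : ℍ} : z ∈ idealTriangle 0 1 ↔
    0 ≤ z.re ∧ z.re ≤ 1 ∧ 0 ≤ z.re ^ 2 + z.im ^ 2 - z.re := by
  change (0 ≤ z.re ∧ z.re ≤ 1 ∧ (1 - 0) / 2 ≤ ‖(z : ℂ) - (((0 + 1) / 2 : ℝ) : ℂ)‖) ↔ _
  have h := norm_coe_sub_sq z ((0 + 1) / 2)
  have h0 := norm_nonneg ((z : ℂ) - (((0 + 1) / 2 : ℝ) : ℂ))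
  refine and_congr_right fun _ => and_congr_right fun _ => ?_
  constructor <;> intro h' <;> nlinarith

theorem mem_arcGeodesic_iff {z : ℍ} : z ∈ arcGeodesic 0 1 ↔ z.re ^ 2 + z.im ^ 2 - z.re = 0 := by
  change ‖(z : ℂ) - (((0 + 1) / 2 : ℝ) : ℂ)‖ = (1 - 0) / 2 ↔ _
  have h := norm_coe_sub_sq z ((0 + 1) / 2)
  have h0 := norm_nonneg ((z : ℂ) - (((0 + 1) / 2 : ℝ) : ℂ))
  constructor <;> intro h' <;> nlinarith

theorem mul_nonneg_of_int_sub_eq_one {a b : ℤ} (h : a - b = 1) : 0 ≤ a * b := by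
  rcases le_or_gt 0 b with hb | hb
  · exact mul_nonneg (by omega) hb
  · exact mul_nonneg_of_nonpos_of_nonpos (by omega) hb.le

/-- The coefficients of the real part of a modular transformation, with respect to the sides of the
ideal triangle `0, 1, ∞`, have the same sign. -/
theorem same_sign (g : SL(2, ℤ)) :
    (0 ≤ g 0 0 * g 1 0 ∧ 0 ≤ (g 0 0 + g 0 1) * (g 1 0 + g 1 1) ∧ 0 ≤ g 0 1 * g 1 1 ∨
      g 0 0 * g 1 0 ≤ 0 ∧ (g 0 0 + g 0 1) * (g 1 0 + g 1 1) ≤ 0 ∧ g 0 1 * g 1 1 ≤ 0) ∧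
    ¬ (g 0 0 * g 1 0 = 0 ∧ (g 0 0 + g 0 1) * (g 1 0 + g 1 1) = 0 ∧ g 0 1 * g 1 1 = 0) := by
  have hd := det_int g
  generalize g 0 0 = p at *
  generalize g 0 1 = q at *
  generalize g 1 0 = r at *
  generalize g 1 1 = s at *
  -- By the determinant, `p s` and `q r` are consecutive integers, so their product is nonnegative;
  -- the other two pairs of vertices also have determinant one.
  have h1 : 0 ≤ (p * r) * (q * s) := by
    have := mul_nonneg_of_int_sub_eq_one hd; linarith
  have h2 : 0 ≤ (p * r) * ((p + q) * (r + s)) := by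
    have := mul_nonneg_of_int_sub_eq_one (a := p * (r + s)) (b := r * (p + q)) (by linarith)
    linarith
  have h3 : 0 ≤ ((p + q) * (r + s)) * (q * s) := by
    have := mul_nonneg_of_int_sub_eq_one (a := (p + q) * s) (b := q * (r + s)) (by linarith)
    linarith
  have hne : ¬ (p * r = 0 ∧ (p + q) * (r + s) = 0 ∧ q * s = 0) := by
    rintro ⟨a1, a2, a3⟩
    have : p * s + q * r = 0 := by linarith
    omega
  refine ⟨?_, hne⟩
  generalize p * r = a at *
  generalize (p + q) * (r + s) = b at *
  generalize q * s = c at *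
  by_contra hcon
  have key : ∀ x y : ℤ, 0 ≤ x * y → ¬ (0 < x ∧ y < 0) := fun x y h ⟨h1, h2⟩ => by nlinarith
  have k1 := key _ _ h1
  have k2 := key _ _ h2
  have k3 := key _ _ h3
  have k4 := key c a (by linarith)
  have k5 := key b a (by linarith)
  have k6 := key c b (by linarith)
  omega

/-- No edge of the Farey tessellation meets the open triangle: the coefficients of the real part
have a common sign and the three side functions are positive inside. -/
theorem re_smul_sign (g : SL(2, ℤ)) : (∀ z ∈ openIdealTriangle 0 1, 0 < (g • z).re) ∨
    ∀ z ∈ openIdealTriangle 0 1, (g • z).re < 0 := by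
  obtain ⟨h, hne⟩ := same_sign g
  generalize ha : g 0 0 * g 1 0 = a at *
  generalize hb : (g 0 0 + g 0 1) * (g 1 0 + g 1 1) = b at *
  generalize hc : g 0 1 * g 1 1 = c at *
  have pos : ∀ (a b c : ℤ) (x y z : ℝ), 0 < x → 0 < y → 0 < z → 0 ≤ a → 0 ≤ b → 0 ≤ c →
      ¬ (a = 0 ∧ b = 0 ∧ c = 0) → 0 < a * x + b * y + c * z := by
    intro a b c x y z hx hy hz ha hb hc hne
    have ha' : (0 : ℝ) ≤ a := by exact_mod_cast ha
    have hb' : (0 : ℝ) ≤ b := by exact_mod_cast hb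
    have hc' : (0 : ℝ) ≤ c := by exact_mod_cast hc
    rcases (by omega : 0 < a ∨ 0 < b ∨ 0 < c) with h | h | h
    · have : (0 : ℝ) < a := by exact_mod_cast h
      positivity
    · have : (0 : ℝ) < b := by exact_mod_cast h
      positivity
    · have : (0 : ℝ) < c := by exact_mod_cast h
      positivity
  rcases h with ⟨h1, h2, h3⟩ | ⟨h1, h2, h3⟩
  · left
    intro z hz
    obtain ⟨z1, z2, z3⟩ := mem_openIdealTriangle_iff.1 hz
    obtain ⟨D, hD, e⟩ := re_smul_int g z
    rw [ha, hb, hc] at e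
    have := pos a b c _ _ _ z3 z1 (by linarith : 0 < 1 - z.re) h1 h2 h3 hne
    exact pos_of_mul_pos_left (by rw [e]; exact this) hD.le
  · right
    intro z hz
    obtain ⟨z1, z2, z3⟩ := mem_openIdealTriangle_iff.1 hz
    obtain ⟨D, hD, e⟩ := re_smul_int g z
    rw [ha, hb, hc] at e
    have := pos (-a) (-b) (-c) _ _ _ z3 z1 (by linarith : 0 < 1 - z.re) (by omega) (by omega)
      (by omega) (by omega)
    push_cast at this
    by_contra hle
    nlinarith [mul_nonneg (not_lt.1 hle) hD.le]

theorem re_smul_ne_zero (g : SL(2, ℤ)) {z : ℍ} (hz : z ∈ openIdealTriangle 0 1) :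
    (g • z).re ≠ 0 := by
  rcases re_smul_sign g with h | h
  · exact (h z hz).ne'
  · exact (h z hz).ne

theorem coe_T_zpow_smul (n : ℤ) (z : ℍ) : ((ModularGroup.T ^ n • z : ℍ) : ℂ) = n + z := by
  rw [modular_T_zpow_smul, coe_vadd]; simp

theorem re_T_zpow_smul (n : ℤ) (z : ℍ) : (ModularGroup.T ^ n • z : ℍ).re = n + z.re := by
  rw [modular_T_zpow_smul, vadd_re]

theorem im_T_zpow_smul (n : ℤ) (z : ℍ) : (ModularGroup.T ^ n • z : ℍ).im = z.im := by
  rw [modular_T_zpow_smul, vadd_im]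

/-- A modular transformation that maps the geodesic from `0` to `∞` onto the one from `0`
to `1`. -/
def arcMatrix : SL(2, ℤ) := ⟨!![1, 0; 1, 1], by simp⟩

theorem mul_apply_int (g h : SL(2, ℤ)) (i j : Fin 2) :
    (g * h) i j = g i 0 * h 0 j + g i 1 * h 1 j := by
  rw [Matrix.SpecialLinearGroup.coe_mul, Matrix.mul_apply, Fin.sum_univ_two]

theorem val_arcMatrix_inv : (arcMatrix⁻¹).val = !![1, 0; -1, 1] := by
  rw [Matrix.SpecialLinearGroup.coe_inv, Matrix.adjugate_fin_two]
  simp [arcMatrix]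

theorem re_arcMatrix_inv_smul (z : ℍ) : ∃ D > 0,
    (arcMatrix⁻¹ • z).re * D = -(z.re ^ 2 + z.im ^ 2 - z.re) := by
  obtain ⟨D, hD, h⟩ := re_smul_int arcMatrix⁻¹ z
  refine ⟨D, hD, h.trans ?_⟩
  rw [val_arcMatrix_inv]
  simp

theorem mem_openIdealTriangle_iff_re {z : ℍ} : z ∈ openIdealTriangle 0 1 ↔ 0 < z.re ∧
    (ModularGroup.T ^ (-1 : ℤ) • z).re < 0 ∧ (arcMatrix⁻¹ • z).re < 0 := by
  rw [mem_openIdealTriangle_iff, re_T_zpow_smul]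
  obtain ⟨D, hD, h⟩ := re_arcMatrix_inv_smul z
  refine and_congr_right fun _ => and_congr ?_ ?_
  · push_cast; constructor <;> intro h <;> linarith
  · constructor
    · intro h'
      by_contra hcon
      nlinarith [mul_nonneg (not_lt.1 hcon) hD.le]
    · intro h'
      nlinarith [mul_neg_of_neg_of_pos h' hD]

/-- The modular transformations permute the open triangles of the Farey tessellation. -/
theorem smul_mem_openIdealTriangle {g : SL(2, ℤ)} {z : ℍ} (hz : z ∈ openIdealTriangle 0 1)
    (hgz : g • z ∈ openIdealTriangle 0 1) {w : ℍ} (hw : w ∈ openIdealTriangle 0 1) :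
    g • w ∈ openIdealTriangle 0 1 := by
  rw [mem_openIdealTriangle_iff_re] at hgz ⊢
  simp only [← mul_smul] at hgz ⊢
  have key : ∀ h : SL(2, ℤ), (0 < (h • z).re → 0 < (h • w).re) ∧
      ((h • z).re < 0 → (h • w).re < 0) := by
    intro h
    rcases re_smul_sign h with h | h
    · exact ⟨fun _ => h w hw, fun h' => absurd h' (h z hz).not_gt⟩
    · exact ⟨fun h' => absurd h' (h z hz).not_gt, fun _ => h w hw⟩
  exact ⟨(key _).1 hgz.1, (key _).2 hgz.2.1, (key _).2 hgz.2.2⟩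

/-- The centre of the ideal triangle with vertices `0, 1, ∞`. -/
noncomputable def triangleCentre : ℍ := ⟨⟨1 / 2, √3 / 2⟩, by positivity⟩

theorem triangleCentre_mem : triangleCentre ∈ openIdealTriangle 0 1 := by
  rw [mem_openIdealTriangle_iff]
  have h : √3 * √3 = 3 := Real.mul_self_sqrt (by norm_num)
  have h1 : triangleCentre.re = 1 / 2 := rfl
  have h2 : triangleCentre.im = √3 / 2 := rfl
  rw [h1, h2]
  refine ⟨by norm_num, by norm_num, by nlinarith⟩

theorem smul_eq_self_iff_int (g : SL(2, ℤ)) (z : ℍ) : g • z = z ↔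
    ((g 1 0 : ℤ) : ℂ) * (z * z) + ((g 1 1 : ℤ) - (g 0 0 : ℤ)) * z + -(g 0 1 : ℤ) = 0 := by
  have h0 : ((g 1 0 : ℤ) * (z : ℂ) + (g 1 1 : ℤ)) ≠ 0 :=
    denom_ne_zero (Matrix.SpecialLinearGroup.toGL (toReal g)) z
  rw [UpperHalfPlane.ext_iff, coe_smul_int, div_eq_iff h0]
  constructor <;> intro h <;> linear_combination -h

/-- The first two inequalities place the ratio `p / r` between `0` and `1`, and the third excludes
the open interval; so the ratio is `0`, `1` or `∞`. -/
theorem cases_of_same_sign {p r : ℤ} (h1 : 0 ≤ p * r) (h2 : (p - r) * r ≤ 0)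
    (h3 : 0 ≤ p * (p - r)) : p = 0 ∨ r = 0 ∨ p = r := by
  by_contra! h
  obtain ⟨hp, hr, hpr⟩ := h
  rcases lt_or_gt_of_ne hr with h | h <;> rcases lt_or_gt_of_ne hpr with h' | h' <;>
    rcases lt_or_gt_of_ne hp with h'' | h'' <;> nlinarith

/-- A modular transformation that preserves the ideal triangle with vertices `0, 1, ∞` fixes its
centre. -/
theorem smul_triangleCentre {g : SL(2, ℤ)} {z : ℍ} (hz : z ∈ openIdealTriangle 0 1)
    (hgz : g • z ∈ openIdealTriangle 0 1) : g • triangleCentre = triangleCentre := by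
  have hcoef : ∀ h : SL(2, ℤ), (0 < (h • z).re → 0 ≤ h 0 0 * h 1 0 ∧
      0 ≤ (h 0 0 + h 0 1) * (h 1 0 + h 1 1) ∧ 0 ≤ h 0 1 * h 1 1) ∧
      ((h • z).re < 0 → h 0 0 * h 1 0 ≤ 0 ∧
      (h 0 0 + h 0 1) * (h 1 0 + h 1 1) ≤ 0 ∧ h 0 1 * h 1 1 ≤ 0) := by
    intro h
    obtain ⟨z1, z2, z3⟩ := mem_openIdealTriangle_iff.1 hz
    obtain ⟨D, hD, e⟩ := re_smul_int h z
    obtain ⟨hs, -⟩ := same_sign h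
    rcases hs with hs | hs
    · refine ⟨fun _ => hs, fun hlt => ?_⟩
      exfalso
      obtain ⟨s1, s2, s3⟩ := hs
      have s1' : (0 : ℝ) ≤ (h 0 0 * h 1 0 : ℤ) := by exact_mod_cast s1
      have s2' : (0 : ℝ) ≤ ((h 0 0 + h 0 1) * (h 1 0 + h 1 1) : ℤ) := by exact_mod_cast s2
      have s3' : (0 : ℝ) ≤ (h 0 1 * h 1 1 : ℤ) := by exact_mod_cast s3
      have := mul_neg_of_neg_of_pos hlt hD
      have := mul_nonneg s1' z3.le
      have := mul_nonneg s2' z1.le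
      have := mul_nonneg s3' (by linarith : 0 ≤ 1 - z.re)
      linarith
    · refine ⟨fun hlt => ?_, fun _ => hs⟩
      exfalso
      obtain ⟨s1, s2, s3⟩ := hs
      have s1' : ((h 0 0 * h 1 0 : ℤ) : ℝ) ≤ 0 := by exact_mod_cast s1
      have s2' : (((h 0 0 + h 0 1) * (h 1 0 + h 1 1) : ℤ) : ℝ) ≤ 0 := by exact_mod_cast s2
      have s3' : ((h 0 1 * h 1 1 : ℤ) : ℝ) ≤ 0 := by exact_mod_cast s3
      have := mul_pos hlt hD
      have := mul_nonneg_of_nonpos_of_nonpos s1' (by linarith : -(z.re ^ 2 + z.im ^ 2 - z.re) ≤ 0)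
      have := mul_nonneg_of_nonpos_of_nonpos s2' (by linarith : -z.re ≤ 0)
      have := mul_nonneg_of_nonpos_of_nonpos s3' (by linarith : -(1 - z.re) ≤ 0)
      linarith
  have hdet := det_int g
  rw [mem_openIdealTriangle_iff_re] at hgz
  simp only [← mul_smul] at hgz
  obtain ⟨a1, a2, a3⟩ := (hcoef _).1 hgz.1
  obtain ⟨b1, b2, b3⟩ := (hcoef _).2 hgz.2.1
  obtain ⟨c1, c2, c3⟩ := (hcoef _).2 hgz.2.2
  simp only [mul_apply_int, ModularGroup.coe_T_zpow, val_arcMatrix_inv] at b1 b2 b3 c1 c2 c3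
  simp only [Matrix.of_apply, Matrix.cons_val', Matrix.cons_val_zero, Matrix.cons_val_one,
    Matrix.cons_val_fin_one] at b1 b2 b3 c1 c2 c3
  rw [smul_eq_self_iff_int]
  generalize g 0 0 = p at *
  generalize g 0 1 = q at *
  generalize g 1 0 = r at *
  generalize g 1 1 = s at *
  -- The vertices `∞`, `1` and `0` are mapped to vertices of the same triangle; with the determinant
  -- this leaves only its rotations.
  have k1 := cases_of_same_sign a1 (by linarith) (by linarith)
  have k2 := cases_of_same_sign a2 (by linarith) (by linarith)
  have k3 := cases_of_same_sign a3 (by linarith) (by linarith)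
  -- With these relations the fixed point equation becomes `r (z ^ 2 - z + 1) = 0`, which the centre
  -- satisfies.
  have hfin : r + q = 0 ∧ r + s = p := by
    rcases k1 with rfl | rfl | rfl
    · obtain ⟨h1, h2⟩ := units_of_int_mul (α := q) (δ := r) (by omega)
      rcases h2 with rfl | rfl <;> rcases h1 with h1 | h1 <;> (try subst h1) <;> omega
    · obtain ⟨h1, h2⟩ := units_of_int_mul (α := p) (δ := s) (by omega)
      rcases h2 with rfl | rfl <;> rcases h1 with h1 | h1 <;> (try subst h1) <;> omega
    · obtain ⟨h1, h2⟩ := units_of_int_mul (α := s - q) (δ := p) (by left; linarith)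
      rcases h2 with rfl | rfl <;> rcases h1 with h1 | h1 <;> omega
  obtain ⟨f1, f2⟩ := hfin
  have hc : (triangleCentre : ℂ) * triangleCentre = triangleCentre - 1 := by
    have h : √3 * √3 = 3 := Real.mul_self_sqrt (by norm_num)
    apply Complex.ext <;> simp [triangleCentre]
    · nlinarith
    · ring
  have f1' : (r : ℂ) + q = 0 := by exact_mod_cast f1
  have f2' : (r : ℂ) + s = p := by exact_mod_cast f2
  rw [hc]
  linear_combination (triangleCentre : ℂ) * f2' - f1'

/-- The right half of the standard fundamental domain lies in the ideal triangle, and the left half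
does so after the translation by one. -/
theorem exists_smul_mem_idealTriangle (z : ℍ) : ∃ g : SL(2, ℤ), g • z ∈ idealTriangle 0 1 := by
  obtain ⟨g, h1, h2⟩ := ModularGroup.exists_smul_mem_fd z
  have h1' : 1 ≤ (g • z).re ^ 2 + (g • z).im ^ 2 := by
    rw [Complex.normSq_apply] at h1
    simp only [coe_re, coe_im] at h1
    nlinarith
  obtain ⟨h3, h4⟩ := abs_le.1 h2
  rcases le_total 0 (g • z).re with h | h
  · exact ⟨g, mem_idealTriangle_iff.2 ⟨h, by linarith, by linarith⟩⟩
  · refine ⟨ModularGroup.T ^ (1 : ℤ) * g, mem_idealTriangle_iff.2 ?_⟩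
    rw [mul_smul, re_T_zpow_smul, im_T_zpow_smul]
    push_cast
    exact ⟨by linarith, by linarith, by nlinarith⟩

theorem mem_open_or_exists_re_smul_eq_zero {z : ℍ} (hz : z ∈ idealTriangle 0 1) :
    z ∈ openIdealTriangle 0 1 ∨ ∃ g : SL(2, ℤ), (g • z).re = 0 := by
  obtain ⟨h1, h2, h3⟩ := mem_idealTriangle_iff.1 hz
  rcases h1.eq_or_lt with h1 | h1
  · exact Or.inr ⟨1, by rw [one_smul, ← h1]⟩
  rcases h2.eq_or_lt with h2 | h2
  · exact Or.inr ⟨ModularGroup.T ^ (-1 : ℤ), by rw [re_T_zpow_smul, h2]; norm_num⟩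
  rcases h3.eq_or_lt with h3 | h3
  · obtain ⟨D, hD, h⟩ := re_arcMatrix_inv_smul z
    rw [← h3, neg_zero] at h
    exact Or.inr ⟨_, (mul_eq_zero.1 h).resolve_right hD.ne'⟩
  · exact Or.inl (mem_openIdealTriangle_iff.2 ⟨h1, h2, h3⟩)

/-- A modular transformation that maps a point of the geodesic from `0` to `∞` into this geodesic
preserves it, and fixes `i`. -/
theorem re_smul_eq_zero {g : SL(2, ℤ)} {z : ℍ} (hz : z.re = 0) (hgz : (g • z).re = 0) :
    (∀ w : ℍ, w.re = 0 → (g • w).re = 0) ∧ g • UpperHalfPlane.I = UpperHalfPlane.I := by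
  obtain ⟨D, hD, e⟩ := re_smul_int g z
  rw [hgz, hz] at e
  have hpr : 0 ≤ (g 0 0 * g 1 0) * (g 0 1 * g 1 1) := by
    have := mul_nonneg_of_int_sub_eq_one (det_int g); linarith
  have hy := pow_pos z.im_pos 2
  have h0 : g 0 0 * g 1 0 = 0 ∧ g 0 1 * g 1 1 = 0 := by
    have e' : ((g 0 0 * g 1 0 : ℤ) : ℝ) * z.im ^ 2 + (g 0 1 * g 1 1 : ℤ) = 0 := by linarith
    have hpr' : (0 : ℝ) ≤ ((g 0 0 * g 1 0 : ℤ) : ℝ) * (g 0 1 * g 1 1 : ℤ) := by exact_mod_cast hpr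
    generalize g 0 0 * g 1 0 = a at *
    generalize g 0 1 * g 1 1 = b at *
    have ha : (a : ℝ) = 0 := by
      have : (a : ℝ) * a * z.im ^ 2 = -(a * b) := by linear_combination (a : ℝ) * e'
      by_contra hne
      have := mul_pos (mul_self_pos.2 hne) hy
      linarith
    have hb : (b : ℝ) = 0 := by rw [ha] at e'; linarith
    exact ⟨by exact_mod_cast ha, by exact_mod_cast hb⟩
  constructor
  · intro w hw
    obtain ⟨D, hD, e⟩ := re_smul_int g w
    rw [h0.1, h0.2, hw] at e
    have : (g • w).re * D = 0 := by rw [e]; simp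
    exact (mul_eq_zero.1 this).resolve_right hD.ne'
  · rw [smul_eq_self_iff_int]
    have hd := det_int g
    generalize g 0 0 = p at *
    generalize g 0 1 = q at *
    generalize g 1 0 = r at *
    generalize g 1 1 = s at *
    have hfin : r + q = 0 ∧ s - p = 0 := by
      rcases mul_eq_zero.1 h0.1 with rfl | rfl
      · obtain ⟨h1, h2⟩ := units_of_int_mul (α := q) (δ := r) (by omega)
        have : s = 0 := (mul_eq_zero.1 h0.2).resolve_left (by omega)
        rcases h2 with rfl | rfl <;> rcases h1 with h1 | h1 <;> subst h1 <;> omega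
      · obtain ⟨h1, h2⟩ := units_of_int_mul (α := p) (δ := s) (by omega)
        have : q = 0 := (mul_eq_zero.1 h0.2).resolve_right (by omega)
        rcases h2 with rfl | rfl <;> rcases h1 with h1 | h1 <;> subst h1 <;> omega
    have f1 : (r : ℂ) + q = 0 := by exact_mod_cast hfin.1
    have f2 : (s : ℂ) - p = 0 := by exact_mod_cast hfin.2
    rw [UpperHalfPlane.coe_I, Complex.I_mul_I]
    linear_combination Complex.I * f2 - f1

/-- A neighbourhood of the geodesic from `0` to `∞` that meets no other edge of the Farey
tessellation. -/
def edgeNeighbourhood : Set ℍ :=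
  {z | -1 < z.re ∧ z.re < 1 ∧ 0 < z.re ^ 2 + z.im ^ 2 - z.re ∧ 0 < z.re ^ 2 + z.im ^ 2 + z.re}

theorem isOpen_edgeNeighbourhood : IsOpen edgeNeighbourhood := by
  have h1 := UpperHalfPlane.continuous_re
  have h2 := UpperHalfPlane.continuous_im
  refine IsOpen.and (isOpen_lt ?_ ?_) (IsOpen.and (isOpen_lt ?_ ?_) (IsOpen.and (isOpen_lt ?_ ?_)
    (isOpen_lt ?_ ?_))) <;> fun_prop

theorem mem_edgeNeighbourhood {z : ℍ} (hz : z.re = 0) : z ∈ edgeNeighbourhood := by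
  have := z.im_pos
  refine ⟨?_, ?_, ?_, ?_⟩ <;> rw [hz] <;> simp <;> positivity

/-- Off the geodesic, the neighbourhood is contained in the two adjacent open Farey triangles, which
no edge meets. -/
theorem re_eq_zero_of_mem_edgeNeighbourhood {z : ℍ} (hz : z ∈ edgeNeighbourhood) {g : SL(2, ℤ)}
    (hg : (g • z).re = 0) : z.re = 0 := by
  obtain ⟨h1, h2, h3, h4⟩ := hz
  rcases lt_trichotomy z.re 0 with h | h | h
  · have hmem : ModularGroup.T ^ (1 : ℤ) • z ∈ openIdealTriangle 0 1 := by
      rw [mem_openIdealTriangle_iff, re_T_zpow_smul, im_T_zpow_smul]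
      push_cast
      exact ⟨by linarith, by linarith, by nlinarith⟩
    have := re_smul_ne_zero (g * (ModularGroup.T ^ (1 : ℤ))⁻¹) hmem
    rw [mul_smul, inv_smul_smul] at this
    exact absurd hg this
  · exact h
  · exact absurd hg (re_smul_ne_zero g (mem_openIdealTriangle_iff.2 ⟨h, h2, h3⟩))

theorem isOpen_openIdealTriangle : IsOpen (openIdealTriangle 0 1) := by
  have : openIdealTriangle 0 1 =
      {z : ℍ | 0 < z.re ∧ z.re < 1 ∧ 0 < z.re ^ 2 + z.im ^ 2 - z.re} :=
    Set.ext fun z => mem_openIdealTriangle_iff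
  rw [this]
  have h1 := UpperHalfPlane.continuous_re
  have h2 := UpperHalfPlane.continuous_im
  refine IsOpen.and (isOpen_lt ?_ ?_) (IsOpen.and (isOpen_lt ?_ ?_) (isOpen_lt ?_ ?_)) <;> fun_prop

theorem isPreconnected_openIdealTriangle : IsPreconnected (openIdealTriangle 0 1) := by
  -- The triangle lies above a graph; its parameters are `re` and the excess of `im ^ 2` over the
  -- arc.
  let φ : Ioo (0 : ℝ) 1 × Ioi (0 : ℝ) → ℍ := fun p =>
    ⟨⟨p.1, √((p.1 : ℝ) - (p.1 : ℝ) ^ 2 + p.2)⟩, Real.sqrt_pos.2 (by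
      have h1 := p.1.2.1
      have h2 := p.1.2.2
      have h3 : (0 : ℝ) < p.2 := p.2.2
      nlinarith)⟩
  have hφ : Continuous φ := by
    rw [isEmbedding_coe.continuous_iff]
    refine Complex.equivRealProdCLM.symm.continuous.comp (Continuous.prodMk ?_ ?_) <;> fun_prop
  have h1 : PreconnectedSpace (Ioo (0 : ℝ) 1) := Subtype.preconnectedSpace isPreconnected_Ioo
  have h2 : PreconnectedSpace (Ioi (0 : ℝ)) := Subtype.preconnectedSpace isPreconnected_Ioi
  convert isPreconnected_range hφ
  ext z
  rw [mem_openIdealTriangle_iff]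
  constructor
  · rintro ⟨a, b, c⟩
    refine ⟨⟨⟨z.re, a, b⟩, ⟨_, c⟩⟩, UpperHalfPlane.ext_re_im rfl ?_⟩
    change √(z.re - z.re ^ 2 + (z.re ^ 2 + z.im ^ 2 - z.re)) = z.im
    rw [show z.re - z.re ^ 2 + (z.re ^ 2 + z.im ^ 2 - z.re) = z.im ^ 2 by ring,
      Real.sqrt_sq z.im_pos.le]
  · rintro ⟨⟨⟨x, hx⟩, ⟨v, hv⟩⟩, rfl⟩
    have e1 : (φ ⟨⟨x, hx⟩, ⟨v, hv⟩⟩).re = x := rfl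
    have e2 : (φ ⟨⟨x, hx⟩, ⟨v, hv⟩⟩).im = √(x - x ^ 2 + v) := rfl
    have hv' : 0 < v := hv
    rw [e1, e2, Real.sq_sqrt (by nlinarith [hx.1, hx.2])]
    exact ⟨hx.1, hx.2, by linarith⟩

/-! ## The triangulation -/

/-- The edges of the triangulation: the images of the edges of the Farey tessellation. -/
def edges : Set (Set Surface) :=
  range fun g : SL(2, ℤ) => (fun z : ℍ => unif (g • z)) '' verticalGeodesic 0

theorem exists_of_unif_smul_eq {g h : SL(2, ℤ)} {z w : ℍ} (e : unif (g • z) = unif (h • w)) :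
    ∃ k : SL(2, ℤ), k • z = w ∧ h * k * g⁻¹ ∈ fundamentalGroup := by
  obtain ⟨k, hk, e⟩ := unif_eq_iff.1 e
  refine ⟨h⁻¹ * k * g, ?_, ?_⟩
  · rw [mul_smul, mul_smul, e, inv_smul_smul]
  · have : h * (h⁻¹ * k * g) * g⁻¹ = k := by group
    rwa [this]

theorem unif_smul_of_mem {g h k : SL(2, ℤ)} (hk : h * k * g⁻¹ ∈ fundamentalGroup) (z : ℍ) :
    unif (h • k • z) = unif (g • z) := by
  have := hk (g • z)
  rwa [← mul_smul, inv_mul_cancel_right, mul_smul] at this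

theorem smul_eq_of_conj_mem {g k : SL(2, ℤ)} (hk : g * k * g⁻¹ ∈ fundamentalGroup) {z : ℍ}
    (hz : k • z = z) (w : ℍ) : k • w = w := by
  have h1 : (g * k * g⁻¹) • (g • z) = g • z := by
    rw [← mul_smul, inv_mul_cancel_right, mul_smul, hz]
  have := smul_eq_self_of_fixed hk h1 (g • w)
  rw [← mul_smul, inv_mul_cancel_right, mul_smul] at this
  exact smul_left_cancel _ this

theorem unif_mem_sUnion_edges {z : ℍ} :
    unif z ∈ ⋃₀ edges ↔ ∃ g : SL(2, ℤ), (g • z).re = 0 := by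
  constructor
  · rintro ⟨_, ⟨g, rfl⟩, w, hw, e⟩
    obtain ⟨k, hk, -⟩ := exists_of_unif_smul_eq (g := 1) (h := g) (z := z) (w := w)
      (by rw [one_smul]; exact e.symm)
    exact ⟨k, by rw [hk]; exact hw⟩
  · rintro ⟨g, hg⟩
    refine ⟨_, ⟨g⁻¹, rfl⟩, g • z, hg, ?_⟩
    simp only [inv_smul_smul]

theorem image_verticalGeodesic_eq {g h : SL(2, ℤ)} {z w : ℍ} (hz : z.re = 0) (hw : w.re = 0)
    (e : unif (g • z) = unif (h • w)) : (fun z : ℍ => unif (g • z)) '' verticalGeodesic 0 =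
      (fun z : ℍ => unif (h • z)) '' verticalGeodesic 0 := by
  have key : ∀ {g h : SL(2, ℤ)} {z w : ℍ}, z.re = 0 → w.re = 0 → unif (g • z) = unif (h • w) →
      (fun z : ℍ => unif (g • z)) '' verticalGeodesic 0 ⊆
        (fun z : ℍ => unif (h • z)) '' verticalGeodesic 0 := by
    rintro g h z w hz hw e _ ⟨x, hx, rfl⟩
    obtain ⟨k, hk, hk'⟩ := exists_of_unif_smul_eq e
    refine ⟨k • x, (re_smul_eq_zero hz (by rw [hk]; exact hw)).1 x hx, unif_smul_of_mem hk' x⟩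
  exact (key hz hw e).antisymm (key hw hz e.symm)

theorem pairwiseDisjoint_edges : edges.PairwiseDisjoint id := by
  rintro _ ⟨g, rfl⟩ _ ⟨h, rfl⟩ hne
  rw [Function.onFun, disjoint_left]
  rintro _ ⟨z, hz, rfl⟩ ⟨w, hw, e⟩
  exact hne (image_verticalGeodesic_eq hz hw e.symm)

theorem continuous_unif_smul (g : SL(2, ℤ)) : Continuous fun z : ℍ => unif (g • z) :=
  continuous_unif.comp (continuous_smul_int g)

theorem isOpenMap_unif_smul (g : SL(2, ℤ)) : IsOpenMap fun z : ℍ => unif (g • z) :=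
  isOpenMap_unif.comp (Homeomorph.smul (toReal g)).isOpenMap

theorem exists_open_or_edge (p : Surface) : ∃ (g : SL(2, ℤ)) (z : ℍ), unif (g • z) = p ∧
    (z ∈ openIdealTriangle 0 1 ∨ z.re = 0) := by
  obtain ⟨z, rfl⟩ := surjective_unif p
  obtain ⟨g, hg⟩ := exists_smul_mem_idealTriangle z
  rcases mem_open_or_exists_re_smul_eq_zero hg with h | ⟨h, hh⟩
  · exact ⟨g⁻¹, g • z, by rw [inv_smul_smul], Or.inl h⟩
  · rw [← mul_smul] at hh
    exact ⟨(h * g)⁻¹, (h * g) • z, by rw [inv_smul_smul], Or.inr hh⟩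

theorem locallyFinite_edges : LocallyFinite fun a : edges => (a : Set Surface) := by
  intro p
  obtain ⟨g, z, rfl, h | h⟩ := exists_open_or_edge p
  · refine ⟨(fun z : ℍ => unif (g • z)) '' openIdealTriangle 0 1,
      (isOpenMap_unif_smul g _ isOpen_openIdealTriangle).mem_nhds ⟨z, h, rfl⟩, ?_⟩
    convert Set.finite_empty
    rw [eq_empty_iff_forall_notMem]
    rintro ⟨_, ⟨k, rfl⟩⟩ ⟨_, ⟨w, hw, rfl⟩, ⟨x, hx, e⟩⟩
    obtain ⟨k, hk, -⟩ := exists_of_unif_smul_eq e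
    exact re_smul_ne_zero k hx (by rw [hk]; exact hw)
  · refine ⟨(fun z : ℍ => unif (g • z)) '' edgeNeighbourhood,
      (isOpenMap_unif_smul g _ isOpen_edgeNeighbourhood).mem_nhds
        ⟨z, mem_edgeNeighbourhood h, rfl⟩, ?_⟩
    apply Set.Subsingleton.finite
    have key : ∀ a : edges, ((a : Set Surface) ∩ (fun z : ℍ => unif (g • z)) ''
        edgeNeighbourhood).Nonempty → a.1 = (fun z : ℍ => unif (g • z)) '' verticalGeodesic 0 := by
      rintro ⟨_, ⟨k, rfl⟩⟩ ⟨_, ⟨w, hw, rfl⟩, ⟨x, hx, e⟩⟩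
      obtain ⟨k', hk', -⟩ := exists_of_unif_smul_eq e
      exact image_verticalGeodesic_eq hw
        (re_eq_zero_of_mem_edgeNeighbourhood hx (g := k') (by rw [hk']; exact hw)) e.symm
    intro a ha b hb
    exact Subtype.ext ((key a ha).trans (key b hb).symm)

theorem image_triangle_disjoint_or_eq (g h : SL(2, ℤ)) :
    Disjoint ((fun z : ℍ => unif (g • z)) '' openIdealTriangle 0 1)
      ((fun z : ℍ => unif (h • z)) '' openIdealTriangle 0 1) ∨
    (fun z : ℍ => unif (g • z)) '' openIdealTriangle 0 1 =
      (fun z : ℍ => unif (h • z)) '' openIdealTriangle 0 1 := by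
  have key : ∀ {g h : SL(2, ℤ)} {z w : ℍ}, z ∈ openIdealTriangle 0 1 → w ∈ openIdealTriangle 0 1 →
      unif (g • z) = unif (h • w) → (fun z : ℍ => unif (g • z)) '' openIdealTriangle 0 1 ⊆
        (fun z : ℍ => unif (h • z)) '' openIdealTriangle 0 1 := by
    rintro g h z w hz hw e _ ⟨x, hx, rfl⟩
    obtain ⟨k, hk, hk'⟩ := exists_of_unif_smul_eq e
    exact ⟨k • x, smul_mem_openIdealTriangle hz (by rw [hk]; exact hw) hx, unif_smul_of_mem hk' x⟩
  rw [or_iff_not_imp_left, not_disjoint_iff]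
  rintro ⟨_, ⟨z, hz, rfl⟩, ⟨w, hw, e⟩⟩
  exact (key hz hw e.symm).antisymm (key hw hz e)

theorem image_triangle_subset (g : SL(2, ℤ)) :
    (fun z : ℍ => unif (g • z)) '' openIdealTriangle 0 1 ⊆ (⋃₀ edges)ᶜ := by
  rintro _ ⟨z, hz, rfl⟩ hmem
  obtain ⟨h, hh⟩ := unif_mem_sUnion_edges.1 hmem
  rw [← mul_smul] at hh
  exact re_smul_ne_zero _ hz hh

theorem exists_of_notMem_edges {p : Surface} (hp : p ∈ (⋃₀ edges)ᶜ) :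
    ∃ g : SL(2, ℤ), p ∈ (fun z : ℍ => unif (g • z)) '' openIdealTriangle 0 1 := by
  obtain ⟨g, z, rfl, h | h⟩ := exists_open_or_edge p
  · exact ⟨g, z, h, rfl⟩
  · exact absurd ⟨_, ⟨g, rfl⟩, z, h, rfl⟩ hp

/-- The images of the open triangle are open and connected, cover the complement of the edges, and
are pairwise disjoint or equal; hence they are its components. -/
theorem image_triangle_eq_connectedComponentIn (g : SL(2, ℤ)) :
    (fun z : ℍ => unif (g • z)) '' openIdealTriangle 0 1 =
      connectedComponentIn (⋃₀ edges)ᶜ (unif (g • triangleCentre)) := by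
  set V := fun g : SL(2, ℤ) => (fun z : ℍ => unif (g • z)) '' openIdealTriangle 0 1 with hV
  have hopen : ∀ g, IsOpen (V g) := fun g => isOpenMap_unif_smul g _ isOpen_openIdealTriangle
  have hmem : unif (g • triangleCentre) ∈ V g := ⟨_, triangleCentre_mem, rfl⟩
  change V g = _
  apply Subset.antisymm
  · exact (isPreconnected_openIdealTriangle.image _
      (continuous_unif_smul g).continuousOn).subset_connectedComponentIn hmem
      (image_triangle_subset g)
  · have hO : IsOpen (⋃ h ∈ {h | Disjoint (V g) (V h)}, V h) :=
      isOpen_biUnion fun h _ => hopen h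
    refine isPreconnected_connectedComponentIn.subset_left_of_subset_union (hopen g) hO ?_ ?_
      ⟨_, mem_connectedComponentIn (image_triangle_subset g hmem), hmem⟩
    · rw [disjoint_iUnion₂_right]
      exact fun h hh => hh
    · intro p hp
      obtain ⟨h, hh⟩ := exists_of_notMem_edges (connectedComponentIn_subset _ _ hp)
      rcases image_triangle_disjoint_or_eq g h with hd | he
      · exact Or.inr (mem_biUnion (x := h) hd hh)
      · left
        change p ∈ (fun z : ℍ => unif (g • z)) '' openIdealTriangle 0 1
        rw [he]
        exact hh

/-- Two identified points differ by a modular transformation that preserves the triangle, and so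
fixes its centre; since the covering group acts freely, it is trivial. -/
theorem injOn_unif_smul (g : SL(2, ℤ)) :
    InjOn (fun z : ℍ => unif (g • z)) (openIdealTriangle 0 1) := by
  intro z hz w hw e
  obtain ⟨k, hk, hk'⟩ := exists_of_unif_smul_eq e
  have := smul_triangleCentre hz (g := k) (by rw [hk]; exact hw)
  rw [← hk]
  exact (smul_eq_of_conj_mem hk' this z).symm

/-- This reduces the other sides, and the triangle `-1, 0, ∞`, to the standard edge and triangle. -/
theorem image_smul_preimage (g k : SL(2, ℤ)) (S : Set ℍ) :
    (fun z : ℍ => unif (g • z)) '' ((fun z : ℍ => k • z) ⁻¹' S) =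
      (fun z : ℍ => unif ((g * k⁻¹) • z)) '' S := by
  ext p
  constructor
  · rintro ⟨z, hz, rfl⟩
    exact ⟨k • z, hz, by simp only [mul_smul, inv_smul_smul]⟩
  · rintro ⟨z, hz, rfl⟩
    refine ⟨k⁻¹ • z, by rwa [mem_preimage, smul_inv_smul], by simp only [mul_smul]⟩

theorem verticalGeodesic_one :
    verticalGeodesic 1 = (fun z : ℍ => ModularGroup.T ^ (-1 : ℤ) • z) ⁻¹' verticalGeodesic 0 := by
  ext z
  change z.re = 1 ↔ (ModularGroup.T ^ (-1 : ℤ) • z).re = 0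
  rw [re_T_zpow_smul]
  push_cast
  constructor <;> intro h <;> linarith

theorem arcGeodesic_zero_one :
    arcGeodesic 0 1 = (fun z : ℍ => arcMatrix⁻¹ • z) ⁻¹' verticalGeodesic 0 := by
  ext z
  rw [mem_arcGeodesic_iff]
  change _ ↔ (arcMatrix⁻¹ • z).re = 0
  obtain ⟨D, hD, h⟩ := re_arcMatrix_inv_smul z
  constructor
  · intro h'
    rw [h', neg_zero] at h
    exact (mul_eq_zero.1 h).resolve_right hD.ne'
  · intro h'
    rw [h', zero_mul] at h
    linarith

theorem isFace_unif_smul (g : SL(2, ℤ)) : IsFace charts edges 0 1 fun z => unif (g • z) where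
  isometry := isLocalIsometryOn_unif_smul (toReal g) _
  injOn := injOn_unif_smul g
  component := ⟨_, image_triangle_subset g ⟨_, triangleCentre_mem, rfl⟩,
    image_triangle_eq_connectedComponentIn g⟩
  side_left := ⟨g, rfl⟩
  side_right := ⟨_, by rw [verticalGeodesic_one, image_smul_preimage]⟩
  side_arc := ⟨_, by rw [arcGeodesic_zero_one, image_smul_preimage]⟩

theorem coe_T_smul_sub (z : ℍ) : ((ModularGroup.T ^ (1 : ℤ) • z : ℍ) : ℂ) - (((0 + 1) / 2 : ℝ) : ℂ) =
    z - (((-1 + 0) / 2 : ℝ) : ℂ) := by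
  rw [coe_T_zpow_smul]
  push_cast
  ring

theorem openIdealTriangle_neg_one : openIdealTriangle (-1) 0 =
    (fun z : ℍ => ModularGroup.T ^ (1 : ℤ) • z) ⁻¹' openIdealTriangle 0 1 := by
  ext z
  change (-1 < z.re ∧ z.re < 0 ∧ (0 - -1) / 2 < ‖(z : ℂ) - (((-1 + 0) / 2 : ℝ) : ℂ)‖) ↔
    (0 < (ModularGroup.T ^ (1 : ℤ) • z).re ∧ (ModularGroup.T ^ (1 : ℤ) • z).re < 1 ∧
      (1 - 0) / 2 < ‖((ModularGroup.T ^ (1 : ℤ) • z : ℍ) : ℂ) - (((0 + 1) / 2 : ℝ) : ℂ)‖)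
  rw [coe_T_smul_sub, re_T_zpow_smul]
  push_cast
  refine and_congr ?_ (and_congr ?_ ?_)
  · constructor <;> intro h <;> linarith
  · constructor <;> intro h <;> linarith
  · norm_num

theorem arcGeodesic_neg_one : arcGeodesic (-1) 0 =
    (fun z : ℍ => ModularGroup.T ^ (1 : ℤ) • z) ⁻¹' arcGeodesic 0 1 := by
  ext z
  change ‖(z : ℂ) - (((-1 + 0) / 2 : ℝ) : ℂ)‖ = (0 - -1) / 2 ↔
    ‖((ModularGroup.T ^ (1 : ℤ) • z : ℍ) : ℂ) - (((0 + 1) / 2 : ℝ) : ℂ)‖ = (1 - 0) / 2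
  rw [coe_T_smul_sub]
  norm_num

theorem verticalGeodesic_neg_one :
    verticalGeodesic (-1) = (fun z : ℍ => ModularGroup.T ^ (1 : ℤ) • z) ⁻¹' verticalGeodesic 0 := by
  ext z
  change z.re = -1 ↔ (ModularGroup.T ^ (1 : ℤ) • z).re = 0
  rw [re_T_zpow_smul]
  push_cast
  constructor <;> intro h <;> linarith

theorem isFace_unif_smul_left (g : SL(2, ℤ)) :
    IsFace charts edges (-1) 0 fun z => unif (g • z) where
  isometry := isLocalIsometryOn_unif_smul (toReal g) _
  injOn := by
    rw [openIdealTriangle_neg_one]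
    intro z hz w hw e
    have := injOn_unif_smul (g * (ModularGroup.T ^ (1 : ℤ))⁻¹) hz hw
      (by simp only [mul_smul, inv_smul_smul]; exact e)
    exact smul_left_cancel _ this
  component := by
    rw [openIdealTriangle_neg_one, image_smul_preimage]
    exact (isFace_unif_smul _).component
  side_left := ⟨_, by rw [verticalGeodesic_neg_one, image_smul_preimage]⟩
  side_right := ⟨g, rfl⟩
  side_arc := by
    rw [arcGeodesic_neg_one, image_smul_preimage]
    exact (isFace_unif_smul _).side_arc

/-- The Farey triangles adjacent to the edge from `0` to `∞` have third vertices `-1` and `1 = exp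
0`, and a single map develops both. -/
theorem hasShear_zero {a : Set Surface} (ha : a ∈ edges) : HasShear charts edges a 0 := by
  obtain ⟨g, rfl⟩ := ha
  refine ⟨fun z => unif (g • z), isLocalIsometryOn_unif_smul (toReal g) _,
    isFace_unif_smul_left g, ?_, rfl⟩
  rw [Real.exp_zero]
  exact isFace_unif_smul g

/-! ### The edges are geodesics -/

theorem continuous_verticalLine (x : ℝ) : Continuous (verticalLine x) := by
  rw [isEmbedding_coe.continuous_iff]
  exact Complex.equivRealProdCLM.symm.continuous.comp
    (continuous_const.prodMk Real.continuous_exp)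

theorem isGeodesic_unif_smul (g : SL(2, ℤ)) :
    IsGeodesic charts fun t => unif (g • verticalLine 0 t) := by
  intro t
  obtain ⟨e, he, k, hk⟩ := isLocalIsometryOn_unif_smul (toReal g) univ (verticalLine 0 t) (mem_univ _)
  rw [nhdsWithin_univ] at hk
  exact ⟨e, he, k, (continuous_verticalLine 0).continuousAt.eventually hk⟩

/-- A modular transformation that identifies two points of the edge preserves it and fixes `i`; by
freeness it is trivial. -/
theorem injective_unif_smul_verticalLine (g : SL(2, ℤ)) :
    Function.Injective fun t => unif (g • verticalLine 0 t) := by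
  intro t s e
  obtain ⟨k, hk, hk'⟩ := exists_of_unif_smul_eq e
  have h1 := (re_smul_eq_zero (z := verticalLine 0 t) rfl (g := k) (by rw [hk]; rfl)).2
  have h2 := smul_eq_of_conj_mem hk' h1 (verticalLine 0 t)
  rw [hk] at h2
  exact (Real.exp_injective (congrArg UpperHalfPlane.im h2)).symm

theorem range_verticalLine : range (verticalLine 0) = verticalGeodesic 0 := by
  ext z
  constructor
  · rintro ⟨t, rfl⟩; rfl
  · intro hz
    refine ⟨Real.log z.im, UpperHalfPlane.ext_re_im ?_ ?_⟩
    · exact hz.symm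
    · exact Real.exp_log z.im_pos

theorem range_unif_smul_verticalLine (g : SL(2, ℤ)) :
    (range fun t => unif (g • verticalLine 0 t)) =
      (fun z : ℍ => unif (g • z)) '' verticalGeodesic 0 := by
  rw [← range_verticalLine, ← range_comp]
  rfl

theorem isIdealTriangulation_edges : IsIdealTriangulation charts edges where
  geodesic := by
    rintro _ ⟨g, rfl⟩
    exact ⟨_, isGeodesic_unif_smul g, injective_unif_smul_verticalLine g,
      range_unif_smul_verticalLine g⟩
  disjoint := pairwiseDisjoint_edges
  locallyFinite := locallyFinite_edges
  faces p hp := by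
    obtain ⟨g, hg⟩ := exists_of_notMem_edges hp
    exact ⟨_, isFace_unif_smul g, hg⟩

/-! ### The punctures -/

theorem exists_affine {α : ℝ} (hα : 0 < α) (β : ℝ) :
    ∃ h : SL(2, ℝ), ∀ z : ℍ, ((h • z : ℍ) : ℂ) = α * z + β := by
  let A : GL (Fin 2) ℝ := Matrix.GeneralLinearGroup.mkOfDetNeZero !![α, β; 0, 1]
    (by simp [hα.ne'])
  have hA : 0 < A.det.val := by
    simpa [A, Matrix.GeneralLinearGroup.mkOfDetNeZero] using hα
  obtain ⟨h, hh⟩ := exists_specialLinear_smul_eq hA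
  refine ⟨h, fun z => ?_⟩
  rw [hh, coe_smul_of_det_pos hA]
  simp [num, denom, A, Matrix.GeneralLinearGroup.mkOfDetNeZero]

/-- A modular transformation that maps a point of height more than one to such a point is a
translation. -/
theorem exists_vadd_eq {k : SL(2, ℤ)} {z : ℍ} (hz : 1 < z.im) (hkz : 1 < (k • z).im) :
    ∃ j : ℤ, ∀ w : ℍ, k • w = (j : ℝ) +ᵥ w := by
  have h0 : k 1 0 = 0 := by
    by_contra hne
    have h1 := one_le_int_sq hne
    rw [im_smul_int] at hkz
    have hp : z.im < (k 1 0 * z.re + k 1 1) ^ 2 + (k 1 0 * z.im) ^ 2 := by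
      rw [mul_pow]
      nlinarith [sq_nonneg (k 1 0 * z.re + k 1 1)]
    rw [lt_div_iff₀ (by linarith)] at hkz
    linarith
  have hd := det_int k
  rw [h0, mul_zero, sub_zero] at hd
  obtain ⟨h1, h2⟩ := units_of_int_mul (Or.inl hd)
  have h1 : k 0 0 = k 1 1 := by
    rcases h1 with h | h
    · exact h
    · rw [h] at hd; rcases h2 with h' | h' <;> rw [h'] at hd <;> omega
  refine ⟨k 0 1 * k 1 1, fun w => UpperHalfPlane.ext ?_⟩
  rw [coe_smul_int, coe_vadd, h0, h1]
  rcases h2 with h' | h' <;> rw [h'] <;> push_cast <;> ring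

/-- The width of the cusp that is the image of `∞` under `g`. -/
theorem exists_width (g : SL(2, ℤ)) : ∃ W : ℕ, 0 < W ∧
    ∀ j : ℤ, (∀ z : ℍ, unif (g • ((j : ℝ) +ᵥ z)) = unif (g • z)) ↔ (W : ℤ) ∣ j := by
  let S : AddSubgroup ℤ :=
    { carrier := {j | ∀ z : ℍ, unif (g • ((j : ℝ) +ᵥ z)) = unif (g • z)}
      add_mem' := by
        intro a b ha hb z
        rw [Int.cast_add, add_vadd, ha, hb]
      zero_mem' := by
        intro z
        rw [Int.cast_zero, zero_vadd]
      neg_mem' := by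
        intro a ha z
        rw [← ha, Int.cast_neg, vadd_neg_vadd] }
  obtain ⟨a, ha⟩ := Int.subgroup_cyclic S
  have hS : ∀ j : ℤ, j ∈ S ↔ a ∣ j := fun j => by
    rw [ha, AddSubgroup.mem_closure_singleton]
    simp only [zsmul_eq_mul, Int.cast_eq]
    constructor
    · rintro ⟨n, rfl⟩; exact dvd_mul_left _ _
    · rintro ⟨n, rfl⟩; exact ⟨n, mul_comm _ _⟩
  refine ⟨a.natAbs, ?_, fun j => ?_⟩
  · have h8 : (8 : ℤ) ∈ S := fun z => by
      have := unif_smul_eight_vadd g z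
      exact_mod_cast this
    rw [hS] at h8
    rw [Int.natAbs_pos]
    rintro rfl
    simp at h8
  · rw [Int.natAbs_dvd, ← hS]
    rfl

/-- Above height one only translations can identify points, and the width `W` generates those that
do. As `W ≥ 1`, the scaling by `W` stays above height one. -/
theorem isCusp_of_width {g : SL(2, ℤ)} {W : ℕ} (hW : 0 < W)
    (h : ∀ j : ℤ, (∀ z : ℍ, unif (g • ((j : ℝ) +ᵥ z)) = unif (g • z)) ↔ (W : ℤ) ∣ j)
    {s : SL(2, ℝ)} (hs : ∀ z : ℍ, ((s • z : ℍ) : ℂ) = (W : ℝ) * z + (0 : ℝ)) :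
    IsCusp charts 1 fun z => unif (g • s • z) where
  pos := one_pos
  isometry := by
    have := isLocalIsometryOn_unif_smul (toReal g * s) {z | 1 < z.im}
    simp only [mul_smul] at this
    exact this
  eq_iff := by
    intro z w hz hw
    have hW1 : (1 : ℝ) ≤ W := by exact_mod_cast hW
    have hWc : (W : ℂ) ≠ 0 := by exact_mod_cast hW.ne'
    have him : ∀ z : ℍ, 1 < z.im → 1 < (s • z).im := fun z hz => by
      rw [← coe_im, hs]
      simp
      nlinarith
    constructor
    · intro e
      obtain ⟨k, hk, hk'⟩ := exists_of_unif_smul_eq e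
      obtain ⟨j, hj⟩ := exists_vadd_eq (him z hz) (k := k) (by rw [hk]; exact him w hw)
      obtain ⟨n, rfl⟩ := (h j).1 fun x => by rw [← hj]; exact unif_smul_of_mem hk' x
      refine ⟨n, ?_⟩
      rw [hj] at hk
      have := congrArg UpperHalfPlane.coe hk
      rw [coe_vadd, hs, hs] at this
      push_cast at this
      apply mul_left_cancel₀ hWc
      linear_combination -this
    · rintro ⟨n, hn⟩
      have e : s • w = ((W * n : ℤ) : ℝ) +ᵥ s • z := UpperHalfPlane.ext (by
        rw [coe_vadd, hs, hs, hn]; push_cast; ring)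
      change unif (g • s • z) = unif (g • s • w)
      rw [e, (h (W * n)).2 (dvd_mul_right _ _)]

theorem endsAtPuncture_unif_smul (g : SL(2, ℤ)) :
    EndsAtPuncture charts fun t => unif (g • verticalLine 0 t) := by
  obtain ⟨W, hW, h⟩ := exists_width g
  have hW0 : (0 : ℝ) < W := by exact_mod_cast hW
  obtain ⟨s, hs⟩ := exists_affine hW0 0
  -- The scaling by `W` advances a vertical unit speed ray by the time `log W`, which is subtracted
  -- here.
  refine ⟨1, _, isCusp_of_width hW h hs, 0, -Real.log W, Eventually.of_forall fun t => ?_⟩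
  have : s • verticalLine 0 (t + -Real.log W) = verticalLine 0 t := UpperHalfPlane.ext (by
    rw [hs]
    apply Complex.ext
    · simp [verticalLine]
    · simp [verticalLine, Real.exp_add, Real.exp_neg, Real.exp_log hW0]
      field_simp)
  simp only [this]

theorem S_smul_verticalLine (t : ℝ) :
    ModularGroup.S • verticalLine 0 t = verticalLine 0 (-t) := by
  apply UpperHalfPlane.ext
  rw [modular_S_smul]
  have := Real.exp_pos t
  apply Complex.ext <;> simp [verticalLine, Complex.inv_re, Complex.inv_im, Complex.normSq_apply,
    Real.exp_neg]
  field_simp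

theorem endsAtPuncture_unif_smul_neg (g : SL(2, ℤ)) :
    EndsAtPuncture charts fun t => unif (g • verticalLine 0 (-t)) := by
  have := endsAtPuncture_unif_smul (g * ModularGroup.S)
  simp only [mul_smul, S_smul_verticalLine] at this
  exact this

/-! ### The valence of the punctures -/

theorem continuousOn_of_isLocalIsometryOn {S : Set ℍ} {f : ℍ → Surface}
    (h : IsLocalIsometryOn charts S f) : ContinuousOn f S := by
  intro z hz
  obtain ⟨e, he, g, hg⟩ := h z hz
  have h0 := hg.self_of_nhdsWithin hz
  have h1 : ContinuousAt e.symm (g • z) := by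
    rw [← h0.2]
    exact e.symm.continuousAt (e.map_source h0.1)
  have h2 : ContinuousAt (fun w : ℍ => e.symm (g • w)) z :=
    ContinuousAt.comp (f := fun w : ℍ => g • w) h1 (continuous_const_smul g).continuousAt
  refine h2.continuousWithinAt.congr_of_eventuallyEq ?_ ?_
  · filter_upwards [hg] with w hw
    rw [← hw.2, e.left_inv hw.1]
  · rw [← h0.2, e.left_inv h0.1]

theorem exists_smul_eq_chart_unif {e : OpenPartialHomeomorph Surface ℍ} (he : e ∈ charts) {z : ℍ}
    (hz : unif z ∈ e.source) : ∃ g : SL(2, ℝ), ∀ᶠ w in 𝓝 z, e (unif w) = g • w := by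
  obtain ⟨g, hg⟩ := exists_smul_eq_chart he hz
  refine ⟨g * scaling, ?_⟩
  have := (continuous_const_smul scaling).continuousAt (x := z)
  filter_upwards [this.eventually hg] with w hw
  rw [unif, hw, mul_smul]

theorem sl_smul_eq_of_two_points {g h : SL(2, ℝ)} {z w : ℍ} (hne : w ≠ z)
    (hz : g • z = h • z) (hw : g • w = h • w) (x : ℍ) : g • x = h • x := by
  have hdet : ∀ k : SL(2, ℝ), 0 < (Matrix.SpecialLinearGroup.toGL k).det.val := fun k => by
    have : (Matrix.SpecialLinearGroup.toGL k).det.val = 1 := k.det_coe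
    rw [this]; exact one_pos
  exact smul_eq_smul_of_two_points (g := Matrix.SpecialLinearGroup.toGL g)
    (h := Matrix.SpecialLinearGroup.toGL h) (iff_of_true (hdet g) (hdet h)) hne hz hw x

theorem exists_ne_of_eventually {p : ℍ → Prop} {z : ℍ} (h : ∀ᶠ w in 𝓝 z, p w) :
    ∃ w, w ≠ z ∧ p w := by
  have : (𝓝[≠] z).NeBot := inferInstance
  obtain ⟨w, hw, hw'⟩ := ((h.filter_mono nhdsWithin_le_nhds).and
    (self_mem_nhdsWithin (s := {z}ᶜ))).exists
  exact ⟨w, hw', hw⟩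

/-- A local isometry of a horoball into the surface lifts to an isometry of the hyperbolic
plane. -/
theorem exists_lift_of_isLocalIsometryOn {h : ℝ} (hh : 0 < h) {c : ℍ → Surface}
    (hc : IsLocalIsometryOn charts {z | h < z.im} c) :
    ∃ G : SL(2, ℝ), ∀ z : ℍ, h < z.im → c z = unif (G • z) := by
  -- Shifting `ℍ` up onto the horoball gives a map on a simply connected space, which lifts to the
  -- covering.
  let s : ℍ → ℍ := fun z => ⟨z + h * Complex.I, by
    have := z.im_pos
    simp; positivity⟩
  have hs_im : ∀ z, (s z).im = z.im + h := fun z => by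
    change ((z : ℂ) + h * Complex.I).im = _
    simp
  have hs : Continuous s := by
    rw [isEmbedding_coe.continuous_iff]
    exact continuous_coe.add continuous_const
  have hmem : ∀ z, s z ∈ {z : ℍ | h < z.im} := fun z => by
    change h < (s z).im
    rw [hs_im]; linarith [z.im_pos]
  have hopen : IsOpen {z : ℍ | h < z.im} := isOpen_lt continuous_const continuous_im
  have hcs : Continuous (c ∘ s) :=
    (continuousOn_of_isLocalIsometryOn hc).comp_continuous hs hmem
  obtain ⟨x₀, hx₀⟩ := surjective_unif (c (s UpperHalfPlane.I))
  obtain ⟨F, ⟨-, hF⟩, -⟩ := isCoveringMap_unif.existsUnique_continuousMap_lifts ⟨c ∘ s, hcs⟩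
    UpperHalfPlane.I x₀ hx₀
  have hF' : ∀ z, unif (F z) = c (s z) := fun z => congrFun hF z
  have hloc : ∀ z, ∃ G : SL(2, ℝ), ∀ᶠ w in 𝓝 z, F w = G • s w := by
    intro z
    obtain ⟨e, he, g, hg⟩ := hc (s z) (hmem z)
    rw [hopen.nhdsWithin_eq (hmem z)] at hg
    have h0 := hg.self_of_nhds
    obtain ⟨k, hk⟩ := exists_smul_eq_chart_unif he (z := F z) (by rw [hF']; exact h0.1)
    refine ⟨k⁻¹ * g, ?_⟩
    filter_upwards [hs.continuousAt.eventually hg, F.continuous.continuousAt.eventually hk]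
      with w h1 h2
    rw [mul_smul, ← h1.2, ← hF', h2, inv_smul_smul]
  have htop : ∀ {G G' : SL(2, ℝ)} {z : ℍ}, (∀ᶠ w in 𝓝 z, G • s w = G' • s w) →
      ∀ x : ℍ, G • x = G' • x := by
    intro G G' z hev
    obtain ⟨w, hne, hw⟩ := exists_ne_of_eventually hev
    refine sl_smul_eq_of_two_points (z := s z) (w := s w) (fun e => hne ?_) hev.self_of_nhds hw
    have := congrArg UpperHalfPlane.coe e
    exact UpperHalfPlane.ext (add_right_cancel this)
  obtain ⟨G, hG⟩ := hloc UpperHalfPlane.I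
  have hall : ∀ z, ∀ᶠ w in 𝓝 z, F w = G • s w := by
    -- Möbius transformations that agree on an open set are equal, so the local expression of the
    -- lift propagates over the connected half-plane.
    have hclopen : IsClopen {z | ∀ᶠ w in 𝓝 z, F w = G • s w} := by
      refine ⟨⟨?_⟩, isOpen_setOfPred_eventually_nhds⟩
      rw [isOpen_iff_mem_nhds]
      intro z hz
      obtain ⟨G', hG'⟩ := hloc z
      filter_upwards [hG'.eventually_nhds] with w hw hw'
      apply hz
      have := htop (G := G) (G' := G') (z := w) (by
        filter_upwards [hw, hw'] with x h1 h2
        rw [← h1, ← h2])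
      filter_upwards [hG'] with x hx
      rw [hx, this]
    have := hclopen.eq_univ ⟨UpperHalfPlane.I, hG⟩
    intro z
    have hz : z ∈ {z | ∀ᶠ w in 𝓝 z, F w = G • s w} := by rw [this]; exact mem_univ z
    exact hz
  refine ⟨G, fun z hz => ?_⟩
  let w : ℍ := ⟨z - h * Complex.I, by simp; linarith⟩
  have hw : s w = z := UpperHalfPlane.ext (by
    change (z : ℂ) - h * Complex.I + h * Complex.I = z
    ring)
  have := (hall w).self_of_nhds
  rw [hw] at this
  rw [← this, hF', hw]

theorem isPreconnected_lt_im (h : ℝ) : IsPreconnected {z : ℍ | h < z.im} := by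
  rw [← isEmbedding_coe.isInducing.isPreconnected_image]
  have : UpperHalfPlane.coe '' {z : ℍ | h < z.im} = {z : ℂ | max h 0 < z.im} := by
    ext z
    constructor
    · rintro ⟨w, hw, rfl⟩
      exact max_lt hw w.im_pos
    · intro hz
      have hz : max h 0 < z.im := hz
      refine ⟨⟨z, (le_max_right h 0).trans_lt hz⟩, ?_, rfl⟩
      exact (le_max_left h 0).trans_lt hz
  rw [this]
  exact (convex_halfSpace_im_gt _).isPreconnected

/-- Only scalar matrices act trivially; the fixed point equations at `i` and `2 i` show this. -/
theorem exists_row_of_smul_eq {g h : SL(2, ℝ)} (e : ∀ x : ℍ, g • x = h • x) :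
    ∃ c : ℝ, c ≠ 0 ∧ ∀ i j, g i j = c * h i j := by
  have h1 : ∀ x : ℍ, Matrix.SpecialLinearGroup.toGL (h⁻¹ * g) • x = x := fun x => by
    change (h⁻¹ * g) • x = x
    rw [mul_smul, e, inv_smul_smul]
  have hdet : 0 < (Matrix.SpecialLinearGroup.toGL (h⁻¹ * g)).det.val := by
    have : (Matrix.SpecialLinearGroup.toGL (h⁻¹ * g)).det.val = 1 := (h⁻¹ * g).det_coe
    rw [this]; exact one_pos
  have h2 := fun x => (gl_smul_eq_self_iff_quadratic hdet).1 (h1 x)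
  set k := h⁻¹ * g with hk
  have hkq : ∀ x : ℍ, (k 1 0 : ℂ) * (x * x) + (k 1 1 - k 0 0) * x + -k 0 1 = 0 := h2
  have a1 := hkq UpperHalfPlane.I
  have a2 := hkq ⟨⟨0, 2⟩, by norm_num⟩
  have r1 := congrArg Complex.re a1
  have i1 := congrArg Complex.im a1
  have r2 := congrArg Complex.re a2
  simp at r1 i1 r2
  have h10 : k 1 0 = 0 := by linarith
  have h01 : k 0 1 = 0 := by linarith
  have h11 : k 1 1 = k 0 0 := by linarith
  have hd : k 0 0 * k 1 1 - k 0 1 * k 1 0 = 1 := by rw [← Matrix.det_fin_two, k.det_coe]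
  refine ⟨k 0 0, fun h => ?_, ?_⟩
  · rw [h01, h] at hd; simp at hd
  · intro i j
    have hg : g = h * k := by rw [hk, mul_inv_cancel_left]
    rw [hg, Matrix.SpecialLinearGroup.coe_mul, Matrix.mul_apply, Fin.sum_univ_two]
    fin_cases j
    · simp only [Fin.zero_eta, h10]; ring
    · simp only [Fin.mk_one, h01, h11]; ring

/-- The relation makes `a : c` a rational point of the projective line. Dividing by the greatest
common divisor and completing by Bézout gives an integral matrix that takes `∞` to it. -/
theorem exists_int_proportional {a c : ℝ} {u v : ℤ}
    (huv : ¬ (u = 0 ∧ v = 0)) (h : u * a + v * c = 0) :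
    ∃ s : SL(2, ℤ), s 0 0 * c - s 1 0 * a = 0 := by
  have hg : Int.gcd v u ≠ 0 := by
    rw [Ne, Int.gcd_eq_zero_iff]
    exact fun h => huv ⟨h.2, h.1⟩
  obtain ⟨v', hv⟩ := Int.gcd_dvd_left v u
  obtain ⟨u', hu⟩ := Int.gcd_dvd_right v u
  have hg0 : (Int.gcd v u : ℤ) ≠ 0 := by exact_mod_cast hg
  have hbez := Int.gcd_eq_gcd_ab v u
  generalize (Int.gcd v u : ℤ) = d at *
  generalize Int.gcdA v u = A at *
  generalize Int.gcdB v u = B at *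
  have hb1 : v' * A + u' * B = 1 := by
    apply mul_left_cancel₀ hg0
    linear_combination -hbez - A * hv - B * hu
  let s : SL(2, ℤ) := ⟨!![v', B; -u', A], by
    rw [Matrix.det_fin_two_of]; linarith⟩
  refine ⟨s, ?_⟩
  have s00 : s 0 0 = v' := rfl
  have s10 : s 1 0 = -u' := rfl
  rw [s00, s10]
  have hgr : (d : ℝ) ≠ 0 := by exact_mod_cast hg0
  apply mul_left_cancel₀ hgr
  have hu' : (u : ℝ) = d * u' := by exact_mod_cast hu
  have hv' : (v : ℝ) = d * v' := by exact_mod_cast hv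
  push_cast
  linear_combination h - a * hu' - c * hv'

/-- A real Möbius transformation that conjugates the translation by one to an integral one maps
`∞` to a rational number or to `∞`. -/
theorem exists_affine_of_conj {G : SL(2, ℝ)} {k : SL(2, ℤ)}
    (h : ∀ x : ℍ, G • ((1 : ℝ) +ᵥ x) = k • G • x) :
    ∃ (s : SL(2, ℤ)) (A : ℕ) (B : ℝ), 0 < A ∧
      ∀ x y : ℍ, (y : ℂ) = A * x + B → G • x = s • y := by
  let T : SL(2, ℝ) := ⟨!![1, 1; 0, 1], by simp⟩
  have T00 : T 0 0 = 1 := rfl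
  have T01 : T 0 1 = 1 := rfl
  have T10 : T 1 0 = 0 := rfl
  have T11 : T 1 1 = 1 := rfl
  have hT : ∀ x : ℍ, T • x = (1 : ℝ) +ᵥ x := fun x => UpperHalfPlane.ext (by
    rw [coe_specialLinearGroup_apply, coe_vadd, T00, T01, T10, T11]; simp; ring)
  obtain ⟨c, hc, hcij⟩ := exists_row_of_smul_eq (g := G * T) (h := toReal k * G) (fun x => by
    rw [mul_smul, mul_smul, hT, h]; rfl)
  have k00 : toReal k 0 0 = k 0 0 := rfl
  have k01 : toReal k 0 1 = k 0 1 := rfl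
  have k10 : toReal k 1 0 = k 1 0 := rfl
  have k11 : toReal k 1 1 = k 1 1 := rfl
  simp only [Matrix.SpecialLinearGroup.coe_mul, Matrix.mul_apply, Fin.sum_univ_two] at hcij
  have e00 := hcij 0 0
  have e10 := hcij 1 0
  have e01 := hcij 0 1
  have e11 := hcij 1 1
  rw [T00, T10, k00, k01] at e00
  rw [T00, T10, k10, k11] at e10
  rw [T01, T11, k00, k01] at e01
  rw [T01, T11, k10, k11] at e11
  have hGd : G 0 0 * G 1 1 - G 0 1 * G 1 0 = 1 := by rw [← Matrix.det_fin_two, G.det_coe]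
  have hkd : (k 0 0 : ℝ) * k 1 1 - k 0 1 * k 1 0 = 1 := by exact_mod_cast det_int k
  have hc2 : c = 1 ∨ c = -1 := by
    have : c * c = 1 := by
      have d1 : (G 0 0 * 1 + G 0 1 * 0) * (G 1 0 * 1 + G 1 1 * 1) -
          (G 0 0 * 1 + G 0 1 * 1) * (G 1 0 * 1 + G 1 1 * 0) = 1 := by linear_combination hGd
      rw [e00, e11, e01, e10] at d1
      linear_combination d1 - c ^ 2 * (G 0 0 * G 1 1 - G 0 1 * G 1 0) * hkd - c ^ 2 * hGd
    exact mul_self_eq_one_iff.1 this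
  obtain ⟨ε, hε, hεc⟩ : ∃ ε : ℤ, (ε : ℝ) = c ∧ ε * ε = 1 := by
    rcases hc2 with h | h
    · exact ⟨1, by simp [h], by norm_num⟩
    · exact ⟨-1, by simp [h], by norm_num⟩
  have hac : ¬ (G 0 0 = 0 ∧ G 1 0 = 0) := fun ⟨h1, h2⟩ => by rw [h1, h2] at hGd; simp at hGd
  -- The first column of `G` is an eigenvector of `k` for `±1`, so the integral matrix `ε k - 1`
  -- annihilates it. That matrix is not zero, as the translation is not trivial, and a nonzero row
  -- of it is the rational relation.
  obtain ⟨s, hs⟩ : ∃ s : SL(2, ℤ), s 0 0 * G 1 0 - s 1 0 * G 0 0 = 0 := by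
    by_cases h1 : ε * k 0 0 - 1 = 0 ∧ ε * k 0 1 = 0
    · by_cases h2 : ε * k 1 0 = 0 ∧ ε * k 1 1 - 1 = 0
      · exfalso
        have a1 : c * k 0 0 = 1 := by rw [← hε]; exact_mod_cast sub_eq_zero.1 h1.1
        have a2 : c * k 0 1 = 0 := by rw [← hε]; exact_mod_cast h1.2
        have a3 : c * k 1 0 = 0 := by rw [← hε]; exact_mod_cast h2.1
        have a4 : c * k 1 1 = 1 := by rw [← hε]; exact_mod_cast sub_eq_zero.1 h2.2
        apply hac
        constructor
        · linear_combination e01 + G 0 1 * a1 + G 1 1 * a2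
        · linear_combination e11 + G 0 1 * a3 + G 1 1 * a4
      · refine exists_int_proportional h2 ?_
        push_cast
        rw [hε]
        linarith
    · refine exists_int_proportional h1 ?_
      push_cast
      rw [hε]
      linarith
  have hsd := det_int s
  have s00 : toReal s 0 0 = s 0 0 := rfl
  have s01 : toReal s 0 1 = s 0 1 := rfl
  have s10 : toReal s 1 0 = s 1 0 := rfl
  have s11 : toReal s 1 1 = s 1 1 := rfl
  set P : SL(2, ℝ) := (toReal s)⁻¹ * G with hP
  have hPG : ∀ x : ℍ, G • x = s • P • x := fun x => by
    rw [hP, mul_smul, ← toReal_smul, smul_inv_smul]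
  have P10 : P 1 0 = 0 := by
    rw [hP, Matrix.SpecialLinearGroup.coe_mul, Matrix.mul_apply, Fin.sum_univ_two,
      Matrix.SpecialLinearGroup.coe_inv, Matrix.adjugate_fin_two]
    simp only [Matrix.of_apply, Matrix.cons_val', Matrix.cons_val_zero, Matrix.cons_val_one,
      Matrix.cons_val_fin_one, s00, s10]
    linarith
  have hPd : P 0 0 * P 1 1 = 1 := by
    have : P 0 0 * P 1 1 - P 0 1 * P 1 0 = 1 := by rw [← Matrix.det_fin_two, P.det_coe]
    rwa [P10, mul_zero, sub_zero] at this
  have hPx : ∀ x : ℍ, ((P • x : ℍ) : ℂ) = (P 0 0 ^ 2 : ℝ) * x + (P 0 0 * P 0 1 : ℝ) := fun x => by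
    rw [coe_specialLinearGroup_apply, P10]
    have h1 : (P 0 0 : ℂ) * P 1 1 = 1 := by exact_mod_cast congrArg Complex.ofReal hPd
    have h2 : (P 1 1 : ℂ) ≠ 0 := right_ne_zero_of_mul_eq_one h1
    simp only [Algebra.algebraMap_self, RingHom.id_apply, Complex.ofReal_zero, zero_mul, zero_add]
    rw [div_eq_iff h2]
    push_cast
    linear_combination (-(P 0 0 : ℂ) * x - P 0 1) * h1
  have hPpos : 0 < P 0 0 ^ 2 := by
    have := left_ne_zero_of_mul_eq_one hPd
    positivity
  -- The conjugate of `k` is a translation and modular at the same time, so its length `P 0 0 ^ 2`,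
  -- which is the scale of `P`, is an integer.
  have hconj : ∀ y : ℍ, (s⁻¹ * k * s) • y = (P 0 0 ^ 2 : ℝ) +ᵥ y := fun y => by
    have h1 := h (P⁻¹ • y)
    rw [hPG, hPG, smul_inv_smul] at h1
    have h2 : P • ((1 : ℝ) +ᵥ P⁻¹ • y) = (P 0 0 ^ 2 : ℝ) +ᵥ y := UpperHalfPlane.ext (by
      have := hPx (P⁻¹ • y)
      rw [smul_inv_smul] at this
      rw [hPx, coe_vadd, coe_vadd, this]
      push_cast; ring)
    rw [mul_smul, mul_smul, ← h1, inv_smul_smul, h2]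
  let y₀ : ℍ := ⟨⟨0, 2⟩, by norm_num⟩
  obtain ⟨j, hj⟩ := exists_vadd_eq (k := s⁻¹ * k * s) (z := y₀) (by change (1 : ℝ) < 2; norm_num)
    (by rw [hconj, vadd_im]; change (1 : ℝ) < 2; norm_num)
  have hjP : P 0 0 ^ 2 = j := by
    have := (hconj y₀).symm.trans (hj y₀)
    have := congrArg UpperHalfPlane.re this
    rw [vadd_re, vadd_re] at this
    linarith
  have hj0 : 0 < j := by rw [hjP] at hPpos; exact_mod_cast hPpos
  refine ⟨s, j.toNat, P 0 0 * P 0 1, by omega, fun x y hy => ?_⟩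
  rw [hPG]
  congr 1
  apply UpperHalfPlane.ext
  rw [hPx, hy, hjP]
  have : ((j.toNat : ℤ) : ℂ) = j := by rw [Int.toNat_of_nonneg hj0.le]
  push_cast at this ⊢
  rw [this]

/-- A vertical line at a point with non-integral real part meets no edge of the Farey tessellation
above height one. -/
theorem exists_int_of_re_smul_eq_zero {g : SL(2, ℤ)} {z : ℍ} (hz : 1 < z.im)
    (hg : (g • z).re = 0) : ∃ n : ℤ, z.re = n := by
  refine ⟨⌊z.re⌋, ?_⟩
  by_contra hne
  have h1 := Int.floor_le z.re
  have h2 := Int.lt_floor_add_one z.re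
  have hmem : ModularGroup.T ^ (-⌊z.re⌋) • z ∈ openIdealTriangle 0 1 := by
    rw [mem_openIdealTriangle_iff, re_T_zpow_smul, im_T_zpow_smul]
    push_cast
    have h3 : 0 < -(⌊z.re⌋ : ℝ) + z.re := by
      have := lt_of_le_of_ne h1 (Ne.symm hne); linarith
    exact ⟨h3, by linarith, by nlinarith⟩
  have := re_smul_ne_zero (g * (ModularGroup.T ^ (-⌊z.re⌋))⁻¹) hmem
  rw [mul_smul, inv_smul_smul] at this
  exact this hg

/-- In suitable modular coordinates an arbitrary cusp chart is affine, `x ↦ A x + B` with `A` a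
positive integer. High up, the edges of the Farey tessellation sit at integers, and the translation
by `8` forces `A ≤ 8`. -/
theorem valence_le {h : ℝ} {c : ℍ → Surface} (hc : IsCusp charts h c) :
    {x ∈ Ico (0 : ℝ) 1 | ∃ a ∈ edges, ∀ᶠ t in atTop, c (verticalLine x t) ∈ a}.encard ≤ (9 : ℕ) := by
  obtain ⟨G, hG⟩ := exists_lift_of_isLocalIsometryOn hc.pos hc.isometry
  have hone : ∀ z : ℍ, h < z.im → unif (G • ((1 : ℝ) +ᵥ z)) = unif (G • z) := by
    intro z hz
    have hz' : h < ((1 : ℝ) +ᵥ z).im := by rwa [vadd_im]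
    rw [← hG _ hz, ← hG _ hz', eq_comm, hc.eq_iff z _ hz hz']
    exact ⟨1, by rw [coe_vadd]; push_cast; ring⟩
  obtain ⟨t, ht⟩ := exists_affine one_pos 1
  have ht' : ∀ x : ℍ, t • x = (1 : ℝ) +ᵥ x := fun x => UpperHalfPlane.ext (by
    rw [ht, coe_vadd]; push_cast; ring)
  have hc1 : Continuous fun x : ℍ => G • ((1 : ℝ) +ᵥ x) := by
    simp only [← ht']
    exact (continuous_const_smul G).comp (continuous_const_smul t)
  let z₀ : ℍ := ⟨⟨0, h + 1⟩, by linarith [hc.pos]⟩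
  have hz₀ : h < z₀.im := by change h < h + 1; linarith
  obtain ⟨k, hk, hk0⟩ := unif_eq_iff.1 (hone z₀ hz₀).symm
  have hc2 : Continuous fun x : ℍ => k • G • x :=
    (continuous_smul_int k).comp (continuous_const_smul G)
  have heq : EqOn (fun x : ℍ => G • ((1 : ℝ) +ᵥ x)) (fun x => k • G • x) {z : ℍ | h < z.im} :=
    isCoveringMap_unif.eqOn_of_comp_eqOn (isPreconnected_lt_im h) hc1.continuousOn
      hc2.continuousOn (fun z hz => (hone z hz).trans (hk _).symm) hz₀ hk0.symm
  have hconj : ∀ x : ℍ, G • ((1 : ℝ) +ᵥ x) = k • G • x := by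
    have hev : ∀ᶠ x in 𝓝 z₀, G • ((1 : ℝ) +ᵥ x) = k • G • x :=
      eventually_of_mem ((isOpen_lt continuous_const continuous_im).mem_nhds hz₀) heq
    obtain ⟨w, hne, hw⟩ := exists_ne_of_eventually hev
    have hsl : ∀ x : ℍ, (G * t) • x = (toReal k * G) • x ↔ G • ((1 : ℝ) +ᵥ x) = k • G • x :=
      fun x => by rw [mul_smul, mul_smul, ht', toReal_smul]
    exact fun x => (hsl x).1 (sl_smul_eq_of_two_points hne ((hsl _).2 hev.self_of_nhds)
      ((hsl _).2 hw) x)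
  obtain ⟨s, A, B, hA, hs⟩ := exists_affine_of_conj hconj
  have hA0 : (0 : ℝ) < A := by exact_mod_cast hA
  obtain ⟨a, ha⟩ := exists_affine hA0 B
  have hs' : ∀ x : ℍ, G • x = s • a • x := fun x => hs x _ (by rw [ha]; push_cast; ring)
  have hA8 : (A : ℝ) ≤ 8 := by
    have h1 := unif_smul_eight_vadd s (a • z₀)
    have h2 : (8 : ℝ) +ᵥ a • z₀ = a • ((8 / A : ℝ) +ᵥ z₀) := UpperHalfPlane.ext (by
      have : (A : ℂ) ≠ 0 := by exact_mod_cast hA0.ne'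
      rw [ha, coe_vadd, coe_vadd, ha]
      push_cast
      field_simp
      ring)
    rw [h2, ← hs', ← hs', ← hG _ hz₀, ← hG _ (by rwa [vadd_im]), eq_comm,
      hc.eq_iff _ _ hz₀ (by rwa [vadd_im])] at h1
    obtain ⟨n, hn⟩ := h1
    rw [coe_vadd, add_comm] at hn
    have hn : (8 / A : ℝ) = n := by exact_mod_cast add_left_cancel hn
    have hn0 : 0 < n := by
      have : (0 : ℝ) < n := by rw [← hn]; positivity
      exact_mod_cast this
    have hn1 : (1 : ℝ) ≤ n := by exact_mod_cast hn0
    rw [← hn, le_div_iff₀ hA0] at hn1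
    linarith
  have hint : ∀ x ∈ {x ∈ Ico (0 : ℝ) 1 | ∃ a ∈ edges, ∀ᶠ t in atTop, c (verticalLine x t) ∈ a},
      ∃ n : ℤ, A * x + B = n := by
    rintro x ⟨-, e, he, hev⟩
    have h1 : ∀ᶠ t : ℝ in atTop, max h 1 < Real.exp t :=
      Real.tendsto_exp_atTop.eventually (eventually_gt_atTop _)
    obtain ⟨t, ht, ht'⟩ := (hev.and h1).exists
    have hh : h < (verticalLine x t).im := (le_max_left _ _).trans_lt ht'
    rw [hG _ hh, hs'] at ht
    obtain ⟨g, hg⟩ := unif_mem_sUnion_edges.1 ⟨e, he, ht⟩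
    rw [← mul_smul] at hg
    have him : (a • verticalLine x t).im = A * Real.exp t := by
      rw [← coe_im, ha]; simp [verticalLine]
    have hre : (a • verticalLine x t).re = A * x + B := by
      rw [← coe_re, ha]; simp [verticalLine]
    rw [← hre]
    refine exists_int_of_re_smul_eq_zero ?_ hg
    have h3 : 1 < Real.exp t := (le_max_right _ _).trans_lt ht'
    have h4 : (1 : ℝ) ≤ A := by exact_mod_cast hA
    rw [him]
    nlinarith
  -- The values `A x + B` fill an interval of length at most eight starting at `B`; the integers in
  -- it have offsets from `⌊B⌋` between `0` and `8`.
  have hcard : (↑(Finset.Icc (0 : ℤ) 8) : Set ℤ).encard = (9 : ℕ) := by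
    rw [Set.encard_coe_eq_coe_finsetCard]; rfl
  rw [← hcard]
  refine encard_le_encard_of_injOn (f := fun x => ⌊A * x + B⌋ - ⌊B⌋) ?_ ?_
  · intro x hx
    obtain ⟨n, hn⟩ := hint x hx
    obtain ⟨⟨hx0, hx1⟩, -⟩ := hx
    simp only [Finset.coe_Icc, mem_Icc]
    rw [hn, Int.floor_intCast]
    have h1 := Int.floor_le B
    have h2 := Int.lt_floor_add_one B
    constructor
    · have : ((-1 : ℤ) : ℝ) < (n - ⌊B⌋ : ℤ) := by
        push_cast; rw [← hn]; nlinarith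
      have : -1 < n - ⌊B⌋ := by exact_mod_cast this
      omega
    · have : ((n - ⌊B⌋ : ℤ) : ℝ) < (9 : ℤ) := by
        push_cast; rw [← hn]; nlinarith
      have : n - ⌊B⌋ < 9 := by exact_mod_cast this
      omega
  · intro x hx y hy e
    obtain ⟨n, hn⟩ := hint x hx
    obtain ⟨m, hm⟩ := hint y hy
    simp only [hn, hm, Int.floor_intCast] at e
    have e : n = m := by omega
    rw [e, ← hm] at hn
    exact mul_left_cancel₀ hA0.ne' (by linarith)

theorem isBoundedTriangulation_edges : IsBoundedTriangulation charts edges where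
  triangulation := isIdealTriangulation_edges
  ends := by
    rintro _ ⟨g, rfl⟩
    exact ⟨_, isGeodesic_unif_smul g, injective_unif_smul_verticalLine g,
      range_unif_smul_verticalLine g, endsAtPuncture_unif_smul g, endsAtPuncture_unif_smul_neg g⟩
  valence := ⟨9, fun _ _ hc => valence_le hc⟩
  shears := ⟨0, fun _ ha => ⟨0, hasShear_zero ha, by simp⟩⟩

/-! ### Parabolicity: minimum principles -/

/-- A minimum principle for functions on a domain with empty or controlled boundary at infinity:
values below `a` are dominated by values on a compact set. -/
theorem le_of_minimum_principle {X : Type*} [TopologicalSpace X] [ConnectedSpace X] {D : Set X}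
    (hD : IsOpen D) (hne : D ≠ univ) {w : X → ℝ} (hw : ContinuousOn w D) {a : ℝ}
    (hbd : ∀ x, x ∉ D → ∀ᶠ y in 𝓝 x, y ∈ D → a ≤ w y)
    {C : Set X} (hC : IsCompact C) (hCw : ∀ p ∈ D, w p < a → ∃ q ∈ C, q ∈ D ∧ w q ≤ w p)
    (hmin : ∀ p ∈ D, (∀ᶠ y in 𝓝 p, w p ≤ w y) → ∀ᶠ y in 𝓝 p, w y = w p) :
    ∀ p ∈ D, a ≤ w p := by
  by_contra! hcon
  obtain ⟨p, hp, hpa⟩ := hcon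
  -- `V` contains the complement of `D` by the boundary hypothesis, so what is left of `C` outside
  -- `V` is a compact part of `D`.
  set V : Set X := {x | ∀ᶠ y in 𝓝 x, y ∈ D → a ≤ w y} with hV
  have hVo : IsOpen V := isOpen_setOfPred_eventually_nhds
  have hVD : ∀ x ∈ D, x ∈ V → a ≤ w x := fun x hx hxV => (Eventually.self_of_nhds hxV) hx
  have hKD : C \ V ⊆ D := fun x hx => by_contra fun h => hx.2 (hbd x h)
  obtain ⟨q, hqC, hqD, hqw⟩ := hCw p hp hpa
  have hqK : q ∈ C \ V := ⟨hqC, fun h => absurd (hVD q hqD h) (by linarith)⟩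
  obtain ⟨q0, hq0, hq0min⟩ := (hC.diff hVo).exists_isMinOn ⟨q, hqK⟩ (hw.mono hKD)
  have hq0a : w q0 < a := (hq0min hqK).trans_lt (by linarith)
  have hall : ∀ y ∈ D, w q0 ≤ w y := by
    intro y hy
    rcases le_or_gt a (w y) with h | h
    · linarith
    · obtain ⟨q', h1, h2, h3⟩ := hCw y hy h
      exact (hq0min (a := q') ⟨h1, fun h4 => absurd (hVD q' h2 h4) (by linarith)⟩).trans h3
  -- The minimum set is open by the local hypothesis `hmin`, and closed in the whole space because
  -- `w ≥ a` near the boundary. By connectedness it would be everything, although `D` is not.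
  set Z : Set X := {x | x ∈ D ∧ w x = w q0} with hZ
  have hZo : IsOpen Z := by
    rw [isOpen_iff_mem_nhds]
    rintro x ⟨hx, hxw⟩
    filter_upwards [hD.mem_nhds hx, hmin x hx (by
      filter_upwards [hD.mem_nhds hx] with y hy
      rw [hxw]; exact hall y hy)] with y hy hyw
    exact ⟨hy, hyw.trans hxw⟩
  have hZc : IsClosed Z := by
    rw [← isOpen_compl_iff, isOpen_iff_mem_nhds]
    intro x hx
    by_cases hxD : x ∈ D
    · have h1 : w x ≠ w q0 := fun h => hx ⟨hxD, h⟩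
      filter_upwards [(hw.continuousAt (hD.mem_nhds hxD)).eventually_ne h1] with y hy h2
      exact hy h2.2
    · filter_upwards [hbd x hxD] with y hy h2
      have := hy h2.1
      rw [h2.2] at this
      linarith
  rcases isClopen_iff.1 ⟨hZc, hZo⟩ with h | h
  · exact (h ▸ (⟨hKD hq0, rfl⟩ : q0 ∈ Z) : q0 ∈ (∅ : Set X))
  · exact hne (eq_univ_of_forall fun x => ((h ▸ mem_univ x : x ∈ Z)).1)

/-- Locally `f` is the real part of a holomorphic `F`, and the maximum modulus principle applies to
`exp (-F)`. -/
theorem eventually_eq_of_harmonicAt_of_isLocalMin {f : ℂ → ℝ} {z : ℂ}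
    (hf : InnerProductSpace.HarmonicAt f z) (hmin : ∀ᶠ y in 𝓝 z, f z ≤ f y) :
    ∀ᶠ y in 𝓝 z, f y = f z := by
  obtain ⟨ε, hε, hball⟩ := Metric.eventually_nhds_iff_ball.1 hf.eventually
  obtain ⟨F, hF, hFf⟩ := InnerProductSpace.HarmonicOnNhd.exists_analyticOnNhd_ball_re_eq
    (f := f) (z := z) (R := ε) (fun x hx => hball x hx)
  have hmem : Metric.ball z ε ∈ 𝓝 z := Metric.ball_mem_nhds z hε
  have hnorm : ∀ x ∈ Metric.ball z ε, ‖Complex.exp (-F x)‖ = Real.exp (-f x) := fun x hx => by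
    rw [Complex.norm_exp, Complex.neg_re, ← hFf hx]
  have := Complex.eventually_eq_of_isLocalMax_norm (f := fun x => Complex.exp (-F x)) (c := z)
    (by
      filter_upwards [hmem] with x hx
      exact ((hF x hx).differentiableAt.neg).cexp)
    (by
      filter_upwards [hmem, hmin] with x hx hx2
      simp only [Function.comp_apply]
      rw [hnorm x hx, hnorm z (Metric.mem_ball_self hε)]
      exact Real.exp_le_exp.2 (by linarith))
  filter_upwards [hmem, this] with x hx hx2
  have h3 := congrArg norm hx2
  rw [hnorm x hx, hnorm z (Metric.mem_ball_self hε)] at h3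
  linarith [Real.exp_injective h3]

/-! ### Harmonic functions on the half-plane and on the surface -/

/-- Harmonicity of a function on the upper half-plane. -/
def HarmonicAtUHP (W : ℍ → ℝ) (z : ℍ) : Prop :=
  InnerProductSpace.HarmonicAt (fun ζ : ℂ => W (ofComplex ζ)) (z : ℂ)

theorem HarmonicAtUHP.continuousAt {W : ℍ → ℝ} {z : ℍ} (h : HarmonicAtUHP W z) :
    ContinuousAt W z := by
  have h1 : ContinuousAt (fun ζ : ℂ => W (ofComplex ζ)) (z : ℂ) := h.1.continuousAt
  have h2 : ContinuousAt (fun w : ℍ => (fun ζ : ℂ => W (ofComplex ζ)) (w : ℂ)) z :=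
    ContinuousAt.comp (f := fun w : ℍ => (w : ℂ)) h1 continuous_coe.continuousAt
  simpa [ofComplex_apply] using h2

theorem HarmonicAtUHP.eventually_eq {W : ℍ → ℝ} {z : ℍ} (h : HarmonicAtUHP W z)
    (hmin : ∀ᶠ y in 𝓝 z, W z ≤ W y) : ∀ᶠ y in 𝓝 z, W y = W z := by
  have h1 := eventually_eq_of_harmonicAt_of_isLocalMin h (by
    rw [← isOpenEmbedding_coe.map_nhds_eq z, eventually_map]
    simpa [ofComplex_apply] using hmin)
  rw [← isOpenEmbedding_coe.map_nhds_eq z, eventually_map] at h1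
  simpa [ofComplex_apply] using h1

theorem HarmonicAtUHP.add_const_mul {W V : ℍ → ℝ} {z : ℍ} (h : HarmonicAtUHP W z)
    (h' : HarmonicAtUHP V z) (c : ℝ) : HarmonicAtUHP (fun z => W z + c * V z) z :=
  InnerProductSpace.HarmonicAt.add h (InnerProductSpace.HarmonicAt.const_smul h')

theorem harmonicAtUHP_im (z : ℍ) : HarmonicAtUHP UpperHalfPlane.im z := by
  have h1 : InnerProductSpace.HarmonicAt (fun ζ : ℂ => ζ.im) (z : ℂ) :=
    analyticAt_id.harmonicAt_im
  refine (InnerProductSpace.harmonicAt_congr_nhds ?_).1 h1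
  filter_upwards [(isOpen_lt continuous_const Complex.continuous_im).mem_nhds
    (show 0 < (z : ℂ).im from z.im_pos)] with ζ hζ
  rw [ofComplex_apply_of_im_pos hζ]
  rfl

theorem isCompact_re_im_box (a b : ℝ) {c d : ℝ} (hc : 0 < c) :
    IsCompact {z : ℍ | z.re ∈ Icc a b ∧ z.im ∈ Icc c d} := by
  rw [isOpenEmbedding_coe.isEmbedding.isCompact_iff]
  convert (isCompact_Icc (a := a) (b := b)).reProdIm (isCompact_Icc (a := c) (b := d)) using 1
  ext ζ
  constructor
  · rintro ⟨z, hz, rfl⟩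
    exact hz
  · intro h
    have h0 : 0 < ζ.im := hc.trans_le h.2.1
    exact ⟨⟨ζ, h0⟩, h, rfl⟩

/-- A nonnegative harmonic function on a cusp is bounded below by its values on a horocycle. -/
theorem exists_le_on_horocycle {W : ℍ → ℝ} {H h T : ℝ} (hH : 0 < H) (hh : H < h) (hT : 0 < T)
    (hper : ∀ z : ℍ, W (T +ᵥ z) = W z) (hW : ∀ z : ℍ, H < z.im → HarmonicAtUHP W z)
    (hpos : ∀ z : ℍ, H < z.im → 0 ≤ W z) {z : ℍ} (hz : h < z.im) :
    ∃ z' : ℍ, z'.im = h ∧ W z' ≤ W z := by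
  have h0 : 0 < h := hH.trans hh
  have hperz : ∀ z : ℍ, ∃ z' : ℍ, z'.re ∈ Icc 0 T ∧ z'.im = z.im ∧ W z' = W z := by
    have hz : ∀ (n : ℤ) (z : ℍ), W ((n * T : ℝ) +ᵥ z) = W z := by
      intro n
      induction n using Int.induction_on with
      | zero => intro z; simp
      | succ n ih =>
        intro z
        rw [← ih z, ← hper ((((n : ℤ) : ℝ) * T) +ᵥ z), vadd_vadd]
        congr 2; push_cast; ring
      | pred n ih =>
        intro z
        rw [← ih z, ← hper ((((-(n : ℤ) - 1 : ℤ) : ℝ) * T) +ᵥ z), vadd_vadd]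
        congr 2; push_cast; ring
    intro z
    refine ⟨(((-⌊z.re / T⌋ : ℤ) : ℝ) * T) +ᵥ z, ?_, by simp, hz _ _⟩
    have e1 := Int.floor_le (z.re / T)
    have e2 := Int.lt_floor_add_one (z.re / T)
    rw [le_div_iff₀ hT] at e1
    rw [div_lt_iff₀ hT] at e2
    rw [vadd_re]
    push_cast
    constructor <;> nlinarith
  obtain ⟨z0, hz0, hz0min⟩ := (isCompact_re_im_box 0 T (c := h) (d := h) h0).exists_isMinOn
    ⟨⟨⟨0, h⟩, h0⟩, ⟨left_mem_Icc.2 hT.le, left_mem_Icc.2 le_rfl⟩⟩ (f := W) (by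
      intro x hx
      have : x.im = h := le_antisymm hx.2.2 hx.2.1
      exact (hW x (by linarith)).continuousAt.continuousWithinAt)
  have hline : ∀ x : ℍ, x.im = h → W z0 ≤ W x := by
    intro x hx
    obtain ⟨x', h1, h2, h3⟩ := hperz x
    rw [← h3]
    exact hz0min ⟨h1, by rw [h2, hx]; exact ⟨le_rfl, le_rfl⟩⟩
  refine ⟨z0, le_antisymm hz0.2.2 hz0.2.1, ?_⟩
  -- The term `ε im` is a barrier at the cusp: the sum can be below `W z0` only at heights below `W
  -- z0 / ε`, which modulo the period is a compact box.
  have key : ∀ ε > 0, ∀ δ > 0, ∀ p ∈ {p : ℍ | h < p.im}, W z0 - δ ≤ W p + ε * p.im := by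
    intro ε hε δ hδ
    refine le_of_minimum_principle (w := fun p : ℍ => W p + ε * p.im)
      (isOpen_lt continuous_const continuous_im) ?_ ?_ ?_
      (isCompact_re_im_box 0 T (c := h) (d := W z0 / ε) h0) ?_ ?_
    · intro he
      have : z0 ∈ {p : ℍ | h < p.im} := he ▸ mem_univ z0
      exact absurd hz0.2.2 (not_le.2 this)
    · intro p hp
      exact (((hW p (hh.trans hp)).add_const_mul (harmonicAtUHP_im p) ε).continuousAt
        ).continuousWithinAt
    · intro x hx
      rcases lt_or_eq_of_le (not_lt.1 hx : x.im ≤ h) with h1 | h1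
      · filter_upwards [continuous_im.continuousAt.eventually_lt_const h1] with y hy hy2
        exact absurd hy2 (not_lt.2 hy.le)
      · have h2 := hline x h1
        filter_upwards [(hW x (by linarith)).continuousAt.eventually_const_lt
          (show W z0 - δ < W x by linarith)] with y hy _
        have := mul_pos hε y.im_pos
        linarith
    · intro p hp hlt
      obtain ⟨p', h1, h2, h3⟩ := hperz p
      have h4 : h < p.im := hp
      refine ⟨p', ⟨h1, by rw [h2]; exact h4.le, ?_⟩, ?_, ?_⟩
      · rw [h2, le_div_iff₀ hε]
        have := hpos p (hh.trans h4)
        nlinarith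
      · change h < p'.im
        rw [h2]; exact h4
      · rw [h2, h3]
    · intro p hp hm
      exact ((hW p (hh.trans hp)).add_const_mul (harmonicAtUHP_im p) ε).eventually_eq hm
  refine le_of_forall_pos_le_add fun δ hδ => ?_
  have := key (δ / 2 / z.im) (div_pos (half_pos hδ) z.im_pos) (δ / 2) (half_pos hδ) z hz
  rw [div_mul_cancel₀ _ z.im_pos.ne'] at this
  linarith

theorem HarmonicAtUHP.congr {W V : ℍ → ℝ} {z : ℍ} (h : HarmonicAtUHP W z) (hWV : W =ᶠ[𝓝 z] V) :
    HarmonicAtUHP V z := by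
  refine (InnerProductSpace.harmonicAt_congr_nhds ?_).1 h
  rw [← isOpenEmbedding_coe.map_nhds_eq z, Filter.EventuallyEq, eventually_map]
  simp only [ofComplex_apply]
  exact hWV

theorem HarmonicAtUHP.comp_smul {W : ℍ → ℝ} {g : SL(2, ℝ)} {z : ℍ} (h : HarmonicAtUHP W (g • z)) :
    HarmonicAtUHP (fun w => W (g • w)) z := by
  obtain ⟨ε, hε, hball⟩ := Metric.eventually_nhds_iff_ball.1 (InnerProductSpace.HarmonicAt.eventually h)
  obtain ⟨F, hF, hFf⟩ := InnerProductSpace.HarmonicOnNhd.exists_analyticOnNhd_ball_re_eq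
    (z := ((g • z : ℍ) : ℂ)) (R := ε) (fun x hx => hball x hx)
  have hA : AnalyticAt ℂ (fun ζ : ℂ => ((g • ofComplex ζ : ℍ) : ℂ)) z :=
    UpperHalfPlane.analyticAt_smul (g := (g : GL (Fin 2) ℝ)) (by simp) z
  have hFA : AnalyticAt ℂ (fun ζ : ℂ => F ((g • ofComplex ζ : ℍ) : ℂ)) z := by
    refine AnalyticAt.comp (g := F) ?_ hA
    rw [ofComplex_apply]
    exact hF _ (Metric.mem_ball_self hε)
  refine (InnerProductSpace.harmonicAt_congr_nhds ?_).1 hFA.harmonicAt_re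
  have h2 : ∀ᶠ w in 𝓝 z, ((g • w : ℍ) : ℂ) ∈ Metric.ball ((g • z : ℍ) : ℂ) ε :=
    (continuous_coe.comp (continuous_const_smul g)).continuousAt.eventually
      (Metric.ball_mem_nhds _ hε)
  rw [← isOpenEmbedding_coe.map_nhds_eq z, Filter.EventuallyEq, eventually_map]
  filter_upwards [h2] with w hw
  simpa only [ofComplex_apply] using hFf hw

theorem harmonicAtUHP_proj {u : Surface → ℝ} {z : ℍ}
    (h : HypSurface.HarmonicAt charts u (proj z)) : HarmonicAtUHP (fun w => u (proj w)) z := by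
  obtain ⟨e, he, hz⟩ := exists_chart z
  obtain ⟨k, hk⟩ := exists_smul_eq_chart he hz
  have hu : HarmonicAtUHP (fun w => u (e.symm w)) (k • z) := by
    have := h e he hz
    rwa [hk.self_of_nhds] at this
  refine hu.comp_smul.congr ?_
  filter_upwards [hk, continuous_proj.continuousAt.eventually (e.open_source.mem_nhds hz)]
    with w hw1 hw2
  rw [← hw1, e.left_inv hw2]

theorem continuousAt_of_harmonicAtUHP {w : Surface → ℝ} {z : ℍ}
    (h : HarmonicAtUHP (fun x => w (proj x)) z) : ContinuousAt w (proj z) := by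
  rw [ContinuousAt, ← map_nhds_proj, tendsto_map'_iff]
  exact h.continuousAt

theorem eventually_eq_of_harmonicAtUHP {w : Surface → ℝ} {z : ℍ}
    (h : HarmonicAtUHP (fun x => w (proj x)) z)
    (hmin : ∀ᶠ y in 𝓝 (proj z), w (proj z) ≤ w y) : ∀ᶠ y in 𝓝 (proj z), w y = w (proj z) := by
  rw [← map_nhds_proj, eventually_map] at hmin ⊢
  exact h.eventually_eq hmin

/-- The holomorphic square coordinate on the surface. -/
noncomputable def surfaceCoord (p : Surface) : ℂ := squareCoord (surjective_proj p).choose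

theorem surfaceCoord_proj (z : ℍ) : surfaceCoord (proj z) = squareCoord z := by
  obtain ⟨k, hk, hkz⟩ := proj_eq_iff.1 (surjective_proj (proj z)).choose_spec
  have h := hk.2 (surjective_proj (proj z)).choose
  rw [hkz] at h
  simp only [hCoord, vCoord, neg_inj] at h
  exact (Complex.ext h.1 h.2).symm

theorem harmonicAtUHP_log_surfaceCoord {z : ℍ} (hz : surfaceCoord (proj z) ≠ 0) :
    HarmonicAtUHP (fun w => Real.log ‖surfaceCoord (proj w)‖) z := by
  have hd : AnalyticAt ℂ squareCoord z :=
    DifferentiableOn.analyticAt (s := {ζ : ℂ | 0 < ζ.im})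
      (fun ζ hζ => (differentiableAt_squareCoord hζ).differentiableWithinAt)
      ((isOpen_lt continuous_const Complex.continuous_im).mem_nhds z.im_pos)
  rw [surfaceCoord_proj] at hz
  refine (InnerProductSpace.harmonicAt_congr_nhds ?_).1 (hd.harmonicAt_log_norm hz)
  rw [← isOpenEmbedding_coe.map_nhds_eq z, Filter.EventuallyEq, eventually_map]
  filter_upwards with w
  rw [ofComplex_apply, surfaceCoord_proj]

/-! ### Exhaustion of the surface by polygons in the grid -/

/-- The horizontal position of a point in the grid of rectangles. -/
noncomputable def gridH (p : Surface) : ℝ := (surfaceEmbedding p).1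

/-- The vertical position of a point in the grid of rectangles. -/
noncomputable def gridV (p : Surface) : ℝ := (surfaceEmbedding p).2.1

/-- The imaginary part of a point in its rectangle. -/
noncomputable def height (p : Surface) : ℝ := ((surfaceEmbedding p).2.2 : ℍ).im

/-- The distance from the origin in the grid of rectangles. -/
noncomputable def gridNorm (p : Surface) : ℝ := max |gridH p| |gridV p|

theorem gridH_tile (m n : ℤ) (r : rectangle) :
    gridH (tile m n r) = fold m (sideRatio .left .arcRight r) := rfl

theorem gridV_tile (m n : ℤ) (r : rectangle) :
    gridV (tile m n r) = fold n (sideRatio .right .arcLeft r) := rfl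

theorem height_tile (m n : ℤ) (r : rectangle) : height (tile m n r) = (r : ℍ).im := rfl

theorem continuous_height : Continuous height :=
  continuous_im.comp (continuous_subtype_val.comp
    (continuous_snd.comp (continuous_snd.comp continuous_surfaceEmbedding)))

theorem continuous_gridNorm : Continuous gridNorm :=
  (continuous_fst.comp continuous_surfaceEmbedding).abs.max
    (continuous_fst.comp (continuous_snd.comp continuous_surfaceEmbedding)).abs

theorem abs_fold_le (m : ℤ) {x : ℝ} (h0 : 0 ≤ x) (h1 : x ≤ 1) (y : ℝ) :
    |fold m x| ≤ |fold m y| + (|y| + 1) := by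
  have h : |fold m x - fold m y| = |x - y| := by
    by_cases hm : Even m
    · rw [fold_even hm, fold_even hm]; congr 1; ring
    · rw [fold_odd hm, fold_odd hm, abs_sub_comm x y]; congr 1; ring
  have h2 := abs_sub_abs_le_abs_sub (fold m x) (fold m y)
  have h3 := abs_sub x y
  rw [abs_of_nonneg h0] at h3
  linarith

/-- Grid position and square coordinate both arise by `fold` from functions that are bounded on the
rectangle, so they differ by a bounded amount. -/
theorem exists_gridNorm_le : ∃ C : ℝ, ∀ p, gridNorm p ≤ ‖surfaceCoord p‖ + C := by
  obtain ⟨C, hC⟩ := exists_norm_squareCoord_le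
  refine ⟨C + 1, fun p => ?_⟩
  obtain ⟨z, rfl⟩ := surjective_proj p
  obtain ⟨γ, hγ, m, n, r, hi, rfl⟩ := exists_eq_apply z
  obtain ⟨p1, p2⟩ := sideFun_add_pos r.2
  obtain ⟨a1, b1⟩ := sideRatio_mem_Icc r.2 p1
  obtain ⟨a2, b2⟩ := sideRatio_mem_Icc r.2 p2
  have h0 := hC (r : ℍ) (half_le_im r.2)
  rw [surfaceCoord_proj, proj_apply hγ hi, gridNorm, gridH_tile, gridV_tile]
  refine max_le ((abs_fold_le m a1 b1 (hCoord r)).trans ?_)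
    ((abs_fold_le n a2 b2 (vCoord r)).trans ?_)
  · rw [← (hi r).1, hCoord, hCoord, abs_neg, abs_neg]
    linarith [Complex.abs_re_le_norm (squareCoord (γ r)), Complex.abs_re_le_norm (squareCoord r)]
  · rw [← (hi r).2, vCoord, vCoord]
    linarith [Complex.abs_im_le_norm (squareCoord (γ r)), Complex.abs_im_le_norm (squareCoord r)]

theorem isClosed_rectangle : IsClosed rectangle := by
  have : rectangle = ⋂ s, {z | 0 ≤ sideFun s z} := by
    ext z; simp [mem_rectangle_iff]
  rw [this]
  exact isClosed_iInter fun s => isClosed_le continuous_const (continuous_sideFun s)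

theorem isCompact_gridNorm_le_height_le (L h : ℝ) :
    IsCompact {p | gridNorm p ≤ L ∧ height p ≤ h} := by
  have hr : IsCompact {r : rectangle | (r : ℍ).im ≤ h} := by
    rw [Topology.IsEmbedding.subtypeVal.isCompact_iff]
    refine (isCompact_re_im_box 0 (√2) (c := 1 / 2) (d := h) (by norm_num)).of_isClosed_subset
      ?_ ?_
    · convert isClosed_rectangle.inter (isClosed_le continuous_im (continuous_const (y := h)))
        using 1
      ext z
      simp [and_comm]
    · rintro _ ⟨r, hr, rfl⟩
      exact ⟨⟨r.2.1, r.2.2.1⟩, half_le_im r.2, hr⟩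
  have hu : IsCompact (⋃ q ∈ Icc (-⌈L⌉ - 1) ⌈L⌉ ×ˢ Icc (-⌈L⌉ - 1) ⌈L⌉,
      tile q.1 q.2 '' {r : rectangle | (r : ℍ).im ≤ h}) :=
    ((finite_Icc _ _).prod (finite_Icc _ _)).isCompact_biUnion fun q _ =>
      hr.image (continuous_tile _ _)
  refine hu.of_isClosed_subset ((isClosed_le continuous_gridNorm continuous_const).inter
    (isClosed_le continuous_height continuous_const)) ?_
  rintro ⟨m, n, r⟩ ⟨h1, h2⟩
  change gridNorm (tile m n r) ≤ L at h1
  obtain ⟨p1, p2⟩ := sideFun_add_pos r.2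
  obtain ⟨a1, b1⟩ := sideRatio_mem_Icc r.2 p1
  obtain ⟨a2, b2⟩ := sideRatio_mem_Icc r.2 p2
  have hL := Int.le_ceil L
  have aux : ∀ (m : ℤ) (x : ℝ), 0 ≤ x → x ≤ 1 → |fold m x| ≤ L → m ∈ Icc (-⌈L⌉ - 1) ⌈L⌉ := by
    intro m x a b hx
    have := fold_mem_Icc m a b
    rw [abs_le] at hx
    constructor <;> rify <;> linarith [this.1, this.2]
  refine mem_biUnion (x := (m, n)) ⟨aux m _ a1 b1 ((le_max_left _ _).trans h1),
    aux n _ a2 b2 ((le_max_right _ _).trans h1)⟩ ⟨r, h2, rfl⟩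

theorem eq_one_of_fold_eq_odd {m L : ℤ} (hL : Odd L) {x : ℝ} (h0 : 0 ≤ x) (h1 : x ≤ 1)
    (h : fold m x = L) : x = 1 := by
  by_cases hm : Even m
  · rw [fold_even hm] at h
    have e1 : m ≤ L := by rify; linarith
    have e2 : L ≤ m + 1 := by rify; linarith
    have e3 : L = m + 1 := by
      obtain ⟨a, ha⟩ := hL; obtain ⟨b, hb⟩ := hm; omega
    rw [e3] at h; push_cast at h; linarith
  · rw [fold_odd hm] at h
    have e1 : m ≤ L := by rify; linarith
    have e2 : L ≤ m + 1 := by rify; linarith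
    have e3 : L = m := by
      rw [Int.not_even_iff_odd] at hm
      obtain ⟨a, ha⟩ := hL; obtain ⟨b, hb⟩ := hm; omega
    rw [e3] at h; linarith

/-- The grid lines at odd integers consist of finite sides, which lie below height one; the infinite
sides are on the even lines. This is why the polygons used below have odd size: they are compact. -/
theorem height_le_one_of_gridNorm_eq {L : ℤ} (hL : Odd L) {p : Surface} (h : gridNorm p = L) :
    height p ≤ 1 := by
  obtain ⟨m, n, r⟩ := p
  change gridNorm (tile m n r) = L at h
  change (r : ℍ).im ≤ 1
  obtain ⟨p1, p2⟩ := sideFun_add_pos r.2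
  obtain ⟨a1, b1⟩ := sideRatio_mem_Icc r.2 p1
  obtain ⟨a2, b2⟩ := sideRatio_mem_Icc r.2 p2
  have aux : ∀ (m : ℤ) (x : ℝ), 0 ≤ x → x ≤ 1 → |fold m x| = L → x = 1 := by
    intro m x a b hx
    rcases abs_choice (fold m x) with h | h <;> rw [h] at hx
    · exact eq_one_of_fold_eq_odd hL a b hx
    · exact eq_one_of_fold_eq_odd hL.neg a b (by push_cast; linarith)
  have hr := (r : ℍ).im_pos
  rw [gridNorm, gridH_tile, gridV_tile] at h
  rcases max_choice |fold m (sideRatio .left .arcRight (r : ℍ))|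
    |fold n (sideRatio .right .arcLeft (r : ℍ))| with h' | h' <;> rw [h'] at h
  · have := norm_sub_eq_one_of_sideFun ((sideRatio_eq_one_iff p1).1 (aux m _ a1 b1 h))
    have h2 := norm_coe_sub_sq (r : ℍ) (√2)
    rw [this] at h2
    nlinarith [sq_nonneg ((r : ℍ).re - √2)]
  · have := norm_eq_one_of_sideFun ((sideRatio_eq_one_iff p2).1 (aux n _ a2 b2 h))
    have h2 := norm_coe_sq (r : ℍ)
    rw [this] at h2
    nlinarith [sq_nonneg (r : ℍ).re]

theorem exists_apply_mem_rectangle_im_eq {z : ℍ} (hz : 1 ≤ z.im) :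
    ∃ σ ∈ reflGroup, σ z ∈ rectangle ∧ (σ z).im = z.im := by
  have hs : (0 : ℝ) < √2 := by positivity
  obtain ⟨σ, hσ, hre, him⟩ : ∃ σ ∈ reflGroup, (0 ≤ (σ z).re ∧ (σ z).re ≤ √2) ∧
      (σ z).im = z.im := by
    obtain ⟨τ, hτ, h⟩ := exists_translation (-round (z.re / (2 * √2)))
    have e := abs_sub_round (z.re / (2 * √2))
    rw [abs_le] at e
    have e3 : z.re / (2 * √2) * (2 * √2) = z.re := by field_simp
    have h1 : |(τ z).re| ≤ √2 := by
      rw [(h z).1, abs_le]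
      push_cast
      constructor <;> nlinarith
    rw [abs_le] at h1
    rcases le_total 0 (τ z).re with h0 | h0
    · exact ⟨τ, hτ, ⟨h0, h1.2⟩, (h z).2⟩
    · refine ⟨refl .left * τ, mul_mem (refl_mem _) hτ, ?_, ?_⟩
      · rw [Homeomorph.mul_apply, re_refl_left]
        constructor <;> linarith
      · rw [Homeomorph.mul_apply, im_refl_left, (h z).2]
  refine ⟨σ, hσ, ⟨hre.1, hre.2, ?_, ?_⟩, him⟩
  · have := norm_coe_sq (σ z)
    rw [him] at this
    nlinarith [norm_nonneg (σ z : ℂ), sq_nonneg (σ z).re]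
  · have := norm_coe_sub_sq (σ z) (√2)
    rw [him] at this
    nlinarith [norm_nonneg ((σ z : ℂ) - (√2 : ℝ)), sq_nonneg ((σ z).re - √2)]

/-- Above height one a point can be moved into the rectangle by translations and vertical
reflections alone, which preserve `im`. -/
theorem height_proj_apply {γ : ℍ ≃ₜ ℍ} (hγ : γ ∈ reflGroup) {z : ℍ} (hz : 1 ≤ z.im) :
    height (proj (γ z)) = z.im := by
  obtain ⟨σ, hσ, hr, him⟩ := exists_apply_mem_rectangle_im_eq hz
  have h1 : γ * σ⁻¹ ∈ reflGroup := mul_mem hγ (inv_mem hσ)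
  obtain ⟨m, n, -, hi, -⟩ := exists_isArith h1
  have h2 : γ z = (γ * σ⁻¹) (⟨σ z, hr⟩ : rectangle) := by
    change γ z = (γ * σ⁻¹) (σ z)
    rw [← Homeomorph.mul_apply, inv_mul_cancel_right]
  rw [h2, proj_apply h1 hi, height_tile]
  exact him

theorem isPreconnected_one_lt_im : IsPreconnected {z : ℍ | 1 < z.im} := by
  rw [← isOpenEmbedding_coe.isInducing.isPreconnected_image]
  convert (convex_halfSpace_im_gt 1).isPreconnected using 1
  ext ζ
  constructor
  · rintro ⟨z, hz, rfl⟩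
    exact hz
  · intro h
    exact ⟨⟨ζ, one_pos.trans h⟩, h, rfl⟩

/-- The horoball is connected and cannot cross the polygon `gridNorm = L`, whose height is at most
one. -/
theorem gridNorm_proj_lt {γ : ℍ ≃ₜ ℍ} (hγ : γ ∈ reflGroup) {L : ℤ} (hL : Odd L) {z w : ℍ}
    (hz : 1 < z.im) (hw : 1 < w.im) (h : gridNorm (proj (γ z)) < L) :
    gridNorm (proj (γ w)) < L := by
  by_contra! hcon
  have hc : Continuous fun x => gridNorm (proj (γ x)) :=
    continuous_gridNorm.comp (continuous_proj.comp γ.continuous)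
  obtain ⟨x, hx, hxL⟩ := isPreconnected_one_lt_im.intermediate_value hz hw hc.continuousOn
    ⟨h.le, hcon⟩
  have h1 := height_le_one_of_gridNorm_eq hL hxL
  have h2 : 1 < x.im := hx
  rw [height_proj_apply hγ h2.le] at h1
  linarith

/-- Pulling back harmonic functions is done with holomorphic lifts. If the tile is placed with
reversed orientation, the reflection in the left side, which keeps heights, is inserted. -/
theorem exists_cusp_lift {p : Surface} (hp : 1 < height p) :
    ∃ σ ∈ reflGroup, ∃ g : SL(2, ℝ), (∀ w : ℍ, σ w = g • w) ∧
      ∃ z : ℍ, proj (σ z) = p ∧ z.im = height p := by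
  obtain ⟨m, n, r⟩ := p
  obtain ⟨γ, hγ, hi⟩ := exists_isIndex m n
  obtain ⟨M, hM, hdet, -⟩ := exists_matrix hγ hi
  by_cases hmn : Even (m + n)
  · obtain ⟨g, hg⟩ := exists_specialLinear_smul_eq (hdet.2 hmn)
    exact ⟨γ, hγ, g, fun w => by rw [hM, hg], r, proj_apply hγ hi r, rfl⟩
  · have hi' := hi.mul_refl .left
    obtain ⟨M', hM', hdet', -⟩ := exists_matrix (mul_mem hγ (refl_mem .left)) hi'
    obtain ⟨g, hg⟩ := exists_specialLinear_smul_eq (hdet'.2 (by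
      simp only [neighbour]
      split_ifs <;> rw [Int.not_even_iff_odd] at hmn <;> obtain ⟨a, ha⟩ := hmn
      · exact ⟨a, by omega⟩
      · exact ⟨a + 1, by omega⟩))
    refine ⟨γ * refl .left, mul_mem hγ (refl_mem _), g, fun w => by rw [hM', hg], refl .left r, ?_,
      im_refl_left _⟩
    rw [Homeomorph.mul_apply, refl_refl]
    exact proj_apply hγ hi r

theorem proj_apply_vadd {γ : ℍ ≃ₜ ℍ} (hγ : γ ∈ reflGroup) (z : ℍ) :
    proj (γ ((4 * √2 : ℝ) +ᵥ z)) = proj (γ z) := by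
  obtain ⟨k, hk, hkz⟩ := exists_deck_translation 1
  have h := conj_mem_deckGroup (inv_mem hγ) hk
  refine (proj_eq_iff.2 ⟨_, h, ?_⟩).symm
  have e : k z = (4 * √2 : ℝ) +ᵥ z := by
    ext; rw [hkz, coe_vadd]; push_cast; ring
  rw [← e, ← Homeomorph.mul_apply, inv_mul_cancel_right, inv_inv, Homeomorph.mul_apply]

/-- The horocycle estimate is transported to an arbitrary cusp; `hinv` keeps the whole cusp in `E`,
and the deck translation provides the period. -/
theorem exists_le_of_lt_height {E : Set Surface}
    (hinv : ∀ γ ∈ reflGroup, ∀ z w : ℍ, 1 < z.im → 1 < w.im → proj (γ z) ∈ E → proj (γ w) ∈ E)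
    {w : Surface → ℝ} {H h : ℝ} (hH : 1 ≤ H) (hh : H < h)
    (hw : ∀ z, proj z ∈ E → H < height (proj z) → HarmonicAtUHP (fun x => w (proj x)) z)
    (hpos : ∀ q ∈ E, H < height q → 0 ≤ w q) {p : Surface} (hpE : p ∈ E) (hp : h < height p) :
    ∃ q ∈ E, height q = h ∧ w q ≤ w p := by
  obtain ⟨σ, hσ, g, hg, z, rfl, hz⟩ := exists_cusp_lift (p := p) (by linarith)
  have hE : ∀ x : ℍ, H < x.im → proj (σ x) ∈ E := fun x hx =>
    hinv σ hσ z x (by linarith) (by linarith) hpE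
  have hht : ∀ x : ℍ, H < x.im → H < height (proj (σ x)) := fun x hx => by
    rwa [height_proj_apply hσ (by linarith)]
  obtain ⟨z', h1, h2⟩ := exists_le_on_horocycle (W := fun x => w (proj (σ x))) (H := H) (h := h)
    (T := 4 * √2) (by linarith) hh (by positivity) (fun x => by rw [proj_apply_vadd hσ])
    (fun x hx => by
      have := hw (σ x) (hE x hx) (hht x hx)
      simp only [hg] at this ⊢
      exact this.comp_smul)
    (fun x hx => hpos _ (hE x hx) (hht x hx)) (z := z) (by linarith)
  exact ⟨proj (σ z'), hE z' (by linarith), by rw [height_proj_apply hσ (by linarith), h1], h2⟩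

/-- The minimum principle on a domain bounded by a polygon in the grid of rectangles, punctured
at `p₀`. -/
theorem le_of_harmonic_of_boundary {E : Set Surface} (hE : IsOpen E)
    (hinv : ∀ γ ∈ reflGroup, ∀ z w : ℍ, 1 < z.im → 1 < w.im → proj (γ z) ∈ E → proj (γ w) ∈ E)
    {p₀ : Surface} {w : Surface → ℝ} {a L : ℝ}
    (hw : ∀ z, proj z ∈ E → proj z ≠ p₀ → HarmonicAtUHP (fun x => w (proj x)) z)
    (hpos : ∀ q ∈ E, q ≠ p₀ → 0 ≤ w q)
    (hbd : ∀ x, x ∉ E ∨ x = p₀ → ∀ᶠ y in 𝓝 x, y ∈ E → y ≠ p₀ → a ≤ w y)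
    (hL : ∀ p ∈ E, p ≠ p₀ → w p < a → gridNorm p ≤ L) {p : Surface} (hp : p ∈ E) (hp0 : p ≠ p₀) :
    a ≤ w p := by
  -- Above this height the cusps do not contain `p₀`.
  set H : ℝ := max 1 (height p₀)
  have hne : ∀ q, H < height q → q ≠ p₀ := fun q hq h => by
    rw [h] at hq; exact absurd (le_max_right 1 (height p₀)) (not_le.2 hq)
  refine le_of_minimum_principle (D := E ∩ {p₀}ᶜ) (hE.inter isOpen_compl_singleton)
    (fun h => (h ▸ mem_univ p₀ : p₀ ∈ E ∩ {p₀}ᶜ).2 rfl) (w := w) ?_ ?_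
    (isCompact_gridNorm_le_height_le L (H + 1)) ?_ ?_ p ⟨hp, hp0⟩
  · intro q hq
    obtain ⟨z, rfl⟩ := surjective_proj q
    exact (continuousAt_of_harmonicAtUHP (hw z hq.1 hq.2)).continuousWithinAt
  · intro x hx
    filter_upwards [hbd x (by
      by_contra! h
      exact hx ⟨h.1, h.2⟩)] with y hy hy2
    exact hy hy2.1 hy2.2
  · intro q hq hqa
    rcases le_or_gt (height q) (H + 1) with h | h
    · exact ⟨q, ⟨hL q hq.1 hq.2 hqa, h⟩, hq, le_rfl⟩
    · obtain ⟨q', h1, h2, h3⟩ := exists_le_of_lt_height hinv (le_max_left 1 (height p₀))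
        (lt_add_one H) (fun z hz hz2 => hw z hz (hne _ hz2)) (fun q hq h => hpos q hq (hne _ h))
        hq.1 h
      have h4 := hne q' (by rw [h2]; exact lt_add_one H)
      exact ⟨q', ⟨hL q' h1 h4 (by linarith), h2.le⟩, ⟨h1, h4⟩, h3⟩
  · intro q hq hm
    obtain ⟨z, rfl⟩ := surjective_proj q
    exact eventually_eq_of_harmonicAtUHP (hw z hq.1 hq.2) hm

/-- Only the lower half of the comparison with the logarithm enters, together with positivity. -/
theorem tendsto_atTop_of_pole {p₀ : Surface} {u : Surface → ℝ}
    (hu : HypSurface.IsPositiveHarmonicWithLogPole charts p₀ u) :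
    Tendsto u (𝓝[≠] p₀) atTop := by
  obtain ⟨z, rfl⟩ := surjective_proj p₀
  obtain ⟨e, he, hz⟩ := exists_chart z
  obtain ⟨c, hc, hbound⟩ := (hu.pole e he hz).2.exists_pos
  have hlim : Tendsto (fun p => ‖((e p : ℍ) : ℂ) - ((e (proj z) : ℍ) : ℂ)‖) (𝓝[≠] (proj z))
      (𝓝[>] 0) := by
    rw [tendsto_nhdsWithin_iff]
    constructor
    · have h1 : ContinuousAt (fun p => ‖((e p : ℍ) : ℂ) - ((e (proj z) : ℍ) : ℂ)‖) (proj z) :=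
        ((continuous_coe.continuousAt.comp (e.continuousAt hz)).sub continuousAt_const).norm
      have h2 := h1.tendsto
      simp only [sub_self, norm_zero] at h2
      exact h2.mono_left nhdsWithin_le_nhds
    · filter_upwards [self_mem_nhdsWithin,
        mem_nhdsWithin_of_mem_nhds (e.open_source.mem_nhds hz)] with p hp hp2
      refine norm_pos_iff.2 (sub_ne_zero.2 fun h => hp ?_)
      exact e.injOn hp2 hz (UpperHalfPlane.ext h)
  have hlog : Tendsto (fun p => c⁻¹ * Real.log (1 / ‖((e p : ℍ) : ℂ) - ((e (proj z) : ℍ) : ℂ)‖))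
      (𝓝[≠] (proj z)) atTop := by
    simp only [one_div]
    exact (Real.tendsto_log_atTop.comp (tendsto_inv_nhdsGT_zero.comp hlim)).const_mul_atTop
      (inv_pos.2 hc)
  refine tendsto_atTop_mono' _ ?_ hlog
  filter_upwards [hbound.bound, self_mem_nhdsWithin] with p hp hp2
  rw [Real.norm_of_nonneg (hu.pos p hp2).le] at hp
  rw [inv_mul_le_iff₀ hc]
  exact (le_abs_self _).trans hp

theorem exists_gridNorm_eq {L : ℤ} {p₀ : Surface} (h : gridNorm p₀ ≤ L) :
    ∃ p, gridNorm p = L := by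
  obtain ⟨γ, -, hr⟩ := exists_apply_mem_rectangle UpperHalfPlane.I
  let r : rectangle := ⟨γ UpperHalfPlane.I, hr⟩
  refine mem_range_of_exists_le_of_exists_ge continuous_gridNorm ⟨p₀, h⟩ ⟨tile L 0 r, ?_⟩
  obtain ⟨p1, -⟩ := sideFun_add_pos r.2
  obtain ⟨a1, b1⟩ := sideRatio_mem_Icc r.2 p1
  exact (fold_mem_Icc L a1 b1).1.trans ((le_abs_self _).trans (le_max_left _ _))

/-- The minimum of `u` over a compact polygon `gridNorm = L` is a global one: inside, the pole only
helps; outside, `ε log ‖surfaceCoord‖` is a positive harmonic barrier that tends to infinity with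
the grid norm. By the strong minimum principle `u` would be constant, against the pole. -/
theorem isParabolic_charts : HypSurface.IsParabolic charts := by
  rintro ⟨p₀, u, hu⟩
  have hharm : ∀ z, proj z ≠ p₀ → HarmonicAtUHP (fun x => u (proj x)) z := fun z hz =>
    harmonicAtUHP_proj (hu.harmonic _ hz)
  have hcont : ∀ q, q ≠ p₀ → ContinuousAt u q := fun q hq => by
    obtain ⟨z, rfl⟩ := surjective_proj q
    exact continuousAt_of_harmonicAtUHP (hharm z hq)
  have hpole : ∀ b, ∀ᶠ y in 𝓝 p₀, y ≠ p₀ → b ≤ u y := fun b =>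
    eventually_nhdsWithin_iff.1 ((tendsto_atTop_of_pole hu).eventually_ge_atTop b)
  obtain ⟨C, hC⟩ := exists_gridNorm_le
  -- Oddness makes the polygon compact, and `L > C + 1` makes the coordinate exceed one in modulus
  -- outside, so that its logarithm is positive.
  obtain ⟨L, hLodd, hLC, hLp⟩ : ∃ L : ℤ, Odd L ∧ C + 1 < L ∧ gridNorm p₀ < L := by
    refine ⟨2 * max ⌈C + 1⌉ (max ⌈gridNorm p₀⌉ 0) + 1, ⟨_, rfl⟩, ?_, ?_⟩ <;> push_cast
    · have h1 := Int.le_ceil (C + 1)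
      have h2 := le_max_left (⌈C + 1⌉ : ℝ) (max (⌈gridNorm p₀⌉ : ℝ) 0)
      have h3 := (le_max_right (⌈gridNorm p₀⌉ : ℝ) 0).trans (le_max_right (⌈C + 1⌉ : ℝ) _)
      linarith
    · have h1 := Int.le_ceil (gridNorm p₀)
      have h2 := (le_max_left (⌈gridNorm p₀⌉ : ℝ) 0).trans (le_max_right (⌈C + 1⌉ : ℝ) _)
      have h3 := (le_max_right (⌈gridNorm p₀⌉ : ℝ) 0).trans (le_max_right (⌈C + 1⌉ : ℝ) _)
      linarith
  have hS : IsCompact {p | gridNorm p = L} :=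
    (isCompact_gridNorm_le_height_le L 1).of_isClosed_subset
      (isClosed_eq continuous_gridNorm continuous_const)
      fun p hp => ⟨le_of_eq hp, height_le_one_of_gridNorm_eq hLodd hp⟩
  have hS0 : ∀ p, gridNorm p = L → p ≠ p₀ := fun p hp h => by
    rw [h] at hp; linarith
  obtain ⟨q₀, hq₀, hmin⟩ := hS.exists_isMinOn (exists_gridNorm_eq hLp.le) (f := u)
    fun p hp => (hcont p (hS0 p hp)).continuousWithinAt
  have hlt : ∀ γ ∈ reflGroup, ∀ z w : ℍ, 1 < z.im → 1 < w.im → gridNorm (proj (γ z)) < L →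
      gridNorm (proj (γ w)) < L := fun γ hγ z w hz hw => gridNorm_proj_lt hγ hLodd hz hw
  have hgt : ∀ γ ∈ reflGroup, ∀ z w : ℍ, 1 < z.im → 1 < w.im → L < gridNorm (proj (γ z)) →
      L < gridNorm (proj (γ w)) := by
    intro γ hγ z w hz hw h
    rcases lt_trichotomy (gridNorm (proj (γ w))) L with h1 | h1 | h1
    · exact absurd (hlt γ hγ w z hw hz h1) h.not_gt
    · have := height_le_one_of_gridNorm_eq hLodd h1
      rw [height_proj_apply hγ hw.le] at this
      linarith
    · exact h1
  have hnear : ∀ δ > 0, ∀ x, gridNorm x = L → ∀ᶠ y in 𝓝 x, u q₀ - δ ≤ u y := by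
    intro δ hδ x hx
    have h1 : u q₀ ≤ u x := hmin hx
    filter_upwards [(hcont x (hS0 x hx)).eventually_const_lt
      (show u q₀ - δ < u x by linarith)] with y hy
    exact hy.le
  have hnorm : ∀ q, L < gridNorm q → 1 < ‖surfaceCoord q‖ := fun q hq => by
    linarith [hC q]
  have houter : ∀ p, L < gridNorm p → u q₀ ≤ u p := by
    intro p hp
    have hne : ∀ q, L < gridNorm q → q ≠ p₀ := fun q hq h => by
      rw [h] at hq; linarith
    have hl := Real.log_pos (hnorm p hp)
    refine le_of_forall_pos_le_add fun δ hδ => ?_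
    -- The barrier then costs exactly `δ / 2` at `p`. Where the sum is below `u q₀`, the coordinate
    -- is at most `exp (u q₀ / ε)` in modulus, which bounds the grid norm.
    set ε : ℝ := δ / 2 / Real.log ‖surfaceCoord p‖ with hε
    have hε0 : 0 < ε := by positivity
    have key := le_of_harmonic_of_boundary (E := {p | L < gridNorm p})
      (isOpen_lt continuous_const continuous_gridNorm) hgt (p₀ := p₀)
      (w := fun q => u q + ε * Real.log ‖surfaceCoord q‖) (a := u q₀ - δ / 2)
      (L := Real.exp (u q₀ / ε) + C)
      (fun z hz hz0 => (hharm z hz0).add_const_mul (harmonicAtUHP_log_surfaceCoord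
        (norm_pos_iff.1 (one_pos.trans (hnorm _ hz)))) ε)
      (fun q hq hq0 => by
        have := hu.pos q hq0
        have := Real.log_pos (hnorm q hq)
        positivity)
      (fun x hx => by
        have hx' : gridNorm x ≤ L := by
          rcases hx with hx | rfl
          · exact not_lt.1 hx
          · exact hLp.le
        rcases hx'.lt_or_eq with h | h
        · filter_upwards [continuous_gridNorm.continuousAt.eventually_lt_const h] with y hy hy2
          exact absurd hy2 (not_lt.2 hy.le)
        · filter_upwards [hnear (δ / 2) (half_pos hδ) x h] with y hy hy2 _
          have := mul_pos hε0 (Real.log_pos (hnorm y hy2))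
          linarith)
      (fun q hq hq0 hlt' => by
        have h1 := hu.pos q hq0
        have h2 := hnorm q hq
        have h3 : Real.log ‖surfaceCoord q‖ ≤ u q₀ / ε := by
          rw [le_div_iff₀ hε0]; linarith
        rw [Real.log_le_iff_le_exp (by linarith)] at h3
        linarith [hC q])
      hp (hne p hp)
    rw [hε, div_mul_cancel₀ _ hl.ne'] at key
    linarith
  have hinner : ∀ p, gridNorm p < L → p ≠ p₀ → u q₀ ≤ u p := by
    intro p hp hp0
    refine le_of_forall_pos_le_add fun δ hδ => ?_
    have key := le_of_harmonic_of_boundary (E := {p | gridNorm p < L})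
      (isOpen_lt continuous_gridNorm continuous_const) hlt (p₀ := p₀)
      (w := u) (a := u q₀ - δ) (L := L) (fun z _ => hharm z) (fun q _ h => (hu.pos q h).le)
      (fun x hx => by
        by_cases hx0 : x = p₀
        · rw [hx0]
          filter_upwards [hpole (u q₀ - δ)] with y hy _
          exact hy
        have hx' : L ≤ gridNorm x := not_lt.1 (hx.resolve_right hx0)
        rcases hx'.lt_or_eq with h | h
        · filter_upwards [continuous_gridNorm.continuousAt.eventually_const_lt h] with y hy hy2
          exact absurd hy2 (not_lt.2 hy.le)
        · filter_upwards [hnear δ hδ x h.symm] with y hy _ _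
          exact hy)
      (fun q hq _ _ => le_of_lt hq) hp hp0
    linarith
  have hall : ∀ p, p ≠ p₀ → u q₀ ≤ u p := by
    intro p hp
    rcases lt_trichotomy (gridNorm p) L with h | h | h
    · exact hinner p h hp
    · exact hmin h
    · exact houter p h
  -- As `q₀` is a global minimum, the one-point set `{q₀}` serves as the compact set, and the level
  -- `u q₀ + 1` leads to the absurd `u q₀ + 1 ≤ u q₀`.
  have := le_of_minimum_principle (D := {p₀}ᶜ) isOpen_compl_singleton
    (fun h => (h ▸ mem_univ p₀ : p₀ ∈ ({p₀}ᶜ : Set Surface)) rfl) (w := u) (a := u q₀ + 1)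
    (fun q hq => (hcont q hq).continuousWithinAt)
    (fun x hx => by
      rw [show x = p₀ from not_not.1 hx]
      exact hpole _)
    (isCompact_singleton (x := q₀)) (fun p hp _ => ⟨q₀, rfl, hS0 q₀ hq₀, hall p hp⟩)
    (fun q hq hm => by
      obtain ⟨z, rfl⟩ := surjective_proj q
      exact eventually_eq_of_harmonicAtUHP (hharm z hq) hm) q₀ (hS0 q₀ hq₀)
  linarith

end BPV

theorem proposition1p2 :
    HypSurface.IsHyperbolicSurface BPV.charts ∧
    HypSurface.IsParabolic BPV.charts ∧
    (∃ E : Set (Set BPV.Surface),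
      HypSurface.IsBoundedTriangulation BPV.charts E ∧
      ∀ a ∈ E, HypSurface.HasShear BPV.charts E a 0) ∧
    (∃ π : ℍ → BPV.Surface,
      HypSurface.IsUniformization BPV.charts π ∧
      HypSurface.coveringGroup π ≤ HypSurface.modularGroup) :=
  ⟨BPV.isHyperbolicSurface_charts, BPV.isParabolic_charts,
    ⟨BPV.edges, BPV.isBoundedTriangulation_edges, fun _ ha => BPV.hasShear_zero ha⟩,
    ⟨BPV.unif, BPV.isUniformization_unif, BPV.coveringGroup_unif_le⟩⟩
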